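/- **Setting.** Let $\kappa\ge 1$, $B=M_\kappa(\mathbb C)$ with unit $I$ and normalized trace $\tau$; $B^N=B^{\otimes N}$, $B^0=\mathbb C$, $I^j=I^{\otimes j}$. For $N\ge1$ let $\gamma_N$ be the left shift on $B^N$, $\gamma_N(a_1\otimes\dots\otimes a_N)=a_2\otimes\dots\otimes a_N\otimes a_1$, let $\overline\gamma_N=\frac1N\sum_{j=0}^{N-1}\gamma_N^j$ and let $B^N_\gamma=\overline\gamma_N(B^N)$, the $C^*$-algebra of $\gamma_N$-invariant elements. For $M\ge 0$ and $a\in B^M$ the *$\gamma$-sequence* of $a$ is $(\overline\gamma^M_N a)_{N\ge1}$ with $\overline\gamma^M_Na=\overline\gamma_N(I^{N-M}\otimes a)$ for $N\ge M$ and $0$ for $N<M$. Let $[B]_\sim$ be the $C^*$-algebra of bounded sequences $(a_N)_{N\ge1}$, $a_N\in B^N$, modulo those with $\|a_N\|\to0$, with norm $\|[a_N]_N\|=\limsup_N\|a_N\|$. Let $\dot B^\infty_\gamma$ be the $*$-algebra generated by the $\gamma$-sequences, $[\dot B]^\infty_\gamma\subset[B]_\sim$ the set of classes of its elements, and $[B]^\infty_\gamma$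 the closure of $[\dot B]^\infty_\gamma$ in $[B]_\sim$. Let $[B]_\gamma$ be the set of all $(A_N)_{N\in\mathbb N_{\ge1}\cup\{\infty\}}$ with $A_N\in B^N_\gamma$ for finite $N$ and $A_\infty\in[B]^\infty_\gamma$ such that for every $\varepsilon>0$ there are $(a_N)_N\in\dot B^\infty_\gamma$ and $N_\varepsilon$ with $\|A_N-a_N\|<\varepsilon$ for all finite $N\ge N_\varepsilon$ and $\|A_\infty-[a_N]_N\|<\varepsilon$. **Canonical representatives.** An element $a\in B^M$ is *irreducible* if $M=0$, or if $(\tau\otimes\omega)(a)=(\omega\otimes\tau)(a)=0$ for all states $\omega$ of $B^{M-1}$. For $\ell\ge1$ and irreducible $a_k\in B^{M_k}$, $k=1,\dots,\ell$, with $M_k\ge1$ for all $k$ if $\ell\ge2$, put $|M|=M_1+\dots+M_\ell$ and $$c_N(a_1,\dots,a_\ell)=\frac1{N^{\ell-1}}\sum_{j_1+\dots+j_\ell=N-|M|}\overline\gamma_N\Big(\frac1\ell\sum_{\varsigma\in\mathfrak S_\ell}I^{j_1}\otimes a_{\varsigma(1)}\otimes\dots\otimes I^{j_\ell}\otimes a_{\varsigma(\ell)}\Big)\quad(N\ge|M|),$$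 and $c_N(a_1,\dots,a_\ell)=0$ for $N<|M|$. A sequence $(a_N)_{N\ge1}$ is a *canonical representative* of $x\in[B]_\sim$ if there is a finite family of scalars $c_i$ and tuples $(a_{i,1},\dots,a_{i,\ell_i})$ as above with $x=\sum_i c_i\,[\overline\gamma_N^{M_{i,1}}a_{i,1}\cdots\overline\gamma_N^{M_{i,\ell_i}}a_{i,\ell_i}]_N$ and $a_N=\sum_i c_i\,c_N(a_{i,1},\dots,a_{i,\ell_i})$ for all $N\ge1$. **Theorem.** Every $x\in[\dot B]^\infty_\gamma$ has exactly one canonical representative $(x_N^{\mathrm{can}})_{N\ge1}$. There are a bilinear map $\{\,,\}_\gamma$ on $[\dot B]^\infty_\gamma$ with values in $[\dot B]^\infty_\gamma$ and linear maps $Q_N:[\dot B]^\infty_\gamma\to B^N_\gamma$, $N\ge 1$, given by $$\{x,y\}_\gamma=\big[\,iN(x_N^{\mathrm{can}}y_N^{\mathrm{can}}-y_N^{\mathrm{can}}x_N^{\mathrm{can}})\,\big]_N,\qquad Q_N(x)=x_N^{\mathrm{can}},$$ and together with $Q_\infty(x)=x$ they form a strict deformation quantization of $[B]^\infty_\gamma$,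 that is: 1. $[B]^\infty_\gamma$ is a commutative $C^*$-algebra, $[\dot B]^\infty_\gamma$ is a dense $*$-subalgebra of it, and $\{\,,\}_\gamma$ is a Poisson structure: it is skew-symmetric, $\{x,y\}_\gamma^*=\{x^*,y^*\}_\gamma$, it is a derivation in each argument, and it satisfies the Jacobi identity. 2. $[B]_\gamma$ is (the space of continuous sections of) a continuous bundle of $C^*$-algebras over $\mathbb N_{\ge1}\cup\{\infty\}$ with fibres $B^N_\gamma$ and $[B]^\infty_\gamma$: it is a $*$-algebra of sections, complete in the supremum norm, it is mapped onto each fibre by evaluation, it is closed under multiplication by convergent scalar sequences $(\alpha_N)_N$ with $\alpha_\infty=\lim_N\alpha_N$, and $\|A_N\|\to\|A_\infty\|$ for each of its elements. 3. $Q_N(x)^*=Q_N(x^*)$ for all $N$ and $x$, and $N\mapsto Q_N(x)$, $N\in\mathbb N_{\ge1}\cup\{\infty\}$, belongs to $[B]_\gamma$ for every $x$. 4. $\lim_{N\to\infty}\|Q_N(\{x,y\}_\gamma)-iN[Q_N(x),Q_N(y)]\|=0$ for all $x,y\in[\dot B]^\infty_\gamma$. 5. For every $N\ge1$ the image of $Q_N$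 is all of $B^N_\gamma$; in particular it is a dense $*$-subalgebra of $B^N_\gamma$. -/

import Mathlib

open scoped ENNReal Topology Matrix.Norms.L2Operator ComplexOrder
open Filter

noncomputable section

namespace AsympAlg

universe u

variable {A : ℕ+ → Type u} [∀ N, CStarAlgebra (A N)] [∀ N, Nontrivial (A N)]

variable (A) in
/-- The direct C⋆-sum: bounded sequences whose norms tend to zero, as a two-sided ideal of the full
C⋆-product `lp A ∞`. -/
def directSum : Ideal (lp A ∞) where
  carrier := {f | Tendsto (fun N => ‖f N‖) atTop (𝓝 0)}
  zero_mem' := by simp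
  add_mem' {f g} hf hg := by
    refine squeeze_zero (fun _ => norm_nonneg _) (fun N => norm_add_le (f N) (g N)) ?_
    simpa using hf.add hg
  smul_mem' c f hf := by
    refine squeeze_zero (fun _ => norm_nonneg _) (g := fun N => ‖c‖ * ‖f N‖) (fun N => ?_) ?_
    · exact (norm_mul_le (c N) (f N)).trans
        (mul_le_mul_of_nonneg_right (lp.norm_apply_le_norm ENNReal.top_ne_zero c N) (norm_nonneg _))
    · simpa using Tendsto.const_mul ‖c‖ hf

theorem mem_directSum {f : lp A ∞} :
    f ∈ directSum A ↔ Tendsto (fun N => ‖f N‖) atTop (𝓝 0) := Iff.rfl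

instance : (directSum A).IsTwoSided where
  mul_mem_of_left {f} c hf := by
    refine squeeze_zero (fun _ => norm_nonneg _) (g := fun N => ‖f N‖ * ‖c‖) (fun N => ?_) ?_
    · exact (norm_mul_le (f N) (c N)).trans
        (mul_le_mul_of_nonneg_left (lp.norm_apply_le_norm ENNReal.top_ne_zero c N) (norm_nonneg _))
    · simpa using Tendsto.mul_const ‖c‖ hf

theorem directSum_add_norm {f g : lp A ∞} (hg : g ∈ directSum A) {r : ℝ} (h : ‖f + g‖ < r) :
    ∀ᶠ N in atTop, ‖f N‖ < r := by
  have h1 : ∀ᶠ N in atTop, ‖g N‖ < r - ‖f + g‖ := by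
    have := (mem_directSum.1 hg).eventually (gt_mem_nhds (sub_pos.2 h))
    exact this
  filter_upwards [h1] with N hN
  have h2 : ‖(f + g) N‖ ≤ ‖f + g‖ := lp.norm_apply_le_norm ENNReal.top_ne_zero _ N
  have h3 : f N = (f + g) N - g N := by simp
  rw [h3]
  refine (norm_sub_le _ _).trans_lt ?_
  linarith

instance isClosed_directSum : IsClosed (directSum A : Set (lp A ∞)) := by
  refine isClosed_of_closure_subset fun f hf => ?_
  refine tendsto_order.2 ⟨fun a ha => Eventually.of_forall fun N => ha.trans_le (norm_nonneg _),
    fun a ha => ?_⟩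
  obtain ⟨g, hg, hfg⟩ := Metric.mem_closure_iff.1 hf a ha
  rw [dist_eq_norm, sub_eq_add_neg] at hfg
  exact directSum_add_norm ((directSum A).neg_mem hg) hfg


variable (A) in
/-- The quotient of the full C⋆-product by the direct C⋆-sum: equivalence classes of bounded
sequences modulo sequences whose norms tend to zero. -/
def AsympQuotient : Type u := lp A ∞ ⧸ directSum A

instance : NormedAddCommGroup (AsympQuotient A) :=
  inferInstanceAs (NormedAddCommGroup (lp A ∞ ⧸ directSum A))

instance : CompleteSpace (AsympQuotient A) :=
  inferInstanceAs (CompleteSpace (lp A ∞ ⧸ directSum A))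

instance : Ring (AsympQuotient A) := inferInstanceAs (Ring (lp A ∞ ⧸ directSum A))

instance : Algebra ℂ (AsympQuotient A) := inferInstanceAs (Algebra ℂ (lp A ∞ ⧸ directSum A))

/-- The class of a bounded sequence. -/
def mk : lp A ∞ →ₐ[ℂ] AsympQuotient A := Ideal.Quotient.mkₐ ℂ (directSum A)

theorem mk_surjective : Function.Surjective (mk : lp A ∞ → AsympQuotient A) :=
  Ideal.Quotient.mk_surjective

theorem mk_eq_mk {f g : lp A ∞} :
    mk f = mk g ↔ Tendsto (fun N => ‖f N - g N‖) atTop (𝓝 0) :=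
  Ideal.Quotient.eq

theorem norm_mk_le_of_eventually {f : lp A ∞} {r : ℝ} (hr : 0 ≤ r)
    (h : ∀ᶠ N in atTop, ‖f N‖ ≤ r) : ‖mk f‖ ≤ r := by
  classical
  obtain ⟨K, hK⟩ := eventually_atTop.1 h
  have hg : Memℓp (fun N => if K ≤ N then f N else 0) ∞ := by
    refine memℓp_infty ⟨‖f‖, ?_⟩
    rintro _ ⟨N, rfl⟩
    dsimp only
    split_ifs
    · exact lp.norm_apply_le_norm ENNReal.top_ne_zero f N
    · simp
  let g : lp A ∞ := ⟨_, hg⟩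
  have hfg : mk f = mk g := by
    refine mk_eq_mk.2 (tendsto_const_nhds.congr' ?_)
    filter_upwards [eventually_ge_atTop K] with N hN
    have : g N = f N := if_pos hN
    simp [this]
  have h1 : ‖mk g‖ ≤ ‖g‖ := Submodule.Quotient.norm_mk_le (directSum A) g
  rw [hfg]
  refine h1.trans (lp.norm_le_of_forall_le hr fun N => ?_)
  change ‖if K ≤ N then f N else 0‖ ≤ r
  split_ifs with hN
  · exact hK N hN
  · simpa using hr

theorem eventually_norm_lt_of_norm_mk_lt {f : lp A ∞} {r : ℝ} (h : ‖mk f‖ < r) :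
    ∀ᶠ N in atTop, ‖f N‖ < r := by
  obtain ⟨g, hg, hgr⟩ := Submodule.Quotient.norm_mk_lt (S := directSum A) (mk f)
    (sub_pos.2 h)
  have hfg : mk g = mk f := hg
  have h0 : g - f ∈ directSum A := mk_eq_mk.1 hfg
  refine directSum_add_norm h0 ?_
  have h1 : ‖g‖ < ‖mk f‖ + (r - ‖mk f‖) := hgr
  rw [add_sub_cancel] at h1
  simpa using h1

/-- The norm of a class is the limit superior of the norms along a representative. -/
theorem norm_mk (f : lp A ∞) : ‖mk f‖ = limsup (fun N => ‖f N‖) atTop := by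
  have hb : IsBoundedUnder (· ≤ ·) atTop (fun N => ‖f N‖) :=
    isBoundedUnder_of ⟨‖f‖, fun N => lp.norm_apply_le_norm ENNReal.top_ne_zero f N⟩
  have hc : IsCoboundedUnder (· ≤ ·) atTop (fun N => ‖f N‖) :=
    (isBoundedUnder_of ⟨0, fun N => norm_nonneg _⟩ :
      IsBoundedUnder (· ≥ ·) atTop (fun N => ‖f N‖)).isCoboundedUnder_le
  refine le_antisymm ?_ ?_
  · refine le_of_forall_gt_imp_ge_of_dense fun r hr => ?_
    have h := eventually_lt_of_limsup_lt hr hb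
    obtain ⟨N, hN⟩ := h.exists
    exact norm_mk_le_of_eventually ((norm_nonneg _).trans hN.le) (h.mono fun _ => le_of_lt)
  · refine le_of_forall_gt_imp_ge_of_dense fun r hr => ?_
    exact limsup_le_of_le hc ((eventually_norm_lt_of_norm_mk_lt hr).mono fun _ => le_of_lt)

instance : NormedRing (AsympQuotient A) where
  __ := (inferInstance : Ring (AsympQuotient A))
  __ := (inferInstance : NormedAddCommGroup (AsympQuotient A))
  norm_mul_le x y := by
    obtain ⟨f, rfl⟩ := mk_surjective x
    obtain ⟨g, rfl⟩ := mk_surjective y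
    have key : ∀ r > ‖mk f‖, ∀ s > ‖mk g‖, ‖mk f * mk g‖ ≤ r * s := fun r hr s hs => by
      rw [← map_mul]
      refine norm_mk_le_of_eventually
        (mul_nonneg ((norm_nonneg _).trans hr.le) ((norm_nonneg _).trans hs.le)) ?_
      filter_upwards [eventually_norm_lt_of_norm_mk_lt hr, eventually_norm_lt_of_norm_mk_lt hs]
        with N h1 h2
      exact (norm_mul_le (f N) (g N)).trans
        (mul_le_mul h1.le h2.le (norm_nonneg _) ((norm_nonneg _).trans hr.le))
    have ht : Tendsto (fun t : ℝ => (‖mk f‖ + t) * (‖mk g‖ + t)) (𝓝[>] 0) (𝓝 (‖mk f‖ * ‖mk g‖)) := by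
      have : Continuous fun t : ℝ => (‖mk f‖ + t) * (‖mk g‖ + t) := by fun_prop
      simpa using (this.tendsto 0).mono_left nhdsWithin_le_nhds
    refine ge_of_tendsto ht ?_
    filter_upwards [self_mem_nhdsWithin] with t ht
    exact key _ (lt_add_of_pos_right _ ht) _ (lt_add_of_pos_right _ ht)

instance : NormedAlgebra ℂ (AsympQuotient A) where
  norm_smul_le c x := by
    rcases eq_or_ne c 0 with rfl | hc
    · simp
    have hc' : 0 < ‖c‖ := norm_pos_iff.2 hc
    refine le_of_forall_gt_imp_ge_of_dense fun r hr => ?_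
    have hr0 : 0 ≤ r := (mul_nonneg (norm_nonneg _) (norm_nonneg _)).trans hr.le
    obtain ⟨f, rfl⟩ := mk_surjective x
    rw [← map_smul]
    refine norm_mk_le_of_eventually hr0 ?_
    have h1 : ‖mk f‖ < r / ‖c‖ := by rwa [lt_div_iff₀' hc']
    filter_upwards [eventually_norm_lt_of_norm_mk_lt h1] with N hN
    rw [lt_div_iff₀' hc'] at hN
    exact (norm_smul_le c (f N)).trans hN.le

instance : StarRing (AsympQuotient A) where
  star := Quotient.map' star fun f g h => by
    change (directSum A).quotientRel f g at h
    rw [Submodule.quotientRel_def] at h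
    change (directSum A).quotientRel (star f) (star g)
    rw [Submodule.quotientRel_def, mem_directSum, ← star_sub]
    have h1 : ∀ N, ‖(star (f - g)) N‖ = ‖(f - g) N‖ := fun N => norm_star ((f - g) N)
    simp only [h1]
    exact mem_directSum.1 h
  star_involutive x := by
    obtain ⟨f, rfl⟩ := mk_surjective x
    exact congrArg mk (star_star f)
  star_mul x y := by
    obtain ⟨f, rfl⟩ := mk_surjective x
    obtain ⟨g, rfl⟩ := mk_surjective y
    exact congrArg mk (star_mul f g)
  star_add x y := by
    obtain ⟨f, rfl⟩ := mk_surjective x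
    obtain ⟨g, rfl⟩ := mk_surjective y
    exact congrArg mk (star_add f g)

theorem star_mk (f : lp A ∞) : star (mk f) = mk (star f) := rfl

instance : CStarAlgebra (AsympQuotient A) where
  norm_mul_self_le x := by
    obtain ⟨f, rfl⟩ := mk_surjective x
    refine le_of_forall_gt_imp_ge_of_dense fun r hr => ?_
    rw [star_mk, ← map_mul] at hr
    have hr0 : 0 ≤ r := (norm_nonneg _).trans hr.le
    have h : ‖mk f‖ ≤ √r := by
      refine norm_mk_le_of_eventually (Real.sqrt_nonneg r) ?_
      filter_upwards [eventually_norm_lt_of_norm_mk_lt hr] with N hN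
      have h1 : ‖(star f * f) N‖ = ‖f N‖ * ‖f N‖ := CStarRing.norm_star_mul_self (x := f N)
      rw [h1] at hN
      exact Real.le_sqrt_of_sq_le (by rw [sq]; exact hN.le)
    calc ‖mk f‖ * ‖mk f‖ ≤ √r * √r := mul_self_le_mul_self (norm_nonneg _) h
      _ = r := Real.mul_self_sqrt hr0
  star_smul c x := by
    obtain ⟨f, rfl⟩ := mk_surjective x
    exact congrArg mk (star_smul c f)

/-- The class of a bounded sequence, as a unital ⋆-homomorphism. -/
def mkStar : lp A ∞ →⋆ₐ[ℂ] AsympQuotient A where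
  __ := mk
  map_star' _ := rfl

end AsympAlg

/-! ### Strict deformation quantizations over `ℕ ∪ {∞}`

The base is the one-point compactification of the positive integers. A family of fibres over it is
given by `A N` for `N : ℕ+` and by `Ainf` over the point `∞`; a section is an element of
`(∀ N, A N) × Ainf`. -/

section Quantization

universe u v

/-- A Poisson structure on the C⋆-algebra `A` with domain the dense ⋆-subalgebra `A₀`. -/
structure IsPoissonStructure {A : Type v} [CStarAlgebra A] (A₀ : StarSubalgebra ℂ A)
    (br : A₀ →ₗ[ℂ] A₀ →ₗ[ℂ] A₀) : Prop where
  dense : Dense (A₀ : Set A)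
  skew : ∀ a b, br a b = -br b a
  star_apply : ∀ a b, star (br a b) = br (star a) (star b)
  leibniz : ∀ a b c, br a (b * c) = br a b * c + b * br a c
  jacobi : ∀ a b c, br a (br b c) = br (br a b) c + br b (br a c)

/-- `S` is the space of continuous sections of a continuous bundle of C⋆-algebras with fibres
`A N` and `Ainf`: it is a ⋆-algebra of sections that is mapped onto every fibre by evaluation, is
complete for the supremum norm, is a module over the continuous functions on `ℕ ∪ {∞}`, and
consists of sections whose norm is a continuous function on `ℕ ∪ {∞}` (in particular bounded). -/
structure IsContinuousBundle {A : ℕ+ → Type u} [∀ N, CStarAlgebra (A N)]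
    {Ainf : Type v} [CStarAlgebra Ainf] (S : Set ((∀ N, A N) × Ainf)) : Prop where
  isStarSubalgebra : ∃ T : StarSubalgebra ℂ ((∀ N, A N) × Ainf), (T : Set ((∀ N, A N) × Ainf)) = S
  eval_surjective : ∀ N, ∀ x : A N, ∃ s ∈ S, s.1 N = x
  eval_infty_surjective : ∀ x : Ainf, ∃ s ∈ S, s.2 = x
  complete : ∀ s : (∀ N, A N) × Ainf,
    (∀ ε : ℝ, 0 < ε → ∃ t ∈ S, (∀ N, ‖s.1 N - t.1 N‖ < ε) ∧ ‖s.2 - t.2‖ < ε) → s ∈ S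
  smul_mem : ∀ (α : ℕ+ → ℂ) (αinf : ℂ), Tendsto α atTop (𝓝 αinf) →
    ∀ s ∈ S, ((fun N => α N • s.1 N, αinf • s.2) : (∀ N, A N) × Ainf) ∈ S
  norm_continuous : ∀ s ∈ S, Tendsto (fun N => ‖s.1 N‖) atTop (𝓝 ‖s.2‖)

/-- A strict deformation quantization of the C⋆-algebra `Ainf`: this algebra is commutative, it
carries a Poisson structure `br` on the dense ⋆-subalgebra `A₀`, it is the fibre at `∞` of the
continuous bundle with fibres `A N` and continuous sections `S`, and the linear maps
`Q N : A₀ → A N` and `Qinf : A₀ → Ainf` are quantization maps. -/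
structure IsStrictDeformationQuantization {A : ℕ+ → Type u} [∀ N, CStarAlgebra (A N)]
    {Ainf : Type v} [CStarAlgebra Ainf] (A₀ : StarSubalgebra ℂ Ainf)
    (br : A₀ →ₗ[ℂ] A₀ →ₗ[ℂ] A₀) (S : Set ((∀ N, A N) × Ainf))
    (Q : ∀ N, A₀ →ₗ[ℂ] A N) (Qinf : A₀ →ₗ[ℂ] Ainf) : Prop where
  commutative : ∀ a b : Ainf, a * b = b * a
  poisson : IsPoissonStructure A₀ br
  bundle : IsContinuousBundle S
  infty_apply : ∀ a, Qinf a = a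
  hermitian : ∀ N a, Q N (star a) = star (Q N a)
  continuous_section : ∀ a, (fun N => Q N a, Qinf a) ∈ S
  dirac_groenewold_rieffel : ∀ a b, Tendsto (fun N : ℕ+ =>
    ‖Q N (br a b) - (Complex.I * ((N : ℕ) : ℂ)) • (Q N a * Q N b - Q N b * Q N a)‖) atTop (𝓝 0)
  strict : ∀ N, (∃ T : StarSubalgebra ℂ (A N), (T : Set (A N)) = Set.range (Q N)) ∧
    Dense (Set.range (Q N))

end Quantization

/-! ### The spin chain -/

namespace SpinChain

/-- `B^N = B ⊗ ⋯ ⊗ B` (`N` factors) for `B = M_κ(ℂ)`, realized as the algebra of matrices with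
rows and columns indexed by `{0, …, κ - 1}^N`, with its C⋆-norm. -/
abbrev TensorPow (κ N : ℕ) : Type := Matrix (Fin N → Fin κ) (Fin N → Fin κ) ℂ

variable {κ : ℕ}

/-- The elementary tensor `a 0 ⊗ ⋯ ⊗ a (N - 1)`. -/
def elementary {N : ℕ} (a : Fin N → Matrix (Fin κ) (Fin κ) ℂ) : TensorPow κ N :=
  Matrix.of fun s t => ∏ i, a i (s i) (t i)

/-- The tensor product `B^m × B^n → B^(m+n)`. -/
def tmul {m n : ℕ} (x : TensorPow κ m) (y : TensorPow κ n) : TensorPow κ (m + n) :=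
  (Matrix.kroneckerMap (· * ·) x y).submatrix (Fin.appendEquiv m n).symm (Fin.appendEquiv m n).symm

/-- The identification `B^m = B^n` for `m = n`. -/
def castTensorPow {m n : ℕ} (h : m = n) (x : TensorPow κ m) : TensorPow κ n :=
  Matrix.of fun s t => x (fun i => s (Fin.cast h i)) (fun i => t (Fin.cast h i))

theorem tmul_apply {m n : ℕ} (x : TensorPow κ m) (y : TensorPow κ n) (s t : Fin (m + n) → Fin κ) :
    tmul x y s t = x (fun i => s (Fin.castAdd n i)) (fun i => t (Fin.castAdd n i)) *
      y (fun i => s (Fin.natAdd m i)) (fun i => t (Fin.natAdd m i)) := rfl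

theorem tmul_elementary {m n : ℕ} (a : Fin m → Matrix (Fin κ) (Fin κ) ℂ)
    (b : Fin n → Matrix (Fin κ) (Fin κ) ℂ) :
    tmul (elementary a) (elementary b) = elementary (Fin.append a b) := by
  ext s t
  simp [tmul_apply, elementary, Fin.prod_univ_add]

theorem one_tmul_mul {m n : ℕ} (x y : TensorPow κ n) :
    tmul (1 : TensorPow κ m) (x * y) = tmul (1 : TensorPow κ m) x * tmul (1 : TensorPow κ m) y := by
  unfold tmul
  rw [Matrix.submatrix_mul_equiv, ← Matrix.mul_kronecker_mul, one_mul]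

theorem one_tmul_one {m n : ℕ} : tmul (1 : TensorPow κ m) (1 : TensorPow κ n) = 1 := by
  unfold tmul
  have : Matrix.kroneckerMap (· * ·) (1 : TensorPow κ m) (1 : TensorPow κ n) = 1 := Matrix.one_kronecker_one
  rw [this, Matrix.submatrix_one_equiv]

theorem castTensorPow_mul {m n : ℕ} (h : m = n) (x y : TensorPow κ m) :
    castTensorPow h (x * y) = castTensorPow h x * castTensorPow h y := by subst h; rfl

theorem castTensorPow_one {m n : ℕ} (h : m = n) : castTensorPow h (1 : TensorPow κ m) = 1 := by subst h; rfl

/-- The embedding `a ↦ I^{N-M} ⊗ a` of `B^M` into `B^N` for `M ≤ N`. -/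
def leftPad {M N : ℕ} (h : M ≤ N) : TensorPow κ M →⋆ₐ[ℂ] TensorPow κ N where
  toFun a := castTensorPow (Nat.sub_add_cancel h) (tmul (1 : TensorPow κ (N - M)) a)
  map_one' := by rw [one_tmul_one, castTensorPow_one]
  map_mul' x y := by rw [one_tmul_mul, castTensorPow_mul]
  map_zero' := by ext s t; simp [castTensorPow, tmul_apply]
  map_add' x y := by ext s t; simp [castTensorPow, tmul_apply, mul_add]
  commutes' c := by
    have : ∀ x : TensorPow κ M, castTensorPow (Nat.sub_add_cancel h) (tmul (1 : TensorPow κ (N - M)) (c • x)) =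
        c • castTensorPow (Nat.sub_add_cancel h) (tmul (1 : TensorPow κ (N - M)) x) := fun x => by
      ext s t; simp [castTensorPow, tmul_apply]; ring
    rw [Algebra.algebraMap_eq_smul_one, this, one_tmul_one, castTensorPow_one,
      Algebra.algebraMap_eq_smul_one]
  map_star' x := by
    ext s t
    simp only [castTensorPow, Matrix.of_apply, tmul_apply, Matrix.star_apply, Matrix.one_apply, star_mul',
      eq_comm]
    split_ifs <;> simp

/-- The left shift `γ_N` on `B^N`: it maps `a_1 ⊗ a_2 ⊗ ⋯ ⊗ a_N` to `a_2 ⊗ ⋯ ⊗ a_N ⊗ a_1`. -/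
def shift (N : ℕ) : TensorPow κ N →⋆ₐ[ℂ] TensorPow κ N where
  toFun x := Matrix.of fun s t =>
    x (fun i => s ((finRotate N).symm i)) (fun i => t ((finRotate N).symm i))
  map_one' := by
    exact Matrix.submatrix_one_equiv ((finRotate N).arrowCongr (Equiv.refl (Fin κ)))
  map_mul' x y := by
    exact (Matrix.submatrix_mul_equiv x y _
      ((finRotate N).arrowCongr (Equiv.refl (Fin κ))) _).symm
  map_zero' := rfl
  map_add' _ _ := rfl
  commutes' c := by
    have := congrArg (c • ·)
      (Matrix.submatrix_one_equiv (α := ℂ) ((finRotate N).arrowCongr (Equiv.refl (Fin κ))))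
    rw [Algebra.algebraMap_eq_smul_one]
    exact this
  map_star' _ := rfl

theorem shift_elementary {N : ℕ} (a : Fin N → Matrix (Fin κ) (Fin κ) ℂ) :
    shift N (elementary a) = elementary fun i => a (finRotate N i) := by
  ext s t
  change ∏ i, a i (s ((finRotate N).symm i)) (t ((finRotate N).symm i)) =
    ∏ i, a (finRotate N i) (s i) (t i)
  rw [← Equiv.prod_comp (finRotate N)]
  simp only [Equiv.symm_apply_apply]

/-- The averaged shift `(1/N) ∑_{j<N} γ_N^j`. -/
def avg (N : ℕ) : TensorPow κ N →ₗ[ℂ] TensorPow κ N where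
  toFun x := ((N : ℂ)⁻¹) • ∑ j ∈ Finset.range N, (shift N)^[j] x
  map_add' x y := by
    simp only [iterate_map_add, Finset.sum_add_distrib, smul_add]
  map_smul' c x := by
    have : ∀ j, (shift N)^[j] (c • x) = c • (shift N)^[j] x := fun j => by
      induction j with
      | zero => rfl
      | succ j ih => rw [Function.iterate_succ_apply', ih, map_smul, Function.iterate_succ_apply']
    simp only [this, ← Finset.smul_sum, RingHom.id_apply]
    rw [smul_comm]

theorem shift_iterate_self (N : ℕ) (x : TensorPow κ N) : (shift N)^[N] x = x := by
  have key : ∀ j, (shift N)^[j] x = Matrix.of fun s t =>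
      x (fun i => s ((finRotate N).symm^[j] i)) (fun i => t ((finRotate N).symm^[j] i)) := fun j => by
    induction j with
    | zero => rfl
    | succ j ih =>
      rw [Function.iterate_succ_apply', ih]
      ext s t
      simp only [shift, Function.iterate_succ_apply']
      rfl
  have hrot : ∀ i, (finRotate N).symm^[N] i = i := fun i => by
    rcases N with _ | n
    · exact i.elim0
    · have h : ∀ j : ℕ, ((finRotate (n + 1))^[j] i).val = (i.val + j) % (n + 1) := fun j => by
        induction j with
        | zero => simp [Nat.mod_eq_of_lt i.isLt]
        | succ j ih =>
          rw [Function.iterate_succ_apply', finRotate_apply, Fin.val_add, ih]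
          rw [Fin.val_one', ← Nat.add_mod, add_assoc]
      have h1 : (finRotate (n + 1))^[n + 1] i = i := by
        ext
        rw [h, Nat.add_mod_right, Nat.mod_eq_of_lt i.isLt]
      have h2 := Function.LeftInverse.iterate (finRotate (n + 1)).symm_apply_apply (n + 1) i
      rwa [h1] at h2
  rw [key]
  simp only [hrot]
  rfl

theorem shift_avg {N : ℕ} (x : TensorPow κ N) : shift N (avg N x) = avg N x := by
  change shift N (((N : ℂ)⁻¹) • ∑ j ∈ Finset.range N, (shift N)^[j] x) =
    ((N : ℂ)⁻¹) • ∑ j ∈ Finset.range N, (shift N)^[j] x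
  rw [map_smul, map_sum]
  congr 1
  simp only [← Function.iterate_succ_apply' (shift N)]
  have h1 := Finset.sum_range_succ (fun j => (shift N)^[j] x) N
  have h2 := Finset.sum_range_succ' (fun j => (shift N)^[j] x) N
  rw [h1, shift_iterate_self] at h2
  exact (add_right_cancel h2).symm

theorem avg_of_shift_eq {N : ℕ} (hN : N ≠ 0) {x : TensorPow κ N} (hx : shift N x = x) :
    avg N x = x := by
  change ((N : ℂ)⁻¹) • ∑ j ∈ Finset.range N, (shift N)^[j] x = x
  have h : ∀ j, (shift N)^[j] x = x := fun j => Function.iterate_fixed hx j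
  simp only [h, Finset.sum_const, Finset.card_range]
  rw [← Nat.cast_smul_eq_nsmul ℂ, smul_smul, inv_mul_cancel₀ (Nat.cast_ne_zero.2 hN), one_smul]

theorem norm_avg_le {N : ℕ} (x : TensorPow κ N) : ‖avg N x‖ ≤ ‖x‖ := by
  have h : ∀ j, ‖(shift N)^[j] x‖ ≤ ‖x‖ := fun j => by
    induction j with
    | zero => exact le_rfl
    | succ j ih =>
      rw [Function.iterate_succ_apply']
      exact (NonUnitalStarAlgHom.norm_apply_le (shift N) _).trans ih
  change ‖((N : ℂ)⁻¹) • ∑ j ∈ Finset.range N, (shift N)^[j] x‖ ≤ ‖x‖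
  rw [norm_smul, norm_inv, Complex.norm_natCast]
  rcases Nat.eq_zero_or_pos N with rfl | hN
  · simp
  have hN' : (0 : ℝ) < N := Nat.cast_pos.2 hN
  rw [inv_mul_le_iff₀ hN']
  calc ‖∑ j ∈ Finset.range N, (shift N)^[j] x‖ ≤ ∑ j ∈ Finset.range N, ‖x‖ :=
        norm_sum_le_of_le _ fun j _ => h j
    _ = N * ‖x‖ := by simp

theorem mem_range_avg {N : ℕ+} {x : TensorPow κ N} :
    x ∈ Set.range (avg (κ := κ) N) ↔ shift N x = x :=
  ⟨fun ⟨y, hy⟩ => hy ▸ shift_avg y, fun hx => ⟨x, avg_of_shift_eq N.ne_zero hx⟩⟩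

variable (κ) in
/-- `B^N_γ`, the range of the averaged shift on `B^N` (for `N ≥ 1`), as a ⋆-subalgebra. -/
def Inv (N : ℕ+) : StarSubalgebra ℂ (TensorPow κ N) where
  carrier := Set.range (avg N)
  mul_mem' hx hy := by
    rw [mem_range_avg] at *
    rw [map_mul, hx, hy]
  one_mem' := mem_range_avg.2 (map_one _)
  add_mem' hx hy := by
    rw [mem_range_avg] at *
    rw [map_add, hx, hy]
  zero_mem' := mem_range_avg.2 (map_zero _)
  algebraMap_mem' c := mem_range_avg.2 (AlgHomClass.commutes _ c)
  star_mem' hx := by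
    rw [mem_range_avg] at *
    rw [map_star, hx]

instance isClosed_inv (N : ℕ+) : IsClosed (Inv κ N : Set (TensorPow κ N)) :=
  Submodule.closed_of_finiteDimensional (LinearMap.range (avg (κ := κ) N))

/-! ### `γ`-sequences and the sequences that serve as canonical representatives -/

/-- `γ̄^M_N a = γ̄_N (I^{N-M} ⊗ a)` for `M ≤ N`, and `0` for `N < M`. -/
def gammaBar {M : ℕ} (a : TensorPow κ M) (N : ℕ) : TensorPow κ N :=
  if h : M ≤ N then avg N (leftPad h a) else 0

theorem norm_gammaBar_le {M : ℕ} (a : TensorPow κ M) (N : ℕ) : ‖gammaBar a N‖ ≤ ‖a‖ := by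
  unfold gammaBar
  split_ifs with h
  · exact (norm_avg_le _).trans (NonUnitalStarAlgHom.norm_apply_le (leftPad h) a)
  · simp

/-- States of `B^N`: normalized positive linear functionals. -/
structure IsState {N : ℕ} (ω : TensorPow κ N →ₗ[ℂ] ℂ) : Prop where
  map_one : ω 1 = 1
  nonneg : ∀ x, 0 ≤ ω (star x * x)

/-- The slice map `τ ⊗ id : B^(M+1) → B^M`, where `τ` is the normalized trace of `B`, so that
`ω ((τ ⊗ id) a) = (τ ⊗ ω) a` for every functional `ω` on `B^M`. -/
def traceLeft {M : ℕ} (a : TensorPow κ (M + 1)) : TensorPow κ M :=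
  Matrix.of fun s t => (κ : ℂ)⁻¹ * ∑ i : Fin κ, a (Fin.cons i s) (Fin.cons i t)

/-- The slice map `id ⊗ τ : B^(M+1) → B^M`, where `τ` is the normalized trace of `B`, so that
`ω ((id ⊗ τ) a) = (ω ⊗ τ) a` for every functional `ω` on `B^M`. -/
def traceRight {M : ℕ} (a : TensorPow κ (M + 1)) : TensorPow κ M :=
  Matrix.of fun s t => (κ : ℂ)⁻¹ * ∑ i : Fin κ, a (Fin.snoc s i) (Fin.snoc t i)

/-- `a ∈ B^M` is irreducible if `M = 0`, or `(τ ⊗ ω) a = (ω ⊗ τ) a = 0` for all states `ω` of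
`B^(M-1)`. -/
def IsIrr : {M : ℕ} → TensorPow κ M → Prop
  | 0, _ => True
  | _ + 1, a => ∀ ω : TensorPow κ _ →ₗ[ℂ] ℂ, IsState ω → ω (traceLeft a) = 0 ∧ ω (traceRight a) = 0

/-- For a list of pairs `(j_1, a_1), …, (j_ℓ, a_ℓ)` with `a_k ∈ B^{M_k}`, the tensor
`I^{j_1} ⊗ a_1 ⊗ ⋯ ⊗ I^{j_ℓ} ⊗ a_ℓ`, together with its number of factors. -/
def interleave : List (ℕ × Σ M, TensorPow κ M) → Σ n, TensorPow κ n
  | [] => ⟨0, 1⟩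
  | (j, a) :: L =>
    ⟨j + a.1 + (interleave L).1, tmul (tmul (1 : TensorPow κ j) a.2) (interleave L).2⟩

/-- View a tensor with `n` factors as an element of `B^N` if `n = N` (and `0` otherwise). -/
def toTensorPow (N : ℕ) (x : Σ n, TensorPow κ n) : TensorPow κ N :=
  if h : x.1 = N then castTensorPow h x.2 else 0

variable (κ) in
/-- A nonempty finite family `a_1, …, a_ℓ` of irreducible elements `a_k ∈ B^{M_k}`; scalars
(`M_k = 0`) are allowed only for `ℓ = 1`. -/
structure IrrFamily where
  len : ℕ
  len_pos : 0 < len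
  factor : Fin len → Σ M, TensorPow κ M
  irr : ∀ k, IsIrr (factor k).2
  degree_pos : 1 < len → ∀ k, 0 < (factor k).1

namespace IrrFamily

/-- `|M|_ℓ = M_1 + ⋯ + M_ℓ`. -/
def degree (F : IrrFamily κ) : ℕ := ∑ k, (F.factor k).1

/-- The total weighted symmetrization
`(1/ℓ) ∑_σ I^{j_1} ⊗ a_{σ 1} ⊗ ⋯ ⊗ I^{j_ℓ} ⊗ a_{σ ℓ}` as an element of `B^N`, for
`j_1 + ⋯ + j_ℓ = N - |M|_ℓ`. -/
def symm (F : IrrFamily κ) (N : ℕ) (j : Fin F.len → ℕ) : TensorPow κ N :=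
  (F.len : ℂ)⁻¹ • ∑ σ : Equiv.Perm (Fin F.len),
    toTensorPow N (interleave (List.ofFn fun k => (j k, F.factor (σ k))))

/-- The sequence `N ↦ N^{-(ℓ-1)} ∑_{|j|_ℓ = N - |M|_ℓ} γ̄_N (symm N j)` for `N ≥ |M|_ℓ`, and `0`
for `N < |M|_ℓ`. -/
def canonicalSeq (F : IrrFamily κ) (N : ℕ+) : TensorPow κ N :=
  if F.degree ≤ N then
    (((N : ℕ) : ℂ) ^ (F.len - 1))⁻¹ •
      ∑ j ∈ Finset.piAntidiag Finset.univ ((N : ℕ) - F.degree), avg N (F.symm N j)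
  else 0

end IrrFamily

/-! ### Classes of sequences and the classical algebra -/

variable (κ) [NeZero κ]

/-- The full C⋆-product: bounded sequences `(a_N)_{N ≥ 1}` with `a_N ∈ B^N`. -/
abbrev BddSeq : Type := lp (fun N : ℕ+ => TensorPow κ N) ∞

/-- The C⋆-algebra `[B]_∼` of equivalence classes of bounded sequences. -/
abbrev ClassAlg : Type := AsympAlg.AsympQuotient (fun N : ℕ+ => TensorPow κ N)

variable {κ}

/-- The sequence `a` is bounded and its equivalence class is `x`. -/
def HasClass (a : ∀ N : ℕ+, TensorPow κ N) (x : ClassAlg κ) : Prop :=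
  ∃ f : BddSeq κ, (∀ N, f N = a N) ∧ AsympAlg.mk f = x

/-- The `γ`-sequence `(γ̄^M_N a)_N`. -/
def gammaSeq {M : ℕ} (a : TensorPow κ M) : BddSeq κ :=
  ⟨fun N => gammaBar a N, memℓp_infty ⟨‖a‖, by rintro _ ⟨N, rfl⟩; exact norm_gammaBar_le a N⟩⟩

variable (κ)

/-- The ⋆-algebra of sequences generated by the `γ`-sequences. -/
def GammaSeqAlg : StarSubalgebra ℂ (BddSeq κ) :=
  StarAlgebra.adjoin ℂ {f | ∃ (M : ℕ) (a : TensorPow κ M), f = gammaSeq a}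

/-- The ⋆-algebra of classes of elements of `GammaSeqAlg`. -/
def GammaClassAlg : StarSubalgebra ℂ (ClassAlg κ) := (GammaSeqAlg κ).map AsympAlg.mkStar

/-- `[B]^∞_γ`: the norm closure of the ⋆-algebra of classes of elements of `GammaSeqAlg`. -/
def Binf : StarSubalgebra ℂ (ClassAlg κ) := (GammaClassAlg κ).topologicalClosure

instance isClosed_binf : IsClosed (Binf κ : Set (ClassAlg κ)) :=
  (GammaClassAlg κ).isClosed_topologicalClosure

/-- `GammaClassAlg`, regarded as a ⋆-subalgebra of its closure `[B]^∞_γ`. -/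
def BinfDense : StarSubalgebra ℂ (Binf κ) := (GammaClassAlg κ).comap (Binf κ).subtype

/-- The sections `N ↦ a_N`, `∞ ↦ [a_N]_N`, for `(a_N)_N` in `GammaSeqAlg`. -/
def gammaSections : Set ((∀ N : ℕ+, Inv κ N) × Binf κ) :=
  {A | ∃ a ∈ GammaSeqAlg κ, (∀ N : ℕ+, (A.1 N : TensorPow κ N) = a N) ∧ (A.2 : ClassAlg κ) = AsympAlg.mk a}

/-- The bundle `[B]_γ`: the sections of `N ↦ B^N_γ`, `∞ ↦ [B]^∞_γ` which, near `∞`, are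
approximated in norm by elements of `gammaSections`. -/
def gammaBundle : Set ((∀ N : ℕ+, Inv κ N) × Binf κ) :=
  {A | ∀ ε : ℝ, 0 < ε → ∃ K : ℕ+, ∃ A' ∈ gammaSections κ,
    (∀ N : ℕ+, K ≤ N → ‖A.1 N - A'.1 N‖ < ε) ∧ ‖A.2 - A'.2‖ < ε}

/-! ### Canonical representatives, quantization maps and Poisson bracket -/

variable {κ}

namespace IrrFamily

/-- The class `[γ̄^{M_1}_N a_1 ⋯ γ̄^{M_ℓ}_N a_ℓ]_N`. -/
def productClass (F : IrrFamily κ) : ClassAlg κ :=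
  AsympAlg.mk (List.ofFn fun k => gammaSeq (F.factor k).2).prod

end IrrFamily

/-- The sequence `a` is a canonical representative of the class `x`. -/
def IsCanonicalRep (a : ∀ N : ℕ+, TensorPow κ N) (x : ClassAlg κ) : Prop :=
  ∃ (n : ℕ) (c : Fin n → ℂ) (F : Fin n → IrrFamily κ),
    x = ∑ i, c i • (F i).productClass ∧ ∀ N, a N = ∑ i, c i • (F i).canonicalSeq N

/-- The linear maps `Q N` send a class to the `N`-th entry of its canonical representative. -/
def IsGammaQuantization (Q : ∀ N : ℕ+, BinfDense κ →ₗ[ℂ] Inv κ N) : Prop :=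
  ∀ x : BinfDense κ, IsCanonicalRep (fun N => (Q N x : TensorPow κ N)) ((x : Binf κ) : ClassAlg κ)

/-- The bilinear map `br` is the bracket `{x, y}_γ = [i N [a_N, b_N]]_N`, where `(a_N)_N` and
`(b_N)_N` are the canonical representatives of `x` and `y`. -/
def IsGammaBracket (br : BinfDense κ →ₗ[ℂ] BinfDense κ →ₗ[ℂ] BinfDense κ) : Prop :=
  ∀ (x y : BinfDense κ) (a b : ∀ N : ℕ+, TensorPow κ N),
    IsCanonicalRep a ((x : Binf κ) : ClassAlg κ) → IsCanonicalRep b ((y : Binf κ) : ClassAlg κ) →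
      HasClass (fun N => (Complex.I * ((N : ℕ) : ℂ)) • (a N * b N - b N * a N))
        ((br x y : Binf κ) : ClassAlg κ)

end SpinChain

end

noncomputable section

namespace SpinChain

variable {κ : ℕ}

/-! ### Local embeddings -/

section Embedding

set_option linter.unusedSectionVars false

variable {α β γ : Type} [Fintype α] [Fintype β] [Fintype γ] [DecidableEq α] [DecidableEq β]
  [DecidableEq γ]

/-! The proof takes place in the algebra `LocalAlg` of local sequences, which for large N are
polynomials in γ-sequences and in 1/N. Operators far apart on the chain commute, so in N[f, g] one
sum over positions collapses to boundedly many relative positions and the rescaled commutator of two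
local sequences is local again (`IsLocalSeq.commutator`). For a similar reason averages over
positions of products of placed operators, with finitely many coincidences of positions excluded,
are local (`LocalFamily.avg_all`). A canonical sequence is a normalized sum over all non-overlapping
placements of its factors (`IrrFamily.canonicalSeq_eq`); so it is local, and its class is the
product of the classes of the factors, because overlaps form a fraction O(1/N) of all placements.

Local sequences modulo those of order 1/N therefore form a commutative algebra `LeadAlg`. Splitting
off partial traces at the two end sites shows that it is generated by a basis of the irreducible
elements, so polynomials in this basis map onto it (`leadPoly_surjective`). The decisive fact is
that a polynomial P whose class vanishes is zero (`leadClass_leadPoly_injective`). It is tested on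
periodic product states: γ-averages have dispersion O(1/N) in them, so the expectation of a local
sequence is asymptotically P evaluated at the expectations of the γ-averages
(`IsDispersionFree.tendsto_sub_eval`). Densities close to the unit, perturbed by elements dual to
the basis under the trace, produce enough points to force P = 0.

Hence polynomials parametrize the dense algebra, which is existence and uniqueness of canonical
representatives. Moreover a local sequence of class zero has order 1/N, so iN[f, g] passes to
classes, and the Poisson identities are inherited from commutators. Every invariant element of B^N
is its own γ-average, hence a scalar plus γ-averages of irreducible elements, which gives
surjectivity of the quantization maps.

Continuity of the norm at infinity also uses periodic states. A character attaining the norm of a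
class is approximated on finitely many γ-sequences by a vector state of a finite chain
(`exists_vector_of_character`); its periodic repetition bounds the norms on all long chains from
below. -/

variable (κ) in
/-- The algebra `B^{⊗ α}` of matrices with rows and columns indexed by configurations on the
finite set of sites `α`. -/
abbrev SiteMat (α : Type) : Type := Matrix (α → Fin κ) (α → Fin κ) ℂ

open Classical in
/-- Relabelling of sites along `f : α → β`, filling up the remaining sites with the unit. -/
def emb (f : α → β) : SiteMat κ α →ₗ[ℂ] SiteMat κ β where
  toFun x := Matrix.of fun s t =>
    if ∀ b, b ∉ Set.range f → s b = t b then x (s ∘ f) (t ∘ f) else 0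
  map_add' x y := by
    ext s t
    simp only [Matrix.of_apply, Matrix.add_apply]
    split_ifs <;> simp
  map_smul' c x := by
    ext s t
    simp only [Matrix.of_apply, Matrix.smul_apply, RingHom.id_apply]
    split_ifs <;> simp

theorem emb_apply (f : α → β) (x : SiteMat κ α) (s t : β → Fin κ)
    [Decidable (∀ b, b ∉ Set.range f → s b = t b)] :
    emb f x s t = if ∀ b, b ∉ Set.range f → s b = t b then x (s ∘ f) (t ∘ f) else 0 := by
  simp only [emb, LinearMap.coe_mk, AddHom.coe_mk, Matrix.of_apply]
  split_ifs <;> rfl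

theorem emb_apply_of_surjective {f : α → β} (hf : Function.Surjective f) (x : SiteMat κ α)
    (s t : β → Fin κ) : emb f x s t = x (s ∘ f) (t ∘ f) := by
  classical
  rw [emb_apply, if_pos]
  intro b hb
  exact absurd (hf b) hb

theorem emb_id (x : SiteMat κ α) : emb (fun i => i) x = x := by
  ext s t
  rw [emb_apply_of_surjective fun i => ⟨i, rfl⟩]
  rfl

/-- Injectivity of `g` is what prevents a site outside the range of `f` from being identified with a
site inside it, where the diagonal constraint would be lost. -/
theorem emb_emb {g : β → γ} (hg : Function.Injective g) (f : α → β) (x : SiteMat κ α) :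
    emb g (emb f x) = emb (fun i => g (f i)) x := by
  classical
  ext s t
  simp only [emb_apply]
  by_cases h1 : ∀ c, c ∉ Set.range g → s c = t c
  · rw [if_pos h1]
    refine if_congr ⟨fun h c hc => ?_, fun h b hb => h _ ?_⟩ rfl rfl
    · by_cases hcg : c ∈ Set.range g
      · obtain ⟨b, rfl⟩ := hcg
        refine h b ?_
        rintro ⟨a, rfl⟩
        exact hc ⟨a, rfl⟩
      · exact h1 c hcg
    · rintro ⟨a, ha⟩
      exact hb ⟨a, hg ha⟩
  · rw [if_neg h1, if_neg]
    intro h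
    refine h1 fun c hc => h c ?_
    rintro ⟨a, rfl⟩
    exact hc ⟨_, rfl⟩

theorem emb_one (f : α → β) : emb f (1 : SiteMat κ α) = 1 := by
  classical
  ext s t
  rw [emb_apply, Matrix.one_apply, Matrix.one_apply]
  by_cases hst : s = t
  · subst hst
    simp
  · rw [if_neg hst]
    split_ifs with h1 h2
    · refine absurd (funext fun b => ?_) hst
      by_cases hb : b ∈ Set.range f
      · obtain ⟨a, rfl⟩ := hb
        exact congrFun h2 a
      · exact h1 b hb
    · rfl
    · rfl

theorem emb_mul {f : α → β} (hf : Function.Injective f) (x y : SiteMat κ α) :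
    emb f (x * y) = emb f x * emb f y := by
  classical
  ext s t
  rw [Matrix.mul_apply]
  simp only [emb_apply]
  by_cases h : ∀ b, b ∉ Set.range f → s b = t b
  · rw [if_pos h, Matrix.mul_apply]
    -- Only intermediate configurations agreeing with `s` off the range of `f` contribute, and these
    -- are the extensions of configurations `v` on `α`.
    refine Finset.sum_of_injOn (fun v => Function.extend f v s) ?_ (fun _ _ => by simp) ?_ ?_
    · intro v _ w _ hvw
      have := congrArg (· ∘ f) hvw
      simpa [Function.extend_comp hf] using this
    · intro u _ hu
      by_cases h1 : ∀ b, b ∉ Set.range f → s b = u b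
      · refine absurd ⟨u ∘ f, by simp, funext fun b => ?_⟩ hu
        by_cases hb : ∃ a, f a = b
        · obtain ⟨a, rfl⟩ := hb
          simp [hf.extend_apply]
        · simp only []
          rw [Function.extend_apply' _ _ _ hb]
          exact h1 b hb
      · rw [if_neg h1, zero_mul]
    · intro v _
      have h2 : ∀ b, b ∉ Set.range f → Function.extend f v s b = s b := fun b hb =>
        Function.extend_apply' _ _ _ hb
      rw [if_pos fun b hb => (h2 b hb).symm, if_pos fun b hb => (h2 b hb).trans (h b hb),
        Function.extend_comp hf]
  · rw [if_neg h]
    refine (Finset.sum_eq_zero fun u _ => ?_).symm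
    by_cases h1 : ∀ b, b ∉ Set.range f → s b = u b
    · rw [if_pos h1, if_neg, mul_zero]
      exact fun h2 => h fun b hb => (h1 b hb).trans (h2 b hb)
    · rw [if_neg h1, zero_mul]

theorem emb_star (f : α → β) (x : SiteMat κ α) : emb f (star x) = star (emb f x) := by
  classical
  ext s t
  simp only [emb_apply, Matrix.star_apply, eq_comm]
  split_ifs <;> simp

/-- `emb` along an injection, as a unital ⋆-homomorphism. -/
def embHom {f : α → β} (hf : Function.Injective f) : SiteMat κ α →⋆ₐ[ℂ] SiteMat κ β where
  toFun := emb f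
  map_one' := emb_one f
  map_mul' := emb_mul hf
  map_zero' := map_zero _
  map_add' := map_add _
  commutes' c := by rw [Algebra.algebraMap_eq_smul_one, map_smul, emb_one f,
    Algebra.algebraMap_eq_smul_one]
  map_star' := emb_star f

theorem norm_emb {f : α → β} (hf : Function.Injective f) (x : SiteMat κ α) :
    ‖emb f x‖ ≤ ‖x‖ :=
  NonUnitalStarAlgHom.norm_apply_le (embHom hf) x

/-- The units on the complementary sites prescribe the intermediate configuration completely, so one
term of the matrix product survives. -/
theorem emb_inl_mul_emb_inr_apply (x : SiteMat κ α) (y : SiteMat κ β) (s t : α ⊕ β → Fin κ) :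
    (emb Sum.inl x * emb Sum.inr y : SiteMat κ (α ⊕ β)) s t =
      x (s ∘ Sum.inl) (t ∘ Sum.inl) * y (s ∘ Sum.inr) (t ∘ Sum.inr) := by
  classical
  rw [Matrix.mul_apply, Finset.sum_eq_single (Sum.elim (t ∘ Sum.inl) (s ∘ Sum.inr))]
  · simp [emb_apply]
  · intro u _ hu
    simp only [emb_apply]
    split_ifs with h1 h2
    · refine absurd (funext fun b => ?_) hu
      rcases b with a | b
      · simpa using h2 (Sum.inl a) (by simp)
      · simpa using (h1 (Sum.inr b) (by simp)).symm
    all_goals simp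
  · simp

theorem emb_inr_mul_emb_inl_apply (x : SiteMat κ α) (y : SiteMat κ β) (s t : α ⊕ β → Fin κ) :
    (emb Sum.inr y * emb Sum.inl x : SiteMat κ (α ⊕ β)) s t =
      x (s ∘ Sum.inl) (t ∘ Sum.inl) * y (s ∘ Sum.inr) (t ∘ Sum.inr) := by
  classical
  rw [Matrix.mul_apply, Finset.sum_eq_single (Sum.elim (s ∘ Sum.inl) (t ∘ Sum.inr))]
  · simp [emb_apply, mul_comm]
  · intro u _ hu
    simp only [emb_apply]
    split_ifs with h1 h2
    · refine absurd (funext fun b => ?_) hu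
      rcases b with a | b
      · simpa using (h1 (Sum.inl a) (by simp)).symm
      · simpa using h2 (Sum.inr b) (by simp)
    all_goals simp
  · simp

/-- Disjoint ranges make `Sum.elim f g` injective, which reduces the claim to the two halves of a
disjoint union; there both orders give the same Kronecker entries. -/
theorem emb_commute {f : α → γ} {g : β → γ} (hf : Function.Injective f)
    (hg : Function.Injective g) (h : ∀ a b, f a ≠ g b) (x : SiteMat κ α) (y : SiteMat κ β) :
    Commute (emb f x) (emb g y) := by
  have hfg : Function.Injective (Sum.elim f g) := hf.sumElim hg h
  have h1 : emb f x = emb (Sum.elim f g) (emb Sum.inl x) := by rw [emb_emb hfg]; rfl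
  have h2 : emb g y = emb (Sum.elim f g) (emb Sum.inr y) := by rw [emb_emb hfg]; rfl
  have h3 : emb Sum.inl x * emb Sum.inr y = emb Sum.inr y * emb Sum.inl x := by
    ext s t
    rw [emb_inl_mul_emb_inr_apply, emb_inr_mul_emb_inl_apply]
  rw [commute_iff_eq, h1, h2, ← emb_mul hfg, ← emb_mul hfg, h3]

end Embedding

end SpinChain

end

noncomputable section

namespace SpinChain

open scoped Fin.CommRing

variable {κ : ℕ}

/-! ### Local operators on the cyclic chain -/

section Cyclic

variable {N : ℕ} [NeZero N]

/-- The sites `p, p + 1, …, p + M - 1` of the cyclic chain with `N` sites. -/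
def cycSite (N : ℕ) [NeZero N] (M : ℕ) (p : Fin N) (i : Fin M) : Fin N := p + ((i : ℕ) : Fin N)

/-- The operator `a ∈ B^M` placed on the sites `p, p + 1, …, p + M - 1` of the cyclic chain. -/
def place (N : ℕ) [NeZero N] {M : ℕ} (p : Fin N) : TensorPow κ M →ₗ[ℂ] TensorPow κ N :=
  emb (cycSite N M p)

theorem natCast_inj_of_lt {i j : ℕ} (hi : i < N) (hj : j < N)
    (h : (i : Fin N) = (j : Fin N)) : i = j := by
  have := congrArg Fin.val h
  rwa [Fin.val_natCast, Fin.val_natCast, Nat.mod_eq_of_lt hi, Nat.mod_eq_of_lt hj] at this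

theorem intCast_eq_zero_iff_of_abs_lt {z : ℤ} (hz : |z| < N) : (z : Fin N) = 0 ↔ z = 0 := by
  constructor
  · intro h
    rcases le_total 0 z with h0 | h0
    · lift z to ℕ using h0
      have h1 : z < N := by exact_mod_cast (abs_lt.1 hz).2
      have := natCast_inj_of_lt (N := N) h1 (Nat.pos_of_neZero N) (by exact_mod_cast h)
      exact_mod_cast this
    · obtain ⟨w, rfl⟩ : ∃ w : ℤ, z = -w := ⟨-z, by ring⟩
      have h0' : 0 ≤ w := by linarith
      lift w to ℕ using h0'
      have h1 : w < N := by
        have := (abs_lt.1 hz).1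
        have h2 : (w : ℤ) < N := by linarith
        exact_mod_cast h2
      have h2 : ((w : ℕ) : Fin N) = ((0 : ℕ) : Fin N) := by
        have : -((w : ℕ) : Fin N) = 0 := by
          rw [← h]
          push_cast
          rfl
        simpa using this
      have := natCast_inj_of_lt (N := N) h1 (Nat.pos_of_neZero N) h2
      simp [this]
  · rintro rfl
    simp

theorem intCast_inj_of_abs_lt {z w : ℤ} (hz : |z - w| < N) : (z : Fin N) = (w : Fin N) ↔ z = w := by
  rw [← sub_eq_zero, ← Int.cast_sub, intCast_eq_zero_iff_of_abs_lt hz, sub_eq_zero]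

theorem cycSite_injective {M : ℕ} (h : M ≤ N) (p : Fin N) : Function.Injective (cycSite N M p) := by
  intro i j hij
  have h1 := add_left_cancel hij
  exact Fin.ext (natCast_inj_of_lt (i.2.trans_le h) (j.2.trans_le h) h1)

theorem place_one {M : ℕ} (p : Fin N) : place N p (1 : TensorPow κ M) = 1 := emb_one _

theorem place_mul {M : ℕ} (h : M ≤ N) (p : Fin N) (x y : TensorPow κ M) :
    place N p (x * y) = place N p x * place N p y := emb_mul (cycSite_injective h p) x y

theorem place_star {M : ℕ} (p : Fin N) (x : TensorPow κ M) :
    place N p (star x) = star (place N p x) := emb_star _ x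

theorem norm_place_le {M : ℕ} (h : M ≤ N) (p : Fin N) (x : TensorPow κ M) :
    ‖place N p x‖ ≤ ‖x‖ := norm_emb (cycSite_injective h p) x

/-- The hypothesis `hf` is an equation modulo `N`, so the windows may run around the end of the
chain. -/
theorem place_emb {M K : ℕ} (h : M ≤ N) (p q : Fin N) (f : Fin K → Fin M)
    (hf : ∀ i, p + ((f i : ℕ) : Fin N) = q + ((i : ℕ) : Fin N)) (x : TensorPow κ K) :
    place N p (emb f x : TensorPow κ M) = place N q x := by
  unfold place
  rw [emb_emb (cycSite_injective h p)]
  congr 1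
  congr 1
  funext i
  exact hf i

/-- Shifting an operator into a larger interval. -/
def pad (K u : ℕ) {M : ℕ} (h : u + M ≤ K) : TensorPow κ M →ₗ[ℂ] TensorPow κ K :=
  emb fun i : Fin M => ⟨u + i, by omega⟩

theorem place_pad {K u M : ℕ} (h : u + M ≤ K) (hK : K ≤ N) (p : Fin N) (x : TensorPow κ M) :
    place N p (pad K u h x) = place N (p + (u : Fin N)) x :=
  place_emb hK _ _ _ (fun i => by push_cast; ring) x

/-- The product of two operators placed close to each other is again an operator of this form. -/
theorem exists_place_mul_place {M M' : ℕ} (a : TensorPow κ M) (b : TensorPow κ M') (z w : ℤ) :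
    ∃ (K : ℕ) (c : TensorPow κ K) (u : ℤ), ∀ (N : ℕ) [NeZero N], K ≤ N → ∀ p : Fin N,
      place N (p + (z : Fin N)) a * place N (p + (w : Fin N)) b = place N (p + (u : Fin N)) c := by
  -- With `u = min z w` both operators fit into one window starting at `p + u`; the length chosen
  -- for it is a crude bound.
  obtain ⟨u, i, j, hz, hw⟩ : ∃ (u : ℤ) (i j : ℕ), z = u + i ∧ w = u + j :=
    ⟨min z w, (z - min z w).toNat, (w - min z w).toNat, by omega, by omega⟩
  refine ⟨i + M + (j + M'), pad _ i (by omega) a * pad _ j (by omega) b, u, fun N _ hN p => ?_⟩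
  rw [place_mul hN, place_pad _ hN, place_pad _ hN, hz, hw]
  push_cast
  simp only [add_assoc]

theorem commute_place {M M' : ℕ} (hM : M ≤ N) (hM' : M' ≤ N) {p q : Fin N}
    (h : ∀ (i : Fin M) (j : Fin M'), cycSite N M p i ≠ cycSite N M' q j) (a : TensorPow κ M)
    (b : TensorPow κ M') : Commute (place N p a) (place N q b) :=
  emb_commute (cycSite_injective hM p) (cycSite_injective hM' q) h a b

/-- The commutator of two placed operators is supported on finitely many relative positions. -/
theorem place_commutator {M M' : ℕ} (a : TensorPow κ M) (b : TensorPow κ M') (z w : ℤ) :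
    ∃ K : ℕ, ∀ (N : ℕ) [NeZero N], K ≤ N → ∀ p q : Fin N,
      place N (p + (z : Fin N)) a * place N (q + (w : Fin N)) b -
        place N (q + (w : Fin N)) b * place N (p + (z : Fin N)) a =
      ∑ δ ∈ Finset.Ioo (w - z - M) (w - z + M'), if p = q + ((δ : ℤ) : Fin N) then
        (place N (q + ((δ + z : ℤ) : Fin N)) a * place N (q + (w : Fin N)) b -
        place N (q + (w : Fin N)) b * place N (q + ((δ + z : ℤ) : Fin N)) a) else 0 := by
  -- Windows overlap when `p + z + i = q + w + j` with `i < M` and `j < M'`, that is `p - q = δ`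
  -- with `δ = w - z + j - i` in the open interval. For `N ≥ M + M'` these `δ` remain distinct
  -- modulo `N`, so at most one indicator is nonzero.
  refine ⟨M + M', fun N _ hN p q => ?_⟩
  by_cases h : ∃ δ ∈ Finset.Ioo (w - z - M) (w - z + M'), p = q + ((δ : ℤ) : Fin N)
  · obtain ⟨δ, hδ, hp⟩ := h
    rw [Finset.sum_eq_single_of_mem δ hδ, if_pos hp, hp]
    · push_cast
      simp only [add_assoc]
    · intro δ' hδ' hne
      rw [if_neg]
      intro h'
      rw [hp] at h'
      refine hne ((intCast_inj_of_abs_lt ?_).1 (add_left_cancel h')).symm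
      rw [Finset.mem_Ioo] at hδ hδ'
      rw [abs_lt]
      constructor <;> omega
  · push Not at h
    rw [Finset.sum_eq_zero fun δ hδ => if_neg (h δ hδ), sub_eq_zero]
    refine commute_place (by omega) (by omega) (fun i j hij => ?_) a b
    refine h (w - z + j - i) ?_ ?_
    · rw [Finset.mem_Ioo]
      constructor <;> omega
    · unfold cycSite at hij
      push_cast
      linear_combination hij

theorem shift_apply {N : ℕ} (x : TensorPow κ N) :
    shift N x = emb (fun i => (finRotate N).symm i) x := by
  ext s t
  rw [emb_apply_of_surjective (finRotate N).symm.surjective]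
  rfl

theorem finRotate_symm_apply (i : Fin N) : (finRotate N).symm i = i - 1 := by
  rw [Equiv.symm_apply_eq]
  obtain ⟨n, rfl⟩ := Nat.exists_eq_succ_of_ne_zero (NeZero.ne N)
  rw [finRotate_apply]
  ring

theorem shift_place {M : ℕ} (p : Fin N) (a : TensorPow κ M) :
    shift N (place N p a) = place N (p - 1) a := by
  rw [shift_apply]
  unfold place
  rw [emb_emb (finRotate N).symm.injective]
  congr 1
  congr 1
  funext i
  rw [finRotate_symm_apply]
  unfold cycSite
  ring

theorem leftPad_eq_place {M : ℕ} (h : M ≤ N) (a : TensorPow κ M) :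
    leftPad h a = place N ((N - M : ℕ) : Fin N) a := by
  classical
  have hsite : ∀ i : Fin M, cycSite N M ((N - M : ℕ) : Fin N) i =
      Fin.cast (Nat.sub_add_cancel h) (Fin.natAdd (N - M) i) := fun i => by
    ext
    unfold cycSite
    rw [← Nat.cast_add, Fin.val_natCast, Nat.mod_eq_of_lt (by omega)]
    simp
  ext s t
  change (1 : TensorPow κ (N - M)) _ _ * a _ _ = _
  unfold place
  rw [emb_apply, Matrix.one_apply, ite_mul, one_mul, zero_mul]
  have h1 : ∀ u : Fin N → Fin κ, u ∘ cycSite N M ((N - M : ℕ) : Fin N) =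
      fun i => u (Fin.cast (Nat.sub_add_cancel h) (Fin.natAdd (N - M) i)) := fun u => by
    funext i
    exact congrArg u (hsite i)
  rw [h1, h1]
  refine if_congr ⟨fun hst b hb => ?_, fun hst => funext fun i => hst _ ?_⟩ rfl rfl
  · have hb' : b.1 < N - M := by
      by_contra hlt
      refine hb ⟨⟨b.1 - (N - M), by omega⟩, ?_⟩
      rw [hsite]
      ext
      simp
      omega
    exact congrFun hst ⟨b.1, hb'⟩
  · rintro ⟨j, hj⟩
    rw [hsite] at hj
    have := congrArg Fin.val hj
    simp at this
    omega

theorem avg_apply {N : ℕ} (x : TensorPow κ N) :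
    avg N x = (N : ℂ)⁻¹ • ∑ j ∈ Finset.range N, (shift N)^[j] x := rfl

theorem shift_iterate_place {M : ℕ} (j : ℕ) (p : Fin N) (a : TensorPow κ M) :
    (shift N)^[j] (place N p a) = place N (p - (j : Fin N)) a := by
  induction j with
  | zero => simp
  | succ j ih =>
    rw [Function.iterate_succ_apply', ih, shift_place]
    push_cast
    ring_nf

theorem sum_range_eq_sum_fin {E : Type*} [AddCommMonoid E] (f : Fin N → E) :
    ∑ j ∈ Finset.range N, f (j : Fin N) = ∑ p, f p := by
  rw [← Fin.sum_univ_eq_sum_range (fun j : ℕ => f (j : Fin N)) N]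
  simp

theorem sum_range_sub_eq_sum_fin {E : Type*} [AddCommMonoid E] (q : Fin N) (f : Fin N → E) :
    ∑ j ∈ Finset.range N, f (q - (j : Fin N)) = ∑ p, f p := by
  rw [sum_range_eq_sum_fin fun j => f (q - j)]
  exact Equiv.sum_comp (Equiv.subLeft q) f

/-- The shifts run through every position exactly once, whatever the starting position `q`. -/
theorem avg_place {M : ℕ} (q : Fin N) (a : TensorPow κ M) :
    avg N (place N q a) = (N : ℂ)⁻¹ • ∑ p, place N p a := by
  rw [avg_apply]
  simp only [shift_iterate_place]
  rw [sum_range_sub_eq_sum_fin q fun p => place N p a]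

theorem gammaBar_eq {M : ℕ} (h : M ≤ N) (a : TensorPow κ M) :
    gammaBar a N = (N : ℂ)⁻¹ • ∑ p, place N p a := by
  rw [gammaBar, dif_pos h, leftPad_eq_place, avg_place]

theorem gammaBar_star {N M : ℕ} (a : TensorPow κ M) :
    gammaBar (star a) N = star (gammaBar a N) := by
  unfold gammaBar
  split_ifs with h
  · rw [map_star, avg_apply, avg_apply, star_smul, star_sum]
    congr 1
    · simp
    · refine Finset.sum_congr rfl fun j hj => ?_
      clear hj
      induction j with
      | zero => rfl
      | succ j ih => rw [Function.iterate_succ_apply', Function.iterate_succ_apply', ih, map_star]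
  · simp

end Cyclic

end SpinChain

end

noncomputable section

namespace SpinChain

open scoped Fin.CommRing

variable {κ : ℕ}

/-! ### Families of operators depending on positions along the chain -/

theorem eventually_le_pnat (K : ℕ) : ∀ᶠ N : ℕ+ in atTop, K ≤ (N : ℕ) := by
  filter_upwards [eventually_ge_atTop (⟨K + 1, K.succ_pos⟩ : ℕ+)] with N hN
  have : K + 1 ≤ (N : ℕ) := hN
  omega

/-- The families `q ↦ f_N q ∈ B^N` of operators depending on `n` positions `q_0, …, q_{n-1}` on the
cyclic chain, which are (for large `N`) built from operators placed close to the positions,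
indicators of coincidences of positions up to a fixed translation, `γ`-sequences and `1 / N`. -/
inductive LocalFamily (n : ℕ) : (∀ N : ℕ+, (Fin n → Fin N) → TensorPow κ N) → Prop
  | place (k : Fin n) (z : ℤ) {M : ℕ} (a : TensorPow κ M) :
      LocalFamily n fun N q => place N (q k + (z : Fin N)) a
  | indicator (k l : Fin n) (z : ℤ) :
      LocalFamily n fun N q => if q k = q l + (z : Fin N) then 1 else 0
  | gammaBar {M : ℕ} (a : TensorPow κ M) : LocalFamily n fun N _ => gammaBar a N
  | one : LocalFamily n fun _ _ => 1
  | smul (c : ℂ) {f} : LocalFamily n f → LocalFamily n fun N q => c • f N q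
  | inv_smul {f} : LocalFamily n f → LocalFamily n fun N q => ((N : ℕ) : ℂ)⁻¹ • f N q
  | add {f g} : LocalFamily n f → LocalFamily n g → LocalFamily n fun N q => f N q + g N q
  | mul {f g} : LocalFamily n f → LocalFamily n g → LocalFamily n fun N q => f N q * g N q
  | congr {f g} : (∀ᶠ N in atTop, f N = g N) → LocalFamily n f → LocalFamily n g

namespace LocalFamily

variable {n m : ℕ} {f g : ∀ N : ℕ+, (Fin n → Fin N) → TensorPow κ N}

theorem zero : LocalFamily (κ := κ) n fun _ _ => 0 := by
  simpa using (one (κ := κ) (n := n)).smul 0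

theorem neg (hf : LocalFamily n f) : LocalFamily n fun N q => -f N q := by
  simpa using hf.smul (-1)

theorem sub (hf : LocalFamily n f) (hg : LocalFamily n g) :
    LocalFamily n fun N q => f N q - g N q := by
  simpa only [sub_eq_add_neg] using hf.add hg.neg

theorem sum {ι : Type*} (s : Finset ι) {F : ι → ∀ N : ℕ+, (Fin n → Fin N) → TensorPow κ N}
    (h : ∀ i ∈ s, LocalFamily n (F i)) : LocalFamily n fun N q => ∑ i ∈ s, F i N q := by
  classical
  induction s using Finset.induction_on with
  | empty => simpa using zero
  | insert i s hi ih =>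
    simp only [Finset.sum_insert hi]
    exact (h i (Finset.mem_insert_self i s)).add (ih fun j hj => h j (Finset.mem_insert_of_mem hj))

theorem indicator_mul (k l : Fin n) (z : ℤ) (hf : LocalFamily n f) :
    LocalFamily n fun N q => if q k = q l + (z : Fin N) then f N q else 0 := by
  simpa only [ite_mul, one_mul, zero_mul] using (indicator k l z).mul hf

theorem indicator_not_mul (k l : Fin n) (z : ℤ) (hf : LocalFamily n f) :
    LocalFamily n fun N q => if q k = q l + (z : Fin N) then 0 else f N q := by
  have h := hf.sub (hf.indicator_mul k l z)
  convert h using 3 with N q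
  split_ifs <;> simp

theorem list_prod {ℓ : ℕ} {F : Fin ℓ → ∀ N : ℕ+, (Fin n → Fin N) → TensorPow κ N}
    (h : ∀ i, LocalFamily n (F i)) : LocalFamily n fun N q => (List.ofFn fun i => F i N q).prod := by
  induction ℓ with
  | zero => simpa using one
  | succ ℓ ih =>
    simp only [List.ofFn_succ, List.prod_cons]
    exact (h 0).mul (ih fun i => h i.succ)

/-- Substitution of (translated) positions. -/
theorem subst {f : ∀ N : ℕ+, (Fin m → Fin N) → TensorPow κ N} (hf : LocalFamily m f)
    (σ : Fin m → Fin n) (z : Fin m → ℤ) :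
    LocalFamily n fun N q => f N fun k => q (σ k) + ((z k : ℤ) : Fin N) := by
  induction hf with
  | place k w a =>
    have h := place (κ := κ) (σ k) (z k + w) a
    simpa only [Int.cast_add, ← add_assoc] using h
  | indicator k l w =>
    have h := indicator (κ := κ) (σ k) (σ l) (z l + w - z k)
    convert h using 4 with N q
    push_cast
    constructor <;> intro h
    · linear_combination h
    · linear_combination h
  | gammaBar a => exact gammaBar a
  | one => exact one
  | smul c _ h => exact h.smul c
  | inv_smul _ h => exact h.inv_smul
  | add _ _ h1 h2 => exact h1.add h2
  | mul _ _ h1 h2 => exact h1.mul h2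
  | congr h _ ih => exact congr (h.mono fun N hN => funext fun q => by rw [hN]) ih

theorem tail (hf : LocalFamily n f) : LocalFamily (n + 1) fun N q => f N (Fin.tail q) := by
  simpa [Fin.tail_def] using hf.subst Fin.succ 0

theorem diag {f : ∀ N : ℕ+, (Fin (n + 1) → Fin N) → TensorPow κ N} (hf : LocalFamily (n + 1) f)
    (l : Fin n) (z : ℤ) : LocalFamily n fun N q => f N (Fin.cons (q l + (z : Fin N)) q) := by
  have h := hf.subst (Fin.cons l id) (Fin.cons z 0)
  convert h using 4 with N q
  refine funext fun k => ?_
  refine Fin.cases ?_ (fun i => ?_) k <;> simp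

end LocalFamily

/-- The families depending on `n + 1` positions which are sums of families supported on
coincidences of the first position with another one, and of families in which the first position
occurs only in a single placed operator. -/
inductive SplitFamily (n : ℕ) : (∀ N : ℕ+, (Fin (n + 1) → Fin N) → TensorPow κ N) → Prop
  | collision (l : Fin n) (z : ℤ) {g} : LocalFamily (n + 1) g →
      SplitFamily n fun N q => if q 0 = q l.succ + (z : Fin N) then g N q else 0
  | single (z : ℤ) {M : ℕ} (a : TensorPow κ M) {g} : LocalFamily n g →
      SplitFamily n fun N q => g N (Fin.tail q) * place N (q 0 + (z : Fin N)) a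
  | add {f g} : SplitFamily n f → SplitFamily n g → SplitFamily n fun N q => f N q + g N q
  | congr {f g} : (∀ᶠ N in atTop, f N = g N) → SplitFamily n f → SplitFamily n g

namespace SplitFamily

variable {n : ℕ}

theorem one : SplitFamily (κ := κ) n fun _ _ => 1 := by
  -- The normal form asks for an operator at the first position; the unit of length `0` serves.
  have h := single (κ := κ) (n := n) 0 (1 : TensorPow κ 0) LocalFamily.one
  simpa only [place_one, mul_one] using h

theorem zero : SplitFamily (κ := κ) n fun _ _ => 0 := by
  have h := single (κ := κ) (n := n) 0 (1 : TensorPow κ 0) LocalFamily.zero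
  simpa only [zero_mul] using h

theorem sum {ι : Type*} (s : Finset ι) {F : ι → ∀ N : ℕ+, (Fin (n + 1) → Fin N) → TensorPow κ N}
    (h : ∀ i ∈ s, SplitFamily n (F i)) : SplitFamily n fun N q => ∑ i ∈ s, F i N q := by
  classical
  induction s using Finset.induction_on with
  | empty => simpa using zero
  | insert i s hi ih =>
    simp only [Finset.sum_insert hi]
    exact (h i (Finset.mem_insert_self i s)).add (ih fun j hj => h j (Finset.mem_insert_of_mem hj))

/-- Treats constant scalars and the factor `1 / N` at once. -/
theorem smul_of {c : ℕ+ → ℂ} (hc : ∀ {m : ℕ} {g : ∀ N : ℕ+, (Fin m → Fin N) → TensorPow κ N},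
    LocalFamily m g → LocalFamily m fun N q => c N • g N q)
    {f : ∀ N : ℕ+, (Fin (n + 1) → Fin N) → TensorPow κ N} (hf : SplitFamily n f) :
    SplitFamily n fun N q => c N • f N q := by
  induction hf with
  | add _ _ h1 h2 => simp only [smul_add]; exact h1.add h2
  | congr h _ ih => exact congr (h.mono fun N hN => by rw [hN]) ih
  | collision l z hg =>
    simp only [smul_ite, smul_zero]
    exact collision l z (hc hg)
  | single z a hg =>
    simp only [← smul_mul_assoc]
    exact single z a (hc hg)

theorem smul (c : ℂ) {f : ∀ N : ℕ+, (Fin (n + 1) → Fin N) → TensorPow κ N}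
    (hf : SplitFamily n f) : SplitFamily n fun N q => c • f N q :=
  hf.smul_of (c := fun _ => c) fun h => h.smul c

theorem inv_smul {f : ∀ N : ℕ+, (Fin (n + 1) → Fin N) → TensorPow κ N}
    (hf : SplitFamily n f) : SplitFamily n fun N q => ((N : ℕ) : ℂ)⁻¹ • f N q :=
  hf.smul_of (c := fun N => ((N : ℕ) : ℂ)⁻¹) fun h => h.inv_smul

/-- Both operators sit at a bounded distance from `q 0`, hence merge into one. -/
theorem single_mul_place_zero (z w : ℤ) {M M' : ℕ} (a : TensorPow κ M) (b : TensorPow κ M')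
    {g : ∀ N : ℕ+, (Fin n → Fin N) → TensorPow κ N} (hg : LocalFamily n g) :
    SplitFamily n fun N q => g N (Fin.tail q) *
      (place N (q 0 + (z : Fin N)) a * place N (q 0 + (w : Fin N)) b) := by
  obtain ⟨K, c, u, h⟩ := exists_place_mul_place a b z w
  refine congr ?_ (single u c hg)
  filter_upwards [eventually_le_pnat K] with N hN
  funext q
  rw [h N hN]

/-- The new operator belongs to another position and has to be absorbed into `g`. Moving it past the
operator at `q 0` costs a commutator, which lives on the finitely many collisions `q 0 = q k.succ +
δ`. -/
theorem single_mul_place_succ (z w : ℤ) {M M' : ℕ} (a : TensorPow κ M) (b : TensorPow κ M')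
    (k : Fin n) {g : ∀ N : ℕ+, (Fin n → Fin N) → TensorPow κ N} (hg : LocalFamily n g) :
    SplitFamily n fun N q => g N (Fin.tail q) * place N (q 0 + (z : Fin N)) a *
      place N (q k.succ + (w : Fin N)) b := by
  obtain ⟨K, hK⟩ := place_commutator a b z w
  have h1 := single z a (hg.mul (LocalFamily.place k w b))
  have h2 := sum (κ := κ) (n := n) (Finset.Ioo (w - z - M) (w - z + M'))
    (F := fun δ N q => if q 0 = q k.succ + ((δ : ℤ) : Fin N) then
      g N (Fin.tail q) * (place N (q k.succ + ((δ + z : ℤ) : Fin N)) a *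
        place N (q k.succ + (w : Fin N)) b - place N (q k.succ + (w : Fin N)) b *
        place N (q k.succ + ((δ + z : ℤ) : Fin N)) a) else 0) fun δ _ =>
      collision k δ (hg.tail.mul (((LocalFamily.place k.succ _ a).mul
        (LocalFamily.place k.succ w b)).sub ((LocalFamily.place k.succ w b).mul
        (LocalFamily.place k.succ _ a))))
  refine congr ?_ (h1.add h2)
  filter_upwards [eventually_le_pnat K] with N hN
  funext q
  have h3 := hK N hN (q 0) (q k.succ)
  rw [sub_eq_iff_eq_add] at h3
  change g N (Fin.tail q) * place N (q k.succ + (w : Fin N)) b * _ + _ = _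
  rw [mul_assoc (g N (Fin.tail q)), mul_assoc (g N (Fin.tail q)), h3, mul_add, Finset.mul_sum, add_comm]
  simp only [mul_ite, mul_zero]

/-- In the commutator with a γ-average the sum over positions collapses to boundedly many terms near
`q 0`, leaving a factor `1 / N`; the products near `q 0` merge into single operators again. -/
theorem single_mul_gammaBar (z : ℤ) {M M' : ℕ} (a : TensorPow κ M) (b : TensorPow κ M')
    {g : ∀ N : ℕ+, (Fin n → Fin N) → TensorPow κ N} (hg : LocalFamily n g) :
    SplitFamily n fun N q => g N (Fin.tail q) * place N (q 0 + (z : Fin N)) a * gammaBar b N := by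
  obtain ⟨K, hK⟩ := place_commutator b a 0 z
  have h1 := single z a (hg.mul (LocalFamily.gammaBar b))
  have h2 := sum (κ := κ) (n := n) (Finset.Ioo (z - 0 - M') (z - 0 + M))
    (F := fun δ N q =>
      ((N : ℕ) : ℂ)⁻¹ • (g N (Fin.tail q) *
        (place N (q 0 + (z : Fin N)) a * place N (q 0 + ((δ + 0 : ℤ) : Fin N)) b) +
      (-1 : ℂ) • (g N (Fin.tail q) *
        (place N (q 0 + ((δ + 0 : ℤ) : Fin N)) b * place N (q 0 + (z : Fin N)) a)))) fun δ _ =>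
      ((single_mul_place_zero z (δ + 0) a b hg).add
        ((single_mul_place_zero (δ + 0) z b a hg).smul (-1))).inv_smul
  refine congr ?_ (h1.add h2)
  filter_upwards [eventually_le_pnat K, eventually_le_pnat M'] with N hN hN'
  funext q
  have h3 : ∀ p : Fin N, place N (q 0 + (z : Fin N)) a * place N p b =
      place N p b * place N (q 0 + (z : Fin N)) a -
      ∑ δ ∈ Finset.Ioo (z - 0 - M') (z - 0 + M), if p = q 0 + ((δ : ℤ) : Fin N) then
        (place N (q 0 + ((δ + 0 : ℤ) : Fin N)) b * place N (q 0 + (z : Fin N)) a -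
        place N (q 0 + (z : Fin N)) a * place N (q 0 + ((δ + 0 : ℤ) : Fin N)) b) else 0 := by
    intro p
    rw [← hK N hN p (q 0)]
    simp
  have h4 : place N (q 0 + (z : Fin N)) a * ∑ p : Fin N, place N p b =
      (∑ p : Fin N, place N p b) * place N (q 0 + (z : Fin N)) a -
      ∑ δ ∈ Finset.Ioo (z - 0 - M') (z - 0 + M),
        (place N (q 0 + ((δ + 0 : ℤ) : Fin N)) b * place N (q 0 + (z : Fin N)) a -
        place N (q 0 + (z : Fin N)) a * place N (q 0 + ((δ + 0 : ℤ) : Fin N)) b) := by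
    rw [Finset.mul_sum, Finset.sum_congr rfl fun p _ => h3 p, Finset.sum_sub_distrib,
      Finset.sum_comm, Finset.sum_mul]
    simp only [Finset.sum_ite_eq', Finset.mem_univ, if_true]
  rw [gammaBar_eq hN', mul_smul_comm, mul_smul_comm, mul_assoc, smul_mul_assoc,
    mul_assoc, h4, ← Finset.smul_sum, ← smul_add, mul_sub, Finset.mul_sum]
  congr 1
  rw [eq_sub_iff_add_eq, add_assoc, ← Finset.sum_add_distrib, add_eq_left]
  refine Finset.sum_eq_zero fun δ _ => ?_
  rw [mul_sub, neg_one_smul]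
  abel

/-- Induction over the right factor. Each generator is either absorbed into `g`, merged with the
operator at the first position, or turns the term into a collision; the commutators that arise are
collisions or carry a factor `1 / N`. -/
theorem mul {f g : ∀ N : ℕ+, (Fin (n + 1) → Fin N) → TensorPow κ N} (hg : LocalFamily (n + 1) g)
    (hf : SplitFamily n f) : SplitFamily n fun N q => f N q * g N q := by
  induction hg generalizing f with
  | add _ _ ih1 ih2 =>
    simp only [mul_add]
    exact (ih1 hf).add (ih2 hf)
  | mul _ _ ih1 ih2 =>
    simp only [← mul_assoc]
    exact ih2 (ih1 hf)
  | congr h _ ih => exact congr (h.mono fun N hN => by rw [hN]) (ih hf)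
  | one => simpa only [mul_one] using hf
  | smul c _ ih =>
    simp only [mul_smul_comm]
    exact (ih hf).smul c
  | inv_smul _ ih =>
    simp only [mul_smul_comm]
    exact (ih hf).inv_smul
  | gammaBar b =>
    induction hf with
    | add _ _ h1 h2 => simp only [add_mul]; exact h1.add h2
    | congr h _ ih => exact congr (h.mono fun N hN => by rw [hN]) ih
    | collision l z hg =>
      simp only [ite_mul, zero_mul]
      exact collision l z (hg.mul (LocalFamily.gammaBar b))
    | single z a hg => exact single_mul_gammaBar z a b hg
  | place k w b =>
    induction hf with
    | add _ _ h1 h2 => simp only [add_mul]; exact h1.add h2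
    | congr h _ ih => exact congr (h.mono fun N hN => by rw [hN]) ih
    | collision l z hg =>
      simp only [ite_mul, zero_mul]
      exact collision l z (hg.mul (LocalFamily.place k w b))
    | single z a hg =>
      refine Fin.cases ?_ (fun k => ?_) k
      · simp only [mul_assoc]
        exact single_mul_place_zero z w a b hg
      · exact single_mul_place_succ z w a b k hg
  | indicator k l w =>
    simp only [mul_ite, mul_one, mul_zero]
    induction hf with
    | add _ _ h1 h2 =>
      refine congr (.of_forall fun N => funext fun q => ?_) (h1.add h2)
      split_ifs <;> simp
    | congr h _ ih => exact congr (h.mono fun N hN => by rw [hN]) ih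
    | collision l' z hg =>
      refine congr (.of_forall fun N => funext fun q => ?_)
        (collision l' z (hg.indicator_mul k l w))
      dsimp only
      split_ifs <;> rfl
    | single z a hg =>
      refine Fin.cases ?_ (fun k => ?_) k
      · refine Fin.cases ?_ (fun l => ?_) l
        -- The condition reads `w = 0` modulo `N`; for `w ≠ 0` it fails as soon as `N` exceeds
        -- `|w|`.
        · by_cases hw : w = 0
          · subst hw
            simpa using single z a hg
          · refine congr ?_ zero
            filter_upwards [eventually_le_pnat (w.natAbs + 1)] with N hN
            funext q
            rw [if_neg]
            intro h
            have h0 : (w : Fin N) = 0 := by simpa using h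
            refine hw ((intCast_eq_zero_iff_of_abs_lt ?_).1 h0)
            rw [Int.abs_eq_natAbs]
            exact_mod_cast hN
        · exact collision l w (hg.tail.mul (LocalFamily.place 0 z a))
      · refine Fin.cases ?_ (fun l => ?_) l
        · refine congr (.of_forall fun N => funext fun q => ?_)
            (collision k (-w) (hg.tail.mul (LocalFamily.place 0 z a)))
          refine if_congr ?_ rfl rfl
          push_cast
          constructor <;> intro h
          · linear_combination -h
          · linear_combination -h
        · refine congr (.of_forall fun N => funext fun q => ?_)
            (single z a (hg.indicator_mul k l w))
          rw [ite_mul, zero_mul]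
          rfl

end SplitFamily

namespace LocalFamily

variable {n : ℕ}

theorem split {f : ∀ N : ℕ+, (Fin (n + 1) → Fin N) → TensorPow κ N}
    (hf : LocalFamily (n + 1) f) : SplitFamily n f := by
  simpa only [one_mul] using SplitFamily.one.mul hf

/-- Averaging over the first position. -/
theorem avg_first {f : ∀ N : ℕ+, (Fin (n + 1) → Fin N) → TensorPow κ N}
    (hf : LocalFamily (n + 1) f) :
    LocalFamily n fun N q => ((N : ℕ) : ℂ)⁻¹ • ∑ p, f N (Fin.cons p q) := by
  have hs := hf.split
  clear hf
  induction hs with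
  | add _ _ h1 h2 =>
    simp only [Finset.sum_add_distrib, smul_add]
    exact h1.add h2
  | congr h _ ih => exact congr (h.mono fun N hN => funext fun q => by rw [hN]) ih
  -- A collision pins the first position, so the sum has one term and the factor `1 / N` remains.
  | collision l z hg =>
    simp only [Fin.cons_zero, Fin.cons_succ, Finset.sum_ite_eq',
      Finset.mem_univ, if_true]
    exact (hg.diag l z).inv_smul
  -- The first position occurs in one operator only, whose average over all positions is a
  -- γ-average; the offset `z` is removed by reindexing.
  | @single z M a g hg =>
    refine congr ?_ (hg.mul (gammaBar a))
    filter_upwards [eventually_le_pnat M] with N hN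
    funext q
    simp only [Fin.tail_cons, Fin.cons_zero]
    rw [← Finset.mul_sum, gammaBar_eq hN, mul_smul_comm,
      ← Equiv.sum_comp (Equiv.addRight (z : Fin N)) fun p => SpinChain.place N p a]
    rfl

/-- Averaging over all positions. -/
theorem avg_all {f : ∀ N : ℕ+, (Fin n → Fin N) → TensorPow κ N} (hf : LocalFamily n f) :
    LocalFamily 0 fun N _ => (((N : ℕ) : ℂ) ^ n)⁻¹ • ∑ q, f N q := by
  induction n with
  | zero =>
    convert hf using 3 with N q
    rw [Subsingleton.elim q default]
    simp only [pow_zero, inv_one, one_smul, Finset.univ_unique, Finset.sum_singleton]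
    exact congrArg (f N) (Subsingleton.elim _ _)
  | succ n ih =>
    convert ih hf.avg_first using 3 with N q
    rw [← Finset.smul_sum, smul_smul, pow_succ, mul_inv, Finset.sum_comm,
      ← (Fin.consEquiv fun _ => Fin N).sum_comp, Fintype.sum_prod_type]
    rfl

end LocalFamily

end SpinChain

end

noncomputable section

namespace SpinChain

open scoped Fin.CommRing

variable {κ : ℕ}

/-! ### Local sequences -/

/-- Sequences which for large `N` are polynomials in `γ`-sequences and in `1 / N`. -/
def IsLocalSeq (f : ∀ N : ℕ+, TensorPow κ N) : Prop := LocalFamily 0 fun N _ => f N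

namespace IsLocalSeq

variable {f g : ∀ N : ℕ+, TensorPow κ N}

theorem gammaBar {M : ℕ} (a : TensorPow κ M) : IsLocalSeq fun N => gammaBar a N :=
  LocalFamily.gammaBar a

theorem one : IsLocalSeq (κ := κ) 1 := LocalFamily.one

theorem zero : IsLocalSeq (κ := κ) 0 := LocalFamily.zero

theorem smul (c : ℂ) (hf : IsLocalSeq f) : IsLocalSeq (c • f) := LocalFamily.smul c hf

theorem inv_smul (hf : IsLocalSeq f) : IsLocalSeq fun N => ((N : ℕ) : ℂ)⁻¹ • f N :=
  LocalFamily.inv_smul hf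

theorem add (hf : IsLocalSeq f) (hg : IsLocalSeq g) : IsLocalSeq (f + g) := LocalFamily.add hf hg

theorem sub (hf : IsLocalSeq f) (hg : IsLocalSeq g) : IsLocalSeq (f - g) := LocalFamily.sub hf hg

theorem mul (hf : IsLocalSeq f) (hg : IsLocalSeq g) : IsLocalSeq (f * g) := LocalFamily.mul hf hg

theorem congr (h : ∀ᶠ N in atTop, f N = g N) (hf : IsLocalSeq f) : IsLocalSeq g :=
  LocalFamily.congr (h.mono fun N hN => by rw [hN]) hf

theorem sum {ι : Type*} (s : Finset ι) {F : ι → ∀ N : ℕ+, TensorPow κ N}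
    (h : ∀ i ∈ s, IsLocalSeq (F i)) : IsLocalSeq fun N => ∑ i ∈ s, F i N :=
  LocalFamily.sum s h

-- Without positions the constructors `place` and `indicator` cannot occur, so γ-sequences, scalars
-- and `1 / N` generate, up to finitely many entries.
@[elab_as_elim]
theorem induction {C : ∀ f : ∀ N : ℕ+, TensorPow κ N, IsLocalSeq f → Prop}
    (gammaBar : ∀ {M : ℕ} (a : TensorPow κ M),
      C (fun N => SpinChain.gammaBar a N) (.gammaBar a))
    (one : C 1 .one) (smul : ∀ (c : ℂ) f (hf : IsLocalSeq f), C f hf → C (c • f) (hf.smul c))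
    (inv_smul : ∀ f (hf : IsLocalSeq f), C f hf →
      C (fun N => ((N : ℕ) : ℂ)⁻¹ • f N) hf.inv_smul)
    (add : ∀ f g (hf : IsLocalSeq f) (hg : IsLocalSeq g), C f hf → C g hg →
      C (f + g) (hf.add hg))
    (mul : ∀ f g (hf : IsLocalSeq f) (hg : IsLocalSeq g), C f hf → C g hg →
      C (f * g) (hf.mul hg))
    (congr : ∀ f g (h : ∀ᶠ N in atTop, f N = g N) (hf : IsLocalSeq f), C f hf →
      C g (hf.congr h))
    (hf : IsLocalSeq f) : C f hf := by
  have key : ∀ F : ∀ N : ℕ+, (Fin 0 → Fin N) → TensorPow κ N, LocalFamily 0 F →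
      ∃ h : IsLocalSeq (fun N => F N ![]), C (fun N => F N ![]) h := by
    intro F hF
    induction hF with
    | place k => exact k.elim0
    | indicator k => exact k.elim0
    | gammaBar a => exact ⟨_, gammaBar a⟩
    | one => exact ⟨_, one⟩
    | smul c _ ih => exact ⟨_, smul c _ ih.1 ih.2⟩
    | inv_smul _ ih => exact ⟨_, inv_smul _ ih.1 ih.2⟩
    | add _ _ h1 h2 => exact ⟨_, add _ _ h1.1 h2.1 h1.2 h2.2⟩
    | mul _ _ h1 h2 => exact ⟨_, mul _ _ h1.1 h2.1 h1.2 h2.2⟩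
    | congr h _ ih => exact ⟨_, congr _ _ (h.mono fun N hN => congrFun hN ![]) ih.1 ih.2⟩
  exact (key _ hf).2

theorem conj (hf : IsLocalSeq f) : IsLocalSeq fun N => star (f N) := by
  induction hf using induction with
  | gammaBar a => simpa only [gammaBar_star] using gammaBar (star a)
  | one => exact one.congr (.of_forall fun N => by simp)
  | smul c f _ h =>
    simp only [Pi.smul_apply, star_smul]
    exact h.smul _
  | inv_smul f _ h =>
    simp only [star_smul, star_inv₀, star_natCast]
    exact h.inv_smul
  | add f g _ _ h1 h2 =>
    simp only [Pi.add_apply, star_add]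
    exact h1.add h2
  | mul f g _ _ h1 h2 =>
    simp only [Pi.mul_apply, star_mul]
    exact h2.mul h1
  | congr f g h _ ih => exact ih.congr (h.mono fun N hN => by rw [hN])

theorem norm_inv_natCast_le (N : ℕ+) : ‖((N : ℕ) : ℂ)⁻¹‖ ≤ 1 := by
  rw [norm_inv, Complex.norm_natCast]
  exact inv_le_one_of_one_le₀ (by exact_mod_cast N.pos)

theorem exists_norm_le_eventually [NeZero κ] (hf : IsLocalSeq f) :
    ∃ C : ℝ, ∀ᶠ N in atTop, ‖f N‖ ≤ C := by
  induction hf using induction with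
  | gammaBar a => exact ⟨‖a‖, .of_forall fun N => norm_gammaBar_le a N⟩
  | one => exact ⟨1, .of_forall fun N => by simp⟩
  | smul c f _ h =>
    obtain ⟨C, hC⟩ := h
    exact ⟨‖c‖ * C, hC.mono fun N hN => (norm_smul_le c (f N)).trans (by gcongr)⟩
  | inv_smul f _ h =>
    obtain ⟨C, hC⟩ := h
    refine ⟨C, hC.mono fun N hN => (norm_smul_le _ (f N)).trans ?_⟩
    exact (mul_le_of_le_one_left (norm_nonneg _) (norm_inv_natCast_le N)).trans hN
  | add f g _ _ h1 h2 =>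
    obtain ⟨C, hC⟩ := h1
    obtain ⟨D, hD⟩ := h2
    refine ⟨C + D, ?_⟩
    filter_upwards [hC, hD] with N h1 h2
    exact (norm_add_le (f N) (g N)).trans (add_le_add h1 h2)
  | mul f g _ _ h1 h2 =>
    obtain ⟨C, hC⟩ := h1
    obtain ⟨D, hD⟩ := h2
    refine ⟨C * D, ?_⟩
    filter_upwards [hC, hD] with N h1 h2
    exact (norm_mul_le (f N) (g N)).trans
      (mul_le_mul h1 h2 (norm_nonneg _) ((norm_nonneg _).trans h1))
  | congr f g h _ ih =>
    obtain ⟨C, hC⟩ := ih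
    refine ⟨C, ?_⟩
    filter_upwards [h, hC] with N h1 h2
    rwa [← h1]

theorem exists_norm_le [NeZero κ] (hf : IsLocalSeq f) : ∃ C : ℝ, ∀ N, ‖f N‖ ≤ C := by
  obtain ⟨C, hC⟩ := hf.exists_norm_le_eventually
  obtain ⟨K, hK⟩ := eventually_atTop.1 hC
  refine ⟨max C (∑ N ∈ Finset.Iic K, ‖f N‖), fun N => ?_⟩
  rcases le_total K N with h | h
  · exact (hK N h).trans (le_max_left _ _)
  · refine le_trans ?_ (le_max_right _ _)
    exact Finset.single_le_sum (f := fun N => ‖f N‖) (fun N _ => norm_nonneg _)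
      (Finset.mem_Iic.2 h)

theorem memℓp [NeZero κ] (hf : IsLocalSeq f) : Memℓp f ∞ := by
  obtain ⟨C, hC⟩ := hf.exists_norm_le
  exact memℓp_infty ⟨C, by rintro _ ⟨N, rfl⟩; exact hC N⟩

/-- The normalizations and the rescaling combine to `1 / N`, and for each of the finitely many
relative positions `δ` one sum over positions is left: the γ-averages of the two products at that
relative position. -/
theorem gammaBar_commutator {M M' : ℕ} (a : TensorPow κ M) (b : TensorPow κ M') :
    IsLocalSeq fun N => ((N : ℕ) : ℂ) • (SpinChain.gammaBar a N * SpinChain.gammaBar b N -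
      SpinChain.gammaBar b N * SpinChain.gammaBar a N) := by
  obtain ⟨K, hK⟩ := place_commutator a b 0 0
  choose K₁ c₁ u₁ h₁ using fun δ : ℤ => exists_place_mul_place a b (δ + 0) 0
  choose K₂ c₂ u₂ h₂ using fun δ : ℤ => exists_place_mul_place b a 0 (δ + 0)
  let s := Finset.Ioo ((0 : ℤ) - 0 - M) (0 - 0 + M')
  have hs : IsLocalSeq fun N => ∑ δ ∈ s, (SpinChain.gammaBar (c₁ δ) N -
      SpinChain.gammaBar (c₂ δ) N) :=
    sum s fun δ _ => (gammaBar _).sub (gammaBar _)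
  refine hs.congr ?_
  filter_upwards [eventually_le_pnat K, eventually_le_pnat M, eventually_le_pnat M',
    (Filter.eventually_all_finset s).2 fun δ _ => eventually_le_pnat (K₁ δ),
    (Filter.eventually_all_finset s).2 fun δ _ => eventually_le_pnat (K₂ δ)]
    with N hN hM hM' hN₁ hN₂
  have hN0 : ((N : ℕ) : ℂ) ≠ 0 := Nat.cast_ne_zero.2 N.ne_zero
  have hg : ∀ {L : ℕ} (u : ℤ) (c : TensorPow κ L), L ≤ N →
      SpinChain.gammaBar c N = ((N : ℕ) : ℂ)⁻¹ • ∑ p : Fin N, place N (p + (u : Fin N)) c := by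
    intro L u c hL
    rw [gammaBar_eq hL, ← Equiv.sum_comp (Equiv.addRight (u : Fin N)) fun p => place N p c]
    rfl
  have hterm : ∀ δ ∈ s, SpinChain.gammaBar (c₁ δ) N - SpinChain.gammaBar (c₂ δ) N =
      ((N : ℕ) : ℂ)⁻¹ • ∑ q : Fin N, (place N (q + ((δ + 0 : ℤ) : Fin N)) a *
        place N (q + ((0 : ℤ) : Fin N)) b - place N (q + ((0 : ℤ) : Fin N)) b *
        place N (q + ((δ + 0 : ℤ) : Fin N)) a) := by
    intro δ hδ
    rw [hg (u₁ δ) (c₁ δ) (hN₁ δ hδ), hg (u₂ δ) (c₂ δ) (hN₂ δ hδ), ← smul_sub,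
      ← Finset.sum_sub_distrib]
    congr 1
    refine Finset.sum_congr rfl fun q _ => ?_
    rw [h₁ δ N (hN₁ δ hδ), h₂ δ N (hN₂ δ hδ)]
  rw [Finset.sum_congr rfl hterm, ← Finset.smul_sum, Finset.sum_comm, hg 0 a hM, hg 0 b hM']
  rw [smul_mul_smul_comm, smul_mul_smul_comm, ← smul_sub, smul_smul, ← mul_assoc,
    mul_inv_cancel₀ hN0, one_mul]
  congr 1
  rw [Finset.mul_sum, Finset.sum_mul, ← Finset.sum_sub_distrib]
  refine Finset.sum_congr rfl fun q _ => ?_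
  rw [Finset.sum_mul, Finset.mul_sum, ← Finset.sum_sub_distrib,
    Finset.sum_congr rfl fun p _ => hK N hN p q, Finset.sum_comm]
  simp only [Finset.sum_ite_eq', Finset.mem_univ, if_true]
  rfl

/-- The rescaled commutator of two local sequences is a local sequence. -/
theorem commutator (hf : IsLocalSeq f) (hg : IsLocalSeq g) :
    IsLocalSeq fun N => ((N : ℕ) : ℂ) • (f N * g N - g N * f N) := by
  -- The rescaled commutator is a derivation in each argument, so only a pair of γ-sequences
  -- requires an argument.
  induction hf using induction with
  | gammaBar a =>
    induction hg using induction with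
    | gammaBar b => exact gammaBar_commutator a b
    | one => exact zero.congr (.of_forall fun N => by simp)
    | smul c g _ ih =>
      refine (ih.smul c).congr (.of_forall fun N => ?_)
      simp only [Pi.smul_apply, mul_smul_comm, smul_mul_assoc, ← smul_sub]
      rw [smul_comm]
    | inv_smul g _ ih =>
      refine ih.inv_smul.congr (.of_forall fun N => ?_)
      simp only [mul_smul_comm, smul_mul_assoc, ← smul_sub]
      rw [smul_comm]
    | add g h _ _ h1 h2 =>
      refine (h1.add h2).congr (.of_forall fun N => ?_)
      simp only [Pi.add_apply, ← smul_add]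
      congr 1
      noncomm_ring
    | mul g h hg hh h1 h2 =>
      refine ((h1.mul hh).add (hg.mul h2)).congr (.of_forall fun N => ?_)
      simp only [Pi.add_apply, Pi.mul_apply, smul_mul_assoc, mul_smul_comm, ← smul_add]
      congr 1
      noncomm_ring
    | congr g h hgh _ ih => exact ih.congr (hgh.mono fun N hN => by rw [hN])
  | one => exact zero.congr (.of_forall fun N => by simp)
  | smul c f _ ih =>
    refine (ih.smul c).congr (.of_forall fun N => ?_)
    simp only [Pi.smul_apply, mul_smul_comm, smul_mul_assoc, ← smul_sub]
    rw [smul_comm]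
  | inv_smul f _ ih =>
    refine ih.inv_smul.congr (.of_forall fun N => ?_)
    simp only [mul_smul_comm, smul_mul_assoc, ← smul_sub]
    rw [smul_comm]
  | add f h _ _ h1 h2 =>
    refine (h1.add h2).congr (.of_forall fun N => ?_)
    simp only [Pi.add_apply, ← smul_add]
    congr 1
    noncomm_ring
  | mul f h hf hh h1 h2 =>
    refine ((hf.mul h2).add (h1.mul hh)).congr (.of_forall fun N => ?_)
    simp only [Pi.add_apply, Pi.mul_apply, smul_mul_assoc, mul_smul_comm, ← smul_add]
    congr 1
    noncomm_ring
  | congr f h hfh _ ih => exact ih.congr (hfh.mono fun N hN => by rw [hN])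

end IsLocalSeq

variable (κ) in
/-- The ⋆-algebra of local sequences. -/
def LocalAlg : StarSubalgebra ℂ (∀ N : ℕ+, TensorPow κ N) where
  carrier := {f | IsLocalSeq f}
  mul_mem' := IsLocalSeq.mul
  one_mem' := .one
  add_mem' := IsLocalSeq.add
  zero_mem' := .zero
  algebraMap_mem' c := by
    rw [Algebra.algebraMap_eq_smul_one]
    exact IsLocalSeq.one.smul c
  star_mem' hf := IsLocalSeq.conj hf

section Class

variable [NeZero κ]

/-- The class of a local sequence. -/
def localClass : LocalAlg κ →⋆ₐ[ℂ] ClassAlg κ :=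
  AsympAlg.mkStar.comp
    { toFun := fun f => (⟨f.1, f.2.memℓp⟩ : BddSeq κ)
      map_one' := rfl
      map_mul' := fun _ _ => rfl
      map_zero' := rfl
      map_add' := fun _ _ => rfl
      commutes' := fun _ => rfl
      map_star' := fun _ => rfl }

theorem localClass_apply (f : LocalAlg κ) :
    localClass f = AsympAlg.mk (⟨f.1, f.2.memℓp⟩ : BddSeq κ) := rfl

theorem localClass_eq_iff {f g : LocalAlg κ} :
    localClass f = localClass g ↔ Tendsto (fun N => ‖f.1 N - g.1 N‖) atTop (𝓝 0) :=
  AsympAlg.mk_eq_mk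

theorem hasClass_localClass (f : LocalAlg κ) : HasClass f.1 (localClass f) :=
  ⟨_, fun _ => rfl, rfl⟩

end Class

end SpinChain

end

noncomputable section

namespace SpinChain

variable {κ : ℕ}

/-! ### The leading part of a local sequence -/

/-- The `γ`-sequence of `a` as a local sequence. -/
def gammaLocal {M : ℕ} (a : TensorPow κ M) : LocalAlg κ := ⟨_, .gammaBar a⟩

variable (κ) in
/-- The local sequences of order `1 / N`. -/
def orderIdeal : Ideal (LocalAlg κ) where
  carrier := {f | IsLocalSeq fun N => ((N : ℕ) : ℂ) • f.1 N}
  zero_mem' := IsLocalSeq.zero.congr (.of_forall fun N => by simp)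
  add_mem' hf hg := (hf.add hg).congr (.of_forall fun N => by simp)
  smul_mem' c f hf := (c.2.mul hf).congr (.of_forall fun N => by simp)

theorem mem_orderIdeal {f : LocalAlg κ} :
    f ∈ orderIdeal κ ↔ IsLocalSeq fun N => ((N : ℕ) : ℂ) • f.1 N := Iff.rfl

instance : (orderIdeal κ).IsTwoSided where
  mul_mem_of_left {f} c hf := by
    rw [mem_orderIdeal] at *
    exact (hf.mul c.2).congr (.of_forall fun N => by simp)

variable (κ) in
/-- Local sequences modulo local sequences of order `1 / N`. -/
def LeadAlg : Type := LocalAlg κ ⧸ orderIdeal κ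

instance : Ring (LeadAlg κ) := inferInstanceAs (Ring (LocalAlg κ ⧸ orderIdeal κ))

instance : Algebra ℂ (LeadAlg κ) := inferInstanceAs (Algebra ℂ (LocalAlg κ ⧸ orderIdeal κ))

/-- The leading part of a local sequence. -/
def lead : LocalAlg κ →ₐ[ℂ] LeadAlg κ := Ideal.Quotient.mkₐ ℂ (orderIdeal κ)

theorem lead_surjective : Function.Surjective (lead (κ := κ)) := Ideal.Quotient.mk_surjective

theorem lead_eq_iff {f g : LocalAlg κ} : lead f = lead g ↔ f - g ∈ orderIdeal κ :=
  Ideal.Quotient.eq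

theorem lead_eq_zero_iff {f : LocalAlg κ} : lead f = 0 ↔ f ∈ orderIdeal κ :=
  Ideal.Quotient.eq_zero_iff_mem

/-- Commutativity is the locality of rescaled commutators: if `N [f, g]` is local, then `[f, g]`
lies in `orderIdeal`. -/
instance : CommRing (LeadAlg κ) where
  __ := (inferInstance : Ring (LeadAlg κ))
  mul_comm x y := by
    obtain ⟨f, rfl⟩ := lead_surjective x
    obtain ⟨g, rfl⟩ := lead_surjective y
    rw [← map_mul, ← map_mul, lead_eq_iff]
    exact f.2.commutator g.2

theorem lead_eq_of_eventually {f g : LocalAlg κ} (h : ∀ᶠ N in atTop, f.1 N = g.1 N) :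
    lead f = lead g := by
  rw [lead_eq_iff, mem_orderIdeal]
  refine IsLocalSeq.zero.congr (h.mono fun N hN => ?_)
  simp [hN]

/-- Anything with a factor `1 / N` vanishes in the quotient, as does a change of finitely many
entries, so the γ-sequences are the only generators left. -/
theorem adjoin_lead_gammaLocal :
    Algebra.adjoin ℂ {x : LeadAlg κ | ∃ (M : ℕ) (a : TensorPow κ M), x = lead (gammaLocal a)} =
      ⊤ := by
  rw [eq_top_iff]
  suffices key : ∀ (f : ∀ N : ℕ+, TensorPow κ N) (hf : IsLocalSeq f),
      lead ⟨f, hf⟩ ∈ Algebra.adjoin ℂ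
        {x : LeadAlg κ | ∃ (M : ℕ) (a : TensorPow κ M), x = lead (gammaLocal a)} by
    rintro x -
    obtain ⟨⟨f, hf⟩, rfl⟩ := lead_surjective x
    exact key f hf
  intro f hf
  induction hf using IsLocalSeq.induction with
  | gammaBar a => exact Algebra.subset_adjoin ⟨_, a, rfl⟩
  | one => exact one_mem _
  | smul c f hf h => exact Subalgebra.smul_mem _ h c
  | inv_smul f hf h =>
    have : lead ⟨_, hf.inv_smul⟩ = 0 := by
      rw [lead_eq_zero_iff, mem_orderIdeal]
      refine hf.congr (.of_forall fun N => ?_)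
      have hN0 : ((N : ℕ) : ℂ) ≠ 0 := Nat.cast_ne_zero.2 N.ne_zero
      rw [smul_smul, mul_inv_cancel₀ hN0, one_smul]
    rw [this]
    exact zero_mem _
  | add f g hf hg h1 h2 => exact add_mem h1 h2
  | mul f g hf hg h1 h2 => exact mul_mem h1 h2
  | congr f g h hf ih =>
    rwa [lead_eq_of_eventually (f := ⟨f, hf⟩) (g := ⟨g, hf.congr h⟩) h] at ih

theorem tendsto_inv_natCast : Tendsto (fun N : ℕ+ => ((N : ℕ) : ℝ)⁻¹) atTop (𝓝 0) :=
  tendsto_inv_atTop_zero.comp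
    (tendsto_natCast_atTop_atTop.comp (tendsto_atTop.2 eventually_le_pnat))

section Class

variable [NeZero κ]

/-- The sequence `N f_N` is local, hence bounded, so the norm of `f_N` is O(1/N). -/
theorem localClass_eq_zero_of_mem {f : LocalAlg κ} (hf : f ∈ orderIdeal κ) : localClass f = 0 := by
  rw [← map_zero (localClass (κ := κ)), localClass_eq_iff]
  obtain ⟨C, hC⟩ := (mem_orderIdeal.1 hf).exists_norm_le
  refine squeeze_zero (fun _ => norm_nonneg _) (g := fun N : ℕ+ => ((N : ℕ) : ℝ)⁻¹ * C)
    (fun N => ?_) (by simpa using tendsto_inv_natCast.mul_const C)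
  have hN0 : (0 : ℝ) < N := Nat.cast_pos.2 N.pos
  have := hC N
  rw [norm_smul, Complex.norm_natCast] at this
  rw [le_inv_mul_iff₀ hN0]
  simpa using this

/-- The class of a local sequence depends only on the leading part. -/
def leadClass : LeadAlg κ →ₐ[ℂ] ClassAlg κ :=
  Ideal.Quotient.liftₐ (orderIdeal κ) (localClass (κ := κ) : LocalAlg κ →ₐ[ℂ] ClassAlg κ)
    fun _ => localClass_eq_zero_of_mem

theorem leadClass_lead (f : LocalAlg κ) : leadClass (lead f) = localClass f := rfl

/-- A local sequence need not itself belong to `GammaSeqAlg`, because of the factors `1 / N`.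
Passing through `LeadAlg` removes them and leaves the generators to be checked. -/
theorem localClass_mem (f : LocalAlg κ) : localClass f ∈ GammaClassAlg κ := by
  have h : ∀ x : LeadAlg κ, leadClass x ∈ GammaClassAlg κ := fun x => by
    have hx : x ∈ Algebra.adjoin ℂ
        {x : LeadAlg κ | ∃ (M : ℕ) (a : TensorPow κ M), x = lead (gammaLocal a)} := by
      rw [adjoin_lead_gammaLocal]
      trivial
    induction hx using Algebra.adjoin_induction with
    | mem x hx =>
      obtain ⟨M, a, rfl⟩ := hx
      exact ⟨gammaSeq a, StarAlgebra.subset_adjoin ℂ _ ⟨M, a, rfl⟩, rfl⟩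
    | algebraMap c =>
      rw [AlgHom.commutes]
      exact algebraMap_mem _ c
    | add x y _ _ h1 h2 => rw [map_add]; exact add_mem h1 h2
    | mul x y _ _ h1 h2 => rw [map_mul]; exact mul_mem h1 h2
  exact h (lead f)

theorem isLocalSeq_of_mem_gammaSeqAlg {f : BddSeq κ} (hf : f ∈ GammaSeqAlg κ) :
    IsLocalSeq fun N => f N := by
  unfold GammaSeqAlg at hf
  induction hf using StarAlgebra.adjoin_induction with
  | mem f hf =>
    obtain ⟨M, a, rfl⟩ := hf
    exact .gammaBar a
  | algebraMap c =>
    refine (IsLocalSeq.one.smul c).congr (.of_forall fun N => ?_)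
    rw [Algebra.algebraMap_eq_smul_one]
    rfl
  | add f g _ _ h1 h2 => exact h1.add h2
  | mul f g _ _ h1 h2 => exact h1.mul h2
  | star f _ h => exact h.conj

theorem mem_gammaClassAlg_iff {x : ClassAlg κ} :
    x ∈ GammaClassAlg κ ↔ ∃ f : LocalAlg κ, localClass f = x := by
  constructor
  · rintro ⟨f, hf, rfl⟩
    exact ⟨⟨_, isLocalSeq_of_mem_gammaSeqAlg hf⟩, rfl⟩
  · rintro ⟨f, rfl⟩
    exact localClass_mem f

end Class

end SpinChain

end

noncomputable section

namespace SpinChain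

open scoped Fin.CommRing

variable {κ : ℕ}

/-! ### Non-overlapping placements -/

/-- The first site of the `k`-th block if blocks of lengths `e 0, e 1, …` are put one after the
other, the `k`-th one being preceded by a gap of length `j k`. -/
def blockStart {n : ℕ} (j e : Fin n → ℕ) (k : Fin n) : ℕ :=
  ∑ l, ((if l ≤ k then j l else 0) + if l < k then e l else 0)

section BlockStart

variable {n : ℕ}

theorem blockStart_add (j e : Fin n → ℕ) (k : Fin n) :
    blockStart j e k + e k = ∑ l, ((if l ≤ k then j l else 0) + if l ≤ k then e l else 0) := by
  unfold blockStart
  rw [Finset.sum_add_distrib, Finset.sum_add_distrib, add_assoc]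
  congr 1
  have h : e k = ∑ l, if l = k then e l else 0 := by simp
  conv_lhs => rw [h]
  rw [← Finset.sum_add_distrib]
  refine Finset.sum_congr rfl fun l _ => ?_
  rcases lt_trichotomy l k with h | h | h
  · simp [h, h.ne, h.le]
  · simp [h]
  · simp [h.not_gt, h.ne', h.not_ge]

theorem blockStart_zero (j e : Fin (n + 1) → ℕ) : blockStart j e 0 = j 0 := by
  simp [blockStart]

theorem blockStart_succ (j e : Fin (n + 1) → ℕ) (k : Fin n) :
    blockStart j e k.succ = blockStart j e k.castSucc + e k.castSucc + j k.succ := by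
  rw [blockStart_add]
  have h : j k.succ = ∑ l, if l = k.succ then j l else 0 := by simp
  rw [h, ← Finset.sum_add_distrib]
  unfold blockStart
  refine Finset.sum_congr rfl fun l _ => ?_
  have h1 : l < k.succ ↔ l ≤ k.castSucc := by
    simp only [Fin.lt_def, Fin.le_def, Fin.val_succ, Fin.val_castSucc]
    omega
  have h2 : l ≤ k.succ ↔ l ≤ k.castSucc ∨ l = k.succ := by
    rw [le_iff_lt_or_eq, h1]
  by_cases hl : l ≤ k.castSucc
  · have h3 : l ≠ k.succ := fun h => by
      rw [h] at hl
      exact absurd hl (not_le.2 k.castSucc_lt_succ)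
    simp [h1, h2, hl, h3]
  · by_cases h3 : l = k.succ <;> simp [h1, h2, hl, h3]

theorem blockStart_cons_succ (j e : Fin (n + 1) → ℕ) (k : Fin n) :
    blockStart j e k.succ =
      j 0 + e 0 + blockStart (fun i => j i.succ) (fun i => e i.succ) k := by
  simp [blockStart, Fin.sum_univ_succ]

theorem blockStart_last_add (j e : Fin (n + 1) → ℕ) :
    blockStart j e (Fin.last n) + e (Fin.last n) = ∑ l, j l + ∑ l, e l := by
  rw [blockStart_add, ← Finset.sum_add_distrib]
  simp [Fin.le_last]

theorem blockStart_add_le_of_lt (j e : Fin n → ℕ) {k l : Fin n} (h : k < l) :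
    blockStart j e k + e k ≤ blockStart j e l := by
  rw [blockStart_add]
  refine Finset.sum_le_sum fun i _ => ?_
  by_cases hi : i ≤ k
  · simp [hi, hi.trans h.le, hi.trans_lt h]
  · simp [hi]

theorem blockStart_add_le (j e : Fin n → ℕ) (k : Fin n) :
    blockStart j e k + e k ≤ ∑ l, j l + ∑ l, e l := by
  rw [blockStart_add, ← Finset.sum_add_distrib]
  refine Finset.sum_le_sum fun i _ => ?_
  split_ifs <;> omega

end BlockStart

section NonOverlap

variable {N : ℕ} [NeZero N]

/-- The blocks of lengths `d k`, placed at `p k`, do not overlap. -/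
def NonOverlap {ℓ : ℕ} (d : Fin ℓ → ℕ) (p : Fin ℓ → Fin N) : Prop :=
  Function.Injective fun x : Σ k, Fin (d k) => cycSite N (d x.1) (p x.1) x.2

/-- The positions of blocks arranged along the chain in the order `σ`, with gaps `j`. -/
def arrange (N : ℕ) [NeZero N] {ℓ : ℕ} (d : Fin ℓ → ℕ) (j : Fin ℓ → ℕ)
    (σ : Equiv.Perm (Fin ℓ)) (r : Fin N) (i : Fin ℓ) : Fin N :=
  r + ((blockStart j (d ∘ σ) (σ.symm i) : ℕ) : Fin N)

theorem arrange_apply {ℓ : ℕ} (d j : Fin ℓ → ℕ) (σ : Equiv.Perm (Fin ℓ)) (r : Fin N) (k : Fin ℓ) :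
    arrange N d j σ r (σ k) = r + ((blockStart j (d ∘ σ) k : ℕ) : Fin N) := by
  simp [arrange]

theorem nonOverlap_arrange {ℓ : ℕ} {d j : Fin ℓ → ℕ} (h : ∑ k, j k + ∑ k, d k = N)
    (σ : Equiv.Perm (Fin ℓ)) (r : Fin N) : NonOverlap d (arrange N d j σ r) := by
  have hsum : ∑ k, j k + ∑ k, (d ∘ σ) k = N := by
    rw [← h]
    congr 1
    exact Equiv.sum_comp σ d
  rintro ⟨a, x⟩ ⟨b, y⟩ hxy
  obtain ⟨k, rfl⟩ := σ.surjective a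
  obtain ⟨l, rfl⟩ := σ.surjective b
  simp only [cycSite, arrange_apply, add_assoc] at hxy
  have hk := blockStart_add_le j (d ∘ σ) k
  have hl := blockStart_add_le j (d ∘ σ) l
  have hx : (x : ℕ) < (d ∘ σ) k := x.2
  have hy : (y : ℕ) < (d ∘ σ) l := y.2
  -- Gaps and lengths add up to `N`, so the offsets lie below `N` and can be compared as natural
  -- numbers.
  have heq := natCast_inj_of_lt (N := N) (i := blockStart j (d ∘ σ) k + x)
    (j := blockStart j (d ∘ σ) l + y) (by omega) (by omega)
    (by push_cast; exact add_left_cancel hxy)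
  rcases lt_trichotomy k l with hkl | rfl | hkl
  · have := blockStart_add_le_of_lt j (d ∘ σ) hkl
    omega
  · have : x = y := Fin.ext (by omega)
    rw [this]
  · have := blockStart_add_le_of_lt j (d ∘ σ) hkl
    omega

/-- Cyclic distances from the first block recover the starts of the blocks up to the leading gap.
Positive lengths keep the starts below `N`; a single block is its own origin, so there length `0`
does no harm. -/
theorem val_arrange_sub {m : ℕ} {d j : Fin (m + 1) → ℕ} (hN : ∑ k, j k + ∑ k, d k = N)
    (hd : 0 < m → ∀ k, 0 < d k) (σ : Equiv.Perm (Fin (m + 1))) (r : Fin N) (k : Fin (m + 1)) :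
    (arrange N d j σ r (σ k) - arrange N d j σ r (σ 0)).val + j 0 =
      blockStart j (d ∘ σ) k := by
  have hle : j 0 ≤ blockStart j (d ∘ σ) k := by
    rw [← blockStart_zero j (d ∘ σ)]
    rcases (Fin.zero_le k).eq_or_lt with rfl | h
    · exact le_rfl
    · exact (Nat.le_add_right _ _).trans (blockStart_add_le_of_lt j (d ∘ σ) h)
  have hlt : blockStart j (d ∘ σ) k - j 0 < N := by
    have h1 := blockStart_add_le j (d ∘ σ) k
    have h2 : ∑ k, (d ∘ σ) k = ∑ k, d k := Equiv.sum_comp σ d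
    rw [h2, hN] at h1
    rcases Nat.eq_zero_or_pos m with rfl | hm
    · have : k = 0 := Fin.ext (by omega)
      rw [this, blockStart_zero, Nat.sub_self]
      exact Nat.pos_of_neZero N
    · have := hd hm (σ k)
      have h3 : (d ∘ σ) k = d (σ k) := rfl
      omega
  rw [arrange_apply, arrange_apply, blockStart_zero, add_sub_add_left_eq_sub, ← Nat.cast_sub hle,
    Fin.val_natCast, Nat.mod_eq_of_lt hlt]
  omega

theorem blockStart_strictMono {m : ℕ} {d : Fin (m + 1) → ℕ} (j : Fin (m + 1) → ℕ)
    (hd : 0 < m → ∀ k, 0 < d k) : StrictMono (blockStart j d) := by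
  intro k l h
  have hm : 0 < m := by
    rcases Nat.eq_zero_or_pos m with rfl | hm
    · exact absurd (Fin.lt_def.1 h) (by omega)
    · exact hm
  have := blockStart_add_le_of_lt j d h
  have := hd hm k
  omega

/-- Once the first block is known, the cyclic distances from it determine the order by sorting, the
inner gaps as differences and the leading gap from the total length; the starting point follows. -/
theorem arrange_injective {m : ℕ} {d j j' : Fin (m + 1) → ℕ} (hj : ∑ k, j k + ∑ k, d k = N)
    (hj' : ∑ k, j' k + ∑ k, d k = N) (hd : 0 < m → ∀ k, 0 < d k)
    {σ σ' : Equiv.Perm (Fin (m + 1))} {r r' : Fin N}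
    (h : arrange N d j σ r = arrange N d j' σ' r') (h0 : σ 0 = σ' 0) :
    j = j' ∧ σ = σ' ∧ r = r' := by
  let f : Fin (m + 1) → ℕ := fun i => (arrange N d j σ r i - arrange N d j σ r (σ 0)).val
  have h1 : ∀ k, f (σ k) + j 0 = blockStart j (d ∘ σ) k := val_arrange_sub hj hd σ r
  have h2 : ∀ k, f (σ' k) + j' 0 = blockStart j' (d ∘ σ') k := fun k => by
    have := val_arrange_sub hj' hd σ' r' k
    rwa [← h, ← h0] at this
  have hm1 : StrictMono (f ∘ σ) := fun k l hkl => by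
    have := blockStart_strictMono (d := d ∘ σ) j (fun hm k => hd hm _) hkl
    have := h1 k
    have := h1 l
    simp only [Function.comp]
    omega
  have hm2 : StrictMono (f ∘ σ') := fun k l hkl => by
    have := blockStart_strictMono (d := d ∘ σ') j' (fun hm k => hd hm _) hkl
    have := h2 k
    have := h2 l
    simp only [Function.comp]
    omega
  have hfσ := Tuple.unique_monotone hm1.monotone hm2.monotone
  have hinj : Function.Injective f := by
    have := hm1.injective.comp σ.symm.injective
    simpa [Function.comp_def] using this
  have hσ : σ = σ' := Equiv.ext fun k => hinj (congrFun hfσ k)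
  subst hσ
  have hs : ∀ k : Fin m, j k.succ = j' k.succ := fun k => by
    have e1 := h1 k.succ
    have e2 := h2 k.succ
    rw [blockStart_succ, ← h1 k.castSucc] at e1
    rw [blockStart_succ, ← h2 k.castSucc] at e2
    omega
  have hz : j 0 = j' 0 := by
    have e : ∑ k, j k = ∑ k, j' k := by omega
    rw [Fin.sum_univ_succ, Fin.sum_univ_succ, Finset.sum_congr rfl fun k _ => hs k] at e
    omega
  refine ⟨funext fun k => Fin.cases hz hs k, rfl, ?_⟩
  have := congrFun h (σ 0)
  rw [arrange_apply, arrange_apply, blockStart_zero, blockStart_zero, hz] at this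
  exact add_right_cancel this

/-- Sort the blocks by cyclic distance from block `k₀`. The leading gap is what remains between the
end of the last block and `k₀` when going around the circle. -/
theorem exists_arrange_eq {m : ℕ} {d : Fin (m + 1) → ℕ} (hd : 0 < m → ∀ k, 0 < d k)
    {p : Fin (m + 1) → Fin N} (hp : NonOverlap d p) (k₀ : Fin (m + 1)) :
    ∃ (j : Fin (m + 1) → ℕ) (σ : Equiv.Perm (Fin (m + 1))) (r : Fin N),
      ∑ k, j k + ∑ k, d k = N ∧ arrange N d j σ r = p ∧ σ 0 = k₀ := by
  let f : Fin (m + 1) → ℕ := fun i => (p i - p k₀).val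
  have hfN : ∀ i, f i < N := fun i => (p i - p k₀).2
  have hf : ∀ i, ((f i : ℕ) : Fin N) = p i - p k₀ := fun i => Fin.cast_val_eq_self _
  have hfinj : Function.Injective f := by
    intro a b hab
    rcases Nat.eq_zero_or_pos m with rfl | hm
    · exact Fin.ext (by omega)
    · have h1 : p a = p b := sub_left_injective (Fin.ext hab)
      have := @hp ⟨a, ⟨0, hd hm a⟩⟩ ⟨b, ⟨0, hd hm b⟩⟩ (by simp [cycSite, h1])
      exact congrArg Sigma.fst this
  let σ := Tuple.sort f
  have hmono : StrictMono (f ∘ σ) :=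
    (Tuple.monotone_sort f).strictMono_of_injective (hfinj.comp σ.injective)
  have hk₀ : f k₀ = 0 := by simp [f]
  have hσ0 : σ 0 = k₀ := by
    refine hfinj ?_
    have h1 : f (σ 0) ≤ f (σ (σ.symm k₀)) := hmono.monotone (Fin.zero_le _)
    rw [Equiv.apply_symm_apply] at h1
    omega
  have hgap : ∀ k : Fin m, f (σ k.castSucc) + d (σ k.castSucc) ≤ f (σ k.succ) := by
    intro k
    by_contra! hlt
    have hm : 0 < m := k.pos
    have h1 : f (σ k.castSucc) < f (σ k.succ) := hmono k.castSucc_lt_succ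
    have h2 := @hp ⟨σ k.castSucc, ⟨f (σ k.succ) - f (σ k.castSucc), by omega⟩⟩
      ⟨σ k.succ, ⟨0, hd hm _⟩⟩ (by
        simp only [cycSite, Nat.cast_sub h1.le, hf]
        simp)
    have h3 := σ.injective (congrArg Sigma.fst h2)
    exact absurd h3 k.castSucc_lt_succ.ne
  -- Otherwise the last block would run around the circle into the first site of `k₀`; a single
  -- block would run into its own first site.
  have hlast : f (σ (Fin.last m)) + d (σ (Fin.last m)) ≤ N := by
    by_contra! hlt
    have hdk : 0 < d k₀ := by
      rcases Nat.eq_zero_or_pos m with rfl | hm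
      · rw [show k₀ = σ (Fin.last 0) from Fin.ext (by omega)]
        have := hfN (σ (Fin.last 0))
        omega
      · exact hd hm k₀
    have h1 := hfN (σ (Fin.last m))
    have h2 := @hp ⟨σ (Fin.last m), ⟨N - f (σ (Fin.last m)), by omega⟩⟩ ⟨k₀, ⟨0, hdk⟩⟩ (by
        simp only [cycSite, Nat.cast_sub h1.le, hf]
        simp)
    have h3 : N - f (σ (Fin.last m)) = 0 := by
      have h4 : ∀ x y : Σ k, Fin (d k), x = y → (x.2 : ℕ) = y.2 := by rintro x y rfl; rfl
      exact h4 _ _ h2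
    omega
  let j : Fin (m + 1) → ℕ := Fin.cons (N - (f (σ (Fin.last m)) + d (σ (Fin.last m))))
    fun k : Fin m => f (σ k.succ) - (f (σ k.castSucc) + d (σ k.castSucc))
  have hpos : ∀ k, blockStart j (d ∘ σ) k = j 0 + f (σ k) := by
    intro k
    induction k using Fin.induction with
    | zero => rw [blockStart_zero, hσ0, hk₀, add_zero]
    | succ k ih =>
      have h1 := hgap k
      have h2 : j k.succ = f (σ k.succ) - (f (σ k.castSucc) + d (σ k.castSucc)) := rfl
      rw [blockStart_succ, ih, h2]
      simp only [Function.comp]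
      omega
  refine ⟨j, σ, p k₀ - (j 0 : ℕ), ?_, ?_, hσ0⟩
  · have h1 := blockStart_last_add j (d ∘ σ)
    have h2 : ∑ k, (d ∘ σ) k = ∑ k, d k := Equiv.sum_comp σ d
    have h3 : j 0 = N - (f (σ (Fin.last m)) + d (σ (Fin.last m))) := rfl
    have h4 : (d ∘ σ) (Fin.last m) = d (σ (Fin.last m)) := rfl
    rw [hpos, h2, h4] at h1
    omega
  · funext i
    obtain ⟨k, rfl⟩ := σ.surjective i
    rw [arrange_apply, hpos]
    push_cast
    rw [hf]
    ring

/-- Every non-overlapping placement of `m + 1` blocks arises from `m + 1` arrangements. -/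
theorem sum_arrange {m : ℕ} {d : Fin (m + 1) → ℕ} (hd : 0 < m → ∀ k, 0 < d k)
    (hN : ∑ k, d k ≤ N) {E : Type*} [AddCommMonoid E] (G : (Fin (m + 1) → Fin N) → E)
    [DecidablePred (NonOverlap d (N := N))] :
    ∑ j ∈ Finset.piAntidiag Finset.univ (N - ∑ k, d k), ∑ σ : Equiv.Perm (Fin (m + 1)),
      ∑ r : Fin N, G (arrange N d j σ r) =
    (m + 1) • ∑ p, if NonOverlap d p then G p else 0 := by
  have hmem : ∀ j : Fin (m + 1) → ℕ, j ∈ Finset.piAntidiag Finset.univ (N - ∑ k, d k) ↔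
      ∑ k, j k + ∑ k, d k = N := fun j => by
    rw [Finset.mem_piAntidiag]
    constructor
    · rintro ⟨h, -⟩
      change ∑ k, j k = _ at h
      omega
    · intro h
      refine ⟨?_, by simp⟩
      change ∑ k, j k = _
      omega
  have h1 : (m + 1) • ∑ p, (if NonOverlap d p then G p else 0) =
      ∑ x ∈ (Finset.univ.filter (NonOverlap d (N := N))) ×ˢ (Finset.univ : Finset (Fin (m + 1))),
        G x.1 := by
    rw [Finset.sum_product]
    simp only [Finset.sum_const, Finset.card_univ, Fintype.card_fin]
    rw [← Finset.smul_sum, Finset.sum_filter]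
  have h2 : ∑ j ∈ Finset.piAntidiag Finset.univ (N - ∑ k, d k), ∑ σ : Equiv.Perm (Fin (m + 1)),
      ∑ r : Fin N, G (arrange N d j σ r) =
      ∑ x ∈ (Finset.piAntidiag Finset.univ (N - ∑ k, d k)) ×ˢ
        ((Finset.univ : Finset (Equiv.Perm (Fin (m + 1)))) ×ˢ (Finset.univ : Finset (Fin N))),
        G (arrange N d x.1 x.2.1 x.2.2) := by
    rw [Finset.sum_product]
    refine Finset.sum_congr rfl fun j _ => ?_
    rw [Finset.sum_product]
  rw [h1, h2]
  -- Arrangements correspond to placements with a marked block, the one coming first; the marking is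
  -- the factor `m + 1`.
  refine Finset.sum_bij (fun x _ => (arrange N d x.1 x.2.1 x.2.2, x.2.1 0)) ?_ ?_ ?_ ?_
  · rintro ⟨j, σ, r⟩ hx
    simp only [Finset.mem_product, hmem] at hx
    simp only [Finset.mem_product, Finset.mem_filter, Finset.mem_univ, true_and, and_true]
    exact nonOverlap_arrange hx.1 σ r
  · rintro ⟨j, σ, r⟩ hx ⟨j', σ', r'⟩ hx' h
    simp only [Finset.mem_product, hmem] at hx hx'
    rw [Prod.mk.injEq] at h
    obtain ⟨rfl, rfl, rfl⟩ := arrange_injective hx.1 hx'.1 hd h.1 h.2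
    rfl
  · rintro ⟨p, k₀⟩ hx
    simp only [Finset.mem_product, Finset.mem_filter, Finset.mem_univ, true_and, and_true] at hx
    obtain ⟨j, σ, r, hj, hp, h0⟩ := exists_arrange_eq hd hx k₀
    exact ⟨(j, σ, r), by simp [hmem, hj], by simp [hp, h0]⟩
  · rintro ⟨j, σ, r⟩ _
    rfl

theorem NonOverlap.sum_le {ℓ : ℕ} {d : Fin ℓ → ℕ} {p : Fin ℓ → Fin N} (hp : NonOverlap d p) :
    ∑ k, d k ≤ N := by
  have := Fintype.card_le_of_injective _ hp
  simpa using this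

end NonOverlap

end SpinChain

end

noncomputable section

namespace SpinChain

open scoped Fin.CommRing

variable {κ : ℕ}

/-! ### Canonical sequences as sums over non-overlapping placements -/

section PlacementSum

variable {N : ℕ} [NeZero N]

theorem tmul_eq {m n : ℕ} (x : TensorPow κ m) (y : TensorPow κ n) :
    tmul x y = emb (Fin.castAdd n) x * emb (Fin.natAdd m) y := by
  have h1 : emb (Fin.castAdd n) x = emb (finSumFinEquiv (m := m) (n := n)) (emb Sum.inl x) := by
    rw [emb_emb finSumFinEquiv.injective]
    rfl
  have h2 : emb (Fin.natAdd m) y = emb (finSumFinEquiv (m := m) (n := n)) (emb Sum.inr y) := by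
    rw [emb_emb finSumFinEquiv.injective]
    rfl
  rw [h1, h2, ← emb_mul finSumFinEquiv.injective]
  ext s t
  rw [emb_apply_of_surjective finSumFinEquiv.surjective, emb_inl_mul_emb_inr_apply]
  rfl

theorem place_tmul {m n : ℕ} (h : m + n ≤ N) (r : Fin N) (x : TensorPow κ m)
    (y : TensorPow κ n) : place N r (tmul x y) = place N r x * place N (r + (m : Fin N)) y := by
  rw [tmul_eq, place_mul h, place_emb h r r _ fun i => by simp,
    place_emb h r (r + (m : Fin N)) _ fun i => by simp [add_assoc]]

/-- The product of the operators `a_k` placed one after the other, starting from `r`, with gaps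
`j_k`. -/
def chainProd (N : ℕ) [NeZero N] : Fin N → List (ℕ × Σ M, TensorPow κ M) → TensorPow κ N
  | _, [] => 1
  | r, (j, a) :: L => place N (r + (j : Fin N)) a.2 * chainProd N (r + (j : Fin N) + (a.1 : Fin N)) L

theorem place_interleave (L : List (ℕ × Σ M, TensorPow κ M)) (r : Fin N)
    (h : (interleave L).1 ≤ N) : place N r (interleave L).2 = chainProd N r L := by
  induction L generalizing r with
  | nil => exact place_one r
  | cons x L ih =>
    obtain ⟨j, a⟩ := x
    have h' : j + a.1 + (interleave L).1 ≤ N := h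
    change place N r (tmul (tmul (1 : TensorPow κ j) a.2) (interleave L).2) = _
    rw [place_tmul h', place_tmul (by omega), place_one, one_mul, ih _ (by omega)]
    push_cast
    rw [← add_assoc]
    rfl

theorem interleave_ofFn_fst {ℓ : ℕ} (j : Fin ℓ → ℕ) (a : Fin ℓ → Σ M, TensorPow κ M) :
    (interleave (List.ofFn fun k => (j k, a k))).1 = ∑ k, j k + ∑ k, (a k).1 := by
  induction ℓ with
  | zero => simp [interleave]
  | succ ℓ ih =>
    rw [List.ofFn_succ, Fin.sum_univ_succ, Fin.sum_univ_succ]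
    change j 0 + (a 0).1 + (interleave (List.ofFn fun k : Fin ℓ => (j k.succ, a k.succ))).1 = _
    rw [ih (fun k => j k.succ) fun k => a k.succ]
    omega

theorem chainProd_ofFn {ℓ : ℕ} (j : Fin ℓ → ℕ) (a : Fin ℓ → Σ M, TensorPow κ M) (r : Fin N) :
    chainProd N r (List.ofFn fun k => (j k, a k)) =
      (List.ofFn fun k => place N
        (r + ((blockStart j (fun k => (a k).1) k : ℕ) : Fin N)) (a k).2).prod := by
  induction ℓ generalizing r with
  | zero => simp [chainProd]
  | succ ℓ ih =>
    rw [List.ofFn_succ, List.ofFn_succ, List.prod_cons, blockStart_zero]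
    change place N (r + (j 0 : Fin N)) (a 0).2 * chainProd N
      (r + (j 0 : Fin N) + ((a 0).1 : Fin N)) (List.ofFn fun k : Fin ℓ => (j k.succ, a k.succ)) = _
    rw [ih (fun k => j k.succ) fun k => a k.succ]
    congr 3
    funext k
    rw [blockStart_cons_succ]
    push_cast
    simp only [add_assoc]

theorem castTensorPow_eq_place {m : ℕ} (h : m = N) (x : TensorPow κ m) :
    castTensorPow h x = place N 0 x := by
  subst h
  have : cycSite m m 0 = fun i => i := by
    funext i
    simp [cycSite]
  unfold place
  rw [this, emb_id]
  rfl

theorem toTensorPow_interleave {ℓ : ℕ} (j : Fin ℓ → ℕ) (a : Fin ℓ → Σ M, TensorPow κ M)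
    (h : ∑ k, j k + ∑ k, (a k).1 = N) :
    toTensorPow N (interleave (List.ofFn fun k => (j k, a k))) =
      (List.ofFn fun k => place N
        (((blockStart j (fun k => (a k).1) k : ℕ) : Fin N)) (a k).2).prod := by
  have h1 := (interleave_ofFn_fst j a).trans h
  rw [toTensorPow, dif_pos h1, castTensorPow_eq_place h1, place_interleave _ _ h1.le,
    chainProd_ofFn]
  simp only [zero_add]

theorem avg_prod_place {ℓ : ℕ} {d : Fin ℓ → ℕ} (p : Fin ℓ → Fin N)
    (a : ∀ k, TensorPow κ (d k)) :
    avg N (List.ofFn fun k => place N (p k) (a k)).prod =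
      (N : ℂ)⁻¹ • ∑ r : Fin N, (List.ofFn fun k => place N (r + p k) (a k)).prod := by
  have h : ∀ i : ℕ, (shift N)^[i] (List.ofFn fun k => place N (p k) (a k)).prod =
      (List.ofFn fun k => place N (0 - (i : Fin N) + p k) (a k)).prod := fun i => by
    induction i with
    | zero => simp
    | succ i ih =>
      rw [Function.iterate_succ_apply', ih, map_list_prod, List.map_ofFn]
      congr 2
      funext k
      rw [Function.comp, shift_place]
      push_cast
      ring_nf
  rw [avg_apply]
  simp only [h]
  rw [sum_range_sub_eq_sum_fin 0 fun r => (List.ofFn fun k => place N (r + p k) (a k)).prod]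

theorem NonOverlap.commute {ℓ : ℕ} {d : Fin ℓ → ℕ} {p : Fin ℓ → Fin N} (hp : NonOverlap d p)
    {k l : Fin ℓ} (hkl : k ≠ l) (x : TensorPow κ (d k)) (y : TensorPow κ (d l)) :
    Commute (place N (p k) x) (place N (p l) y) := by
  have hle : ∀ k, d k ≤ N := fun k =>
    (Finset.single_le_sum (fun _ _ => Nat.zero_le _) (Finset.mem_univ k)).trans hp.sum_le
  refine commute_place (hle k) (hle l) (fun i j hij => hkl ?_) x y
  exact congrArg Sigma.fst (@hp ⟨k, i⟩ ⟨l, j⟩ hij)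

/-- Operators on disjoint windows commute, so the order of the factors is immaterial. -/
theorem NonOverlap.prod_comp_perm {ℓ : ℕ} {d : Fin ℓ → ℕ} {p : Fin ℓ → Fin N}
    (hp : NonOverlap d p) (a : ∀ k, TensorPow κ (d k)) (σ : Equiv.Perm (Fin ℓ)) :
    (List.ofFn fun k => place N (p (σ k)) (a (σ k))).prod =
      (List.ofFn fun k => place N (p k) (a k)).prod := by
  refine (Equiv.Perm.ofFn_comp_perm σ fun k => place N (p k) (a k)).prod_eq' ?_
  rw [List.pairwise_ofFn]
  intro i j hij
  exact hp.commute (σ.injective.ne hij.ne) _ _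

open Classical in
/-- The normalized sum over all non-overlapping placements of `a 0, a 1, …` along the cyclic
chain. -/
def placementSum (N : ℕ) [NeZero N] {ℓ : ℕ} (d : Fin ℓ → ℕ) :
    MultilinearMap ℂ (fun k => TensorPow κ (d k)) (TensorPow κ N) :=
  ((N : ℂ) ^ ℓ)⁻¹ • ∑ p : Fin ℓ → Fin N, if NonOverlap d p then
    (MultilinearMap.mkPiAlgebraFin ℂ ℓ (TensorPow κ N)).compLinearMap fun k => place N (p k) else 0

open Classical in
theorem placementSum_apply {ℓ : ℕ} (d : Fin ℓ → ℕ) (a : ∀ k, TensorPow κ (d k)) :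
    placementSum N d a = ((N : ℂ) ^ ℓ)⁻¹ • ∑ p : Fin ℓ → Fin N, if NonOverlap d p then
      (List.ofFn fun k => place N (p k) (a k)).prod else 0 := by
  rw [placementSum, smul_apply, sum_apply]
  congr 1
  refine Finset.sum_congr rfl fun p _ => ?_
  split_ifs
  · rw [MultilinearMap.compLinearMap_apply, MultilinearMap.mkPiAlgebraFin_apply]
  · rfl

/-- Allows a placement sum to be attached to a multiset of factors, that is, to a monomial. -/
theorem placementSum_comp_perm {ℓ : ℕ} (d : Fin ℓ → ℕ) (a : ∀ k, TensorPow κ (d k))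
    (σ : Equiv.Perm (Fin ℓ)) :
    placementSum N (fun k => d (σ k)) (fun k => a (σ k)) = placementSum N d a := by
  classical
  rw [placementSum_apply, placementSum_apply]
  congr 1
  rw [← Equiv.sum_comp (Equiv.arrowCongr σ.symm (Equiv.refl (Fin N)))]
  refine Finset.sum_congr rfl fun p _ => ?_
  have hp : (Equiv.arrowCongr σ.symm (Equiv.refl (Fin N))) p = fun k => p (σ k) := by
    funext k
    simp
  have hiff : NonOverlap (fun k => d (σ k)) (fun k => p (σ k)) ↔ NonOverlap d p := by
    have h : (fun x : Σ k, Fin (d (σ k)) => cycSite N (d (σ x.1)) (p (σ x.1)) x.2) =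
      (fun x : Σ k, Fin (d k) => cycSite N (d x.1) (p x.1) x.2) ∘
        (Equiv.sigmaCongrLeft (β := fun k => Fin (d k)) σ) := rfl
    unfold NonOverlap
    rw [h]
    exact (Equiv.injective_comp _ _)
  rw [hp]
  by_cases h : NonOverlap d p
  · rw [if_pos h, if_pos (hiff.2 h), h.prod_comp_perm a σ]
  · rw [if_neg h, if_neg (mt hiff.1 h)]

end PlacementSum

/-- Each placement comes from ℓ arrangements, which cancels the weight 1/ℓ of the symmetrization,
and the factor 1/N of the cyclic average turns N^{-(ℓ-1)} into N^{-ℓ}. The gaps, the order along the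
chain and the starting point disappear from the formula. -/
theorem IrrFamily.canonicalSeq_eq (F : IrrFamily κ) (N : ℕ+) :
    F.canonicalSeq N = placementSum N (fun k => (F.factor k).1) fun k => (F.factor k).2 := by
  classical
  obtain ⟨ℓ, hℓ, a, hirr, hd⟩ := F
  obtain ⟨m, rfl⟩ : ∃ m, ℓ = m + 1 := ⟨ℓ - 1, by omega⟩
  let G : (Fin (m + 1) → Fin N) → TensorPow κ N := fun p =>
    (List.ofFn fun k => place N (p k) (a k).2).prod
  rw [placementSum_apply, IrrFamily.canonicalSeq]
  by_cases hN : ∑ k, (a k).1 ≤ N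
  swap
  · refine (if_neg hN).trans ?_
    rw [Finset.sum_eq_zero, smul_zero]
    intro p _
    exact if_neg fun hp => hN hp.sum_le
  refine (if_pos hN).trans ?_
  have hN0 : ((N : ℕ) : ℂ) ≠ 0 := Nat.cast_ne_zero.2 N.ne_zero
  have hterm : ∀ j ∈ Finset.piAntidiag Finset.univ ((N : ℕ) - ∑ k, (a k).1),
      avg N (IrrFamily.symm ⟨m + 1, hℓ, a, hirr, hd⟩ N j) =
      (((m + 1 : ℕ) : ℂ)⁻¹ * ((N : ℕ) : ℂ)⁻¹) • ∑ σ : Equiv.Perm (Fin (m + 1)),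
        ∑ r : Fin N, G (arrange N (fun k => (a k).1) j σ r) := by
    intro j hj
    have hsum : ∑ k, j k + ∑ k, (a k).1 = N := by
      have : ∑ k, j k = (N : ℕ) - ∑ k, (a k).1 := (Finset.mem_piAntidiag.1 hj).1
      omega
    rw [IrrFamily.symm, map_smul, map_sum, mul_smul]
    congr 1
    rw [Finset.smul_sum]
    refine Finset.sum_congr rfl fun σ _ => ?_
    have hσ : ∑ k, j k + ∑ k, (a (σ k)).1 = N := by
      rw [Equiv.sum_comp σ fun k => (a k).1, hsum]
    rw [toTensorPow_interleave j (fun k => a (σ k)) hσ]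
    rw [avg_prod_place (d := fun k => (a (σ k)).1)
      (fun k => ((blockStart j (fun k => (a (σ k)).1) k : ℕ) : Fin N)) fun k => (a (σ k)).2]
    congr 1
    refine Finset.sum_congr rfl fun r _ => ?_
    have hno := nonOverlap_arrange (d := fun k => (a k).1) hsum σ r
    change _ = (List.ofFn fun k => place N (arrange N (fun k => (a k).1) j σ r k) (a k).2).prod
    rw [← hno.prod_comp_perm (fun k => (a k).2) σ]
    congr 2
    funext k
    rw [arrange_apply]
    rfl
  change (((N : ℕ) : ℂ) ^ m)⁻¹ • ∑ j ∈ Finset.piAntidiag Finset.univ ((N : ℕ) - ∑ k, (a k).1), _ =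
    (((N : ℕ) : ℂ) ^ (m + 1))⁻¹ • ∑ p : Fin (m + 1) → Fin N,
      if NonOverlap (fun k => (a k).1) p then
        (List.ofFn fun k => place N (p k) (a k).2).prod else 0
  rw [Finset.sum_congr rfl hterm, ← Finset.smul_sum,
    sum_arrange (fun hm k => hd (by omega) k) hN G, ← Nat.cast_smul_eq_nsmul ℂ, smul_smul, smul_smul]
  congr 1
  have hm0 : ((m + 1 : ℕ) : ℂ) ≠ 0 := Nat.cast_ne_zero.2 (Nat.succ_ne_zero m)
  rw [pow_succ]
  field_simp

end SpinChain

end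

noncomputable section

namespace SpinChain

open scoped Fin.CommRing

variable {κ : ℕ}

/-! ### Placement sums as local sequences, and their classes -/

namespace LocalFamily

open Classical in
theorem avoid {n : ℕ} {f : ∀ N : ℕ+, (Fin n → Fin N) → TensorPow κ N} (hf : LocalFamily n f)
    {ι : Type*} (s : Finset ι) (k l : ι → Fin n) (z : ι → ℤ) :
    LocalFamily n fun N q =>
      if ∃ i ∈ s, q (k i) = q (l i) + ((z i : ℤ) : Fin N) then 0 else f N q := by
  induction s using Finset.induction_on with
  | empty => simpa using hf
  | insert i s _ ih =>
    refine congr (.of_forall fun N => funext fun q => ?_) (ih.indicator_not_mul (k i) (l i) (z i))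
    by_cases h1 : q (k i) = q (l i) + ((z i : ℤ) : Fin N)
    · simp [h1]
    · simp [h1]

end LocalFamily

section Overlap

variable {ℓ : ℕ} (d : Fin ℓ → ℕ)

/-- The pairs of sites which must not coincide in a non-overlapping placement. -/
def overlapPairs : Finset ((Σ k, Fin (d k)) × Σ k, Fin (d k)) :=
  Finset.univ.filter fun x => x.1.1 ≠ x.2.1

/-- Expresses non-overlap by finitely many forbidden coincidences that do not depend on `N`, the
form which the indicators in `LocalFamily` can encode. A block of length at most `N` never meets
itself, so only pairs of different blocks matter. -/
theorem nonOverlap_iff {N : ℕ} [NeZero N] (hd : ∀ k, d k ≤ N) (p : Fin ℓ → Fin N) :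
    NonOverlap d p ↔ ¬∃ x ∈ overlapPairs d,
      p x.1.1 = p x.2.1 + (((x.2.2 : ℕ) - (x.1.2 : ℕ) : ℤ) : Fin N) := by
  constructor
  · rintro h ⟨⟨x, y⟩, hxy, heq⟩
    simp only [overlapPairs, Finset.mem_filter, Finset.mem_univ, true_and] at hxy
    refine hxy (congrArg Sigma.fst (@h x y ?_))
    simp only [cycSite]
    push_cast at heq
    linear_combination heq
  · rintro h ⟨k, i⟩ ⟨l, j⟩ heq
    by_cases hkl : k = l
    · subst hkl
      have hij : i = j := cycSite_injective (hd k) (p k) heq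
      rw [hij]
    · refine absurd ⟨(⟨k, i⟩, ⟨l, j⟩), by simp [overlapPairs, hkl], ?_⟩ h
      simp only [cycSite] at heq
      push_cast
      linear_combination heq

theorem isLocalSeq_placementSum (a : ∀ k, TensorPow κ (d k)) :
    IsLocalSeq fun N : ℕ+ => placementSum N d a := by
  classical
  have h1 : LocalFamily ℓ fun (N : ℕ+) q => (List.ofFn fun k => place N (q k) (a k)).prod :=
    LocalFamily.list_prod (F := fun k (N : ℕ+) (q : Fin ℓ → Fin N) => place N (q k) (a k))
      fun k => by simpa using LocalFamily.place k 0 (a k)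
  have h2 := (h1.avoid (overlapPairs d) (fun x => x.1.1) (fun x => x.2.1)
    fun x => ((x.2.2 : ℕ) - (x.1.2 : ℕ) : ℤ)).avg_all
  refine IsLocalSeq.congr ?_ h2
  filter_upwards [Filter.eventually_all.2 fun k => eventually_le_pnat (d k)] with N hN
  rw [placementSum_apply]
  congr 1
  refine Finset.sum_congr rfl fun p _ => ?_
  by_cases h : NonOverlap d p
  · rw [if_pos h, if_neg ((nonOverlap_iff d hN p).1 h)]
  · rw [if_neg h, if_pos]
    rwa [nonOverlap_iff d hN p, not_not] at h

/-- A configuration with the coincidence is determined by its other positions, so overwriting the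
`k`-th one arbitrarily gives pairwise different configurations. -/
theorem card_coincidence_le {N : ℕ} [NeZero N] {k l : Fin ℓ} (hkl : k ≠ l) (c : Fin N) :
    N * (Finset.univ.filter fun p : Fin ℓ → Fin N => p k = p l + c).card ≤ N ^ ℓ := by
  have h := Finset.card_le_card_of_injOn
    (s := (Finset.univ : Finset (Fin N)) ×ˢ
      Finset.univ.filter fun p : Fin ℓ → Fin N => p k = p l + c)
    (t := (Finset.univ : Finset (Fin ℓ → Fin N))) (fun x => Function.update x.2 k x.1)
    (fun _ _ => by simp) (by
      rintro ⟨x, p⟩ hp ⟨y, q⟩ hq h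
      simp only [Finset.coe_product, Finset.coe_univ, Finset.coe_filter, Set.mem_prod,
        Set.mem_univ, true_and, Set.mem_ofPred_eq, Finset.mem_univ] at hp hq
      have h1 : x = y := by simpa using congrFun h k
      have h2 : ∀ i, i ≠ k → p i = q i := fun i hi => by simpa [hi] using congrFun h i
      have h3 : p = q := by
        funext i
        by_cases hi : i = k
        · rw [hi, hp, hq, h2 l hkl.symm]
        · exact h2 i hi
      rw [h1, h3])
  simpa [Finset.card_product] using h

theorem norm_prod_place_le [NeZero κ] {N : ℕ} [NeZero N] (hd : ∀ k, d k ≤ N) (p : Fin ℓ → Fin N)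
    (a : ∀ k, TensorPow κ (d k)) :
    ‖(List.ofFn fun k => place N (p k) (a k)).prod‖ ≤ ∏ k, ‖a k‖ := by
  refine (List.norm_prod_le _).trans ?_
  rw [List.map_ofFn, List.prod_ofFn]
  exact Finset.prod_le_prod (fun _ _ => norm_nonneg _) fun k _ => norm_place_le (hd k) (p k) (a k)

theorem prod_gammaBar {N : ℕ} [NeZero N] (hd : ∀ k, d k ≤ N) (a : ∀ k, TensorPow κ (d k)) :
    (List.ofFn fun k => gammaBar (a k) N).prod =
      ((N : ℂ) ^ ℓ)⁻¹ • ∑ p : Fin ℓ → Fin N, (List.ofFn fun k => place N (p k) (a k)).prod := by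
  have h := (MultilinearMap.mkPiAlgebraFin ℂ ℓ (TensorPow κ N)).map_sum
    fun k (p : Fin N) => place N p (a k)
  have h2 := (MultilinearMap.mkPiAlgebraFin ℂ ℓ (TensorPow κ N)).map_smul_univ
    (fun _ => (N : ℂ)⁻¹) fun k => ∑ p : Fin N, place N p (a k)
  simp only [MultilinearMap.mkPiAlgebraFin_apply] at h h2
  rw [← h, ← inv_pow]
  simp only [Finset.prod_const, Finset.card_univ, Fintype.card_fin] at h2
  rw [← h2]
  congr 2
  funext k
  exact gammaBar_eq (hd k) (a k)

/-- The product of γ-averages is the same sum without the restriction, and the overlapping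
placements number O(N^{ℓ-1}) among N^ℓ. -/
theorem tendsto_prod_gammaBar_sub_placementSum [NeZero κ] (a : ∀ k, TensorPow κ (d k)) :
    Tendsto (fun N : ℕ+ => ‖(List.ofFn fun k => gammaBar (a k) N).prod - placementSum N d a‖)
      atTop (𝓝 0) := by
  classical
  have hlim := tendsto_inv_natCast.mul_const ((overlapPairs d).card * ∏ k, ‖a k‖)
  rw [zero_mul] at hlim
  refine squeeze_zero' (.of_forall fun _ => norm_nonneg _) ?_ hlim
  filter_upwards [Filter.eventually_all.2 fun k => eventually_le_pnat (d k)] with N hN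
  have hN0 : (0 : ℝ) < N := Nat.cast_pos.2 N.pos
  rw [prod_gammaBar d hN, placementSum_apply, ← smul_sub, ← Finset.sum_sub_distrib]
  have h1 : ∀ p : Fin ℓ → Fin N, ‖(List.ofFn fun k => place N (p k) (a k)).prod -
      (if NonOverlap d p then (List.ofFn fun k => place N (p k) (a k)).prod else 0)‖ ≤
      ∑ x ∈ overlapPairs d, if p x.1.1 = p x.2.1 + (((x.2.2 : ℕ) - (x.1.2 : ℕ) : ℤ) : Fin N) then
        ∏ k, ‖a k‖ else 0 := by
    intro p
    have hprod : 0 ≤ ∏ k, ‖a k‖ := Finset.prod_nonneg fun _ _ => norm_nonneg _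
    have hnn : ∀ x ∈ overlapPairs d,
        0 ≤ if p x.1.1 = p x.2.1 + (((x.2.2 : ℕ) - (x.1.2 : ℕ) : ℤ) : Fin N) then
          ∏ k, ‖a k‖ else 0 := fun x _ => by
      split_ifs
      · exact hprod
      · exact le_rfl
    by_cases h : NonOverlap d p
    · rw [if_pos h, sub_self, norm_zero]
      exact Finset.sum_nonneg hnn
    · rw [if_neg h, sub_zero]
      rw [nonOverlap_iff d hN p, not_not] at h
      obtain ⟨x, hx, hpx⟩ := h
      refine le_trans ?_ (Finset.single_le_sum hnn hx)
      rw [if_pos hpx]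
      exact norm_prod_place_le d hN p a
  have h2 : ‖∑ p : Fin ℓ → Fin N, ((List.ofFn fun k => place N (p k) (a k)).prod -
      (if NonOverlap d p then (List.ofFn fun k => place N (p k) (a k)).prod else 0))‖ ≤
      ∑ x ∈ overlapPairs d, ((Finset.univ.filter fun p : Fin ℓ → Fin N =>
        p x.1.1 = p x.2.1 + (((x.2.2 : ℕ) - (x.1.2 : ℕ) : ℤ) : Fin N)).card : ℝ) *
          ∏ k, ‖a k‖ := by
    refine (norm_sum_le _ _).trans ((Finset.sum_le_sum fun p _ => h1 p).trans ?_)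
    rw [Finset.sum_comm]
    refine Finset.sum_le_sum fun x _ => ?_
    rw [← Finset.sum_filter, Finset.sum_const, nsmul_eq_mul]
  rw [norm_smul, norm_inv, norm_pow, Complex.norm_natCast]
  rw [inv_mul_le_iff₀ (by positivity)]
  refine h2.trans ?_
  rw [← Finset.sum_mul, ← mul_assoc, ← mul_assoc]
  refine mul_le_mul_of_nonneg_right ?_ (Finset.prod_nonneg fun _ _ => norm_nonneg _)
  have h3 : ∀ x ∈ overlapPairs d, ((Finset.univ.filter fun p : Fin ℓ → Fin N =>
        p x.1.1 = p x.2.1 + (((x.2.2 : ℕ) - (x.1.2 : ℕ) : ℤ) : Fin N)).card : ℝ) ≤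
      (N : ℝ) ^ ℓ * (N : ℝ)⁻¹ := fun x hx => by
    rw [← div_eq_mul_inv, le_div_iff₀' hN0]
    have hne : x.1.1 ≠ x.2.1 := by simpa [overlapPairs] using hx
    exact_mod_cast card_coincidence_le (N := N) hne _
  refine (Finset.sum_le_sum h3).trans ?_
  rw [Finset.sum_const, nsmul_eq_mul]
  exact (mul_comm _ _).le

end Overlap

/-- The sum over non-overlapping placements as a local sequence. -/
def placementLocal {ℓ : ℕ} (d : Fin ℓ → ℕ) (a : ∀ k, TensorPow κ (d k)) : LocalAlg κ :=
  ⟨_, isLocalSeq_placementSum d a⟩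

theorem localClass_placementLocal [NeZero κ] {ℓ : ℕ} (d : Fin ℓ → ℕ)
    (a : ∀ k, TensorPow κ (d k)) :
    localClass (placementLocal d a) = leadClass (∏ k, lead (gammaLocal (a k))) := by
  have h : ∏ k, lead (gammaLocal (a k)) = lead (List.ofFn fun k => gammaLocal (a k)).prod := by
    rw [map_list_prod, List.map_ofFn, List.prod_ofFn]
    rfl
  rw [h, leadClass_lead, eq_comm, localClass_eq_iff]
  convert tendsto_prod_gammaBar_sub_placementSum d a using 4 with N
  swap
  · rfl
  let ev : LocalAlg κ →* TensorPow κ N :=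
    { toFun := fun f => f.1 N, map_one' := rfl, map_mul' := fun _ _ => rfl }
  change ev (List.ofFn fun k => gammaLocal (a k)).prod = _
  rw [map_list_prod, List.map_ofFn]
  rfl

theorem IrrFamily.productClass_eq [NeZero κ] (F : IrrFamily κ) :
    F.productClass = leadClass (∏ k, lead (gammaLocal (F.factor k).2)) := by
  have h : ∏ k, lead (gammaLocal (F.factor k).2) =
      (List.ofFn fun k => lead (gammaLocal (F.factor k).2)).prod := (List.prod_ofFn ..).symm
  rw [h, map_list_prod, List.map_ofFn, productClass, map_list_prod, List.map_ofFn]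
  rfl

end SpinChain

end

noncomputable section

namespace SpinChain

open scoped Fin.CommRing

variable {κ : ℕ}

/-! ### Conditional expectations and irreducible elements -/

/-- Averaging over the site `p` with respect to the normalized trace. -/
def siteExp {n : ℕ} (p : Fin n) : TensorPow κ n →ₗ[ℂ] TensorPow κ n where
  toFun x := Matrix.of fun s t => if s p = t p then
    (κ : ℂ)⁻¹ * ∑ i : Fin κ, x (Function.update s p i) (Function.update t p i) else 0
  map_add' x y := by
    ext s t
    simp only [Matrix.of_apply, Matrix.add_apply, Finset.sum_add_distrib, mul_add]
    split_ifs <;> simp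
  map_smul' c x := by
    ext s t
    simp only [Matrix.of_apply, Matrix.smul_apply, smul_eq_mul, ← Finset.mul_sum, RingHom.id_apply]
    split_ifs
    · ring
    · simp

theorem siteExp_apply {n : ℕ} (p : Fin n) (x : TensorPow κ n) (s t : Fin n → Fin κ) :
    siteExp p x s t = if s p = t p then
      (κ : ℂ)⁻¹ * ∑ i : Fin κ, x (Function.update s p i) (Function.update t p i) else 0 := rfl

theorem siteExp_siteExp_self [NeZero κ] {n : ℕ} (p : Fin n) (x : TensorPow κ n) :
    siteExp p (siteExp p x) = siteExp p x := by
  have hκ : (κ : ℂ) ≠ 0 := Nat.cast_ne_zero.2 (NeZero.ne κ)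
  ext s t
  simp only [siteExp_apply, Function.update_self, if_true, Function.update_idem, Finset.sum_const,
    Finset.card_univ, Fintype.card_fin, nsmul_eq_mul]
  split_ifs
  · field_simp
  · rfl

theorem siteExp_comm {n : ℕ} (p q : Fin n) (x : TensorPow κ n) :
    siteExp p (siteExp q x) = siteExp q (siteExp p x) := by
  rcases eq_or_ne p q with rfl | hpq
  · rfl
  ext s t
  simp only [siteExp_apply, Function.update_of_ne hpq, Function.update_of_ne hpq.symm]
  split_ifs
  · simp only [Finset.mul_sum]
    rw [Finset.sum_comm]
    simp only [Function.update_comm hpq]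
  · simp
  · simp
  · rfl

theorem siteExp_zero_eq {n : ℕ} (x : TensorPow κ (n + 1)) :
    siteExp 0 x = emb Fin.succ (traceLeft x) := by
  classical
  ext s t
  rw [siteExp_apply, emb_apply]
  have h1 : (∀ b, b ∉ Set.range (Fin.succ : Fin n → Fin (n + 1)) → s b = t b) ↔ s 0 = t 0 := by
    constructor
    · exact fun h => h 0 (by rintro ⟨i, hi⟩; exact Fin.succ_ne_zero i hi)
    · intro h b hb
      induction b using Fin.cases with
      | zero => exact h
      | succ i => exact absurd ⟨i, rfl⟩ hb
  have h2 : ∀ (s : Fin (n + 1) → Fin κ) i, Function.update s 0 i = Fin.cons i (s ∘ Fin.succ) := by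
    intro s i
    funext b
    induction b using Fin.cases with
    | zero => simp
    | succ j => simp
  simp only [h1, h2]
  rfl

theorem siteExp_last_eq {n : ℕ} (x : TensorPow κ (n + 1)) :
    siteExp (Fin.last n) x = emb Fin.castSucc (traceRight x) := by
  classical
  ext s t
  rw [siteExp_apply, emb_apply]
  have h1 : (∀ b, b ∉ Set.range (Fin.castSucc : Fin n → Fin (n + 1)) → s b = t b) ↔
      s (Fin.last n) = t (Fin.last n) := by
    constructor
    · exact fun h => h _ (by rintro ⟨i, hi⟩; exact Fin.castSucc_ne_last i hi)
    · intro h b hb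
      induction b using Fin.lastCases with
      | last => exact h
      | cast i => exact absurd ⟨i, rfl⟩ hb
  have h2 : ∀ (s : Fin (n + 1) → Fin κ) i,
      Function.update s (Fin.last n) i = Fin.snoc (s ∘ Fin.castSucc) i := by
    intro s i
    funext b
    induction b using Fin.lastCases with
    | last => simp
    | cast j => simp
  simp only [h1, h2]
  rfl

/-- The irreducible elements of `B^(n+1)`. -/
def irrSubmodule (κ n : ℕ) : Submodule ℂ (TensorPow κ (n + 1)) :=
  LinearMap.ker (siteExp 0) ⊓ LinearMap.ker (siteExp (Fin.last n))

/-- Vector states suffice: over ℂ an operator whose quadratic form vanishes is zero. -/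
theorem eq_zero_of_forall_state {n : ℕ} (x : TensorPow κ n)
    (h : ∀ ω : TensorPow κ n →ₗ[ℂ] ℂ, IsState ω → ω x = 0) : x = 0 := by
  let T := Matrix.toEuclideanCLM (n := Fin n → Fin κ) (𝕜 := ℂ)
  suffices hT : (T x : EuclideanSpace ℂ (Fin n → Fin κ) →ₗ[ℂ]
      EuclideanSpace ℂ (Fin n → Fin κ)) = 0 by
    have : T x = 0 := by
      ext v : 1
      exact LinearMap.congr_fun hT v
    exact (map_eq_zero_iff T T.injective).1 this
  rw [← inner_map_self_eq_zero]
  intro v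
  rcases eq_or_ne v 0 with rfl | hv
  · simp
  have hv' : (‖v‖ : ℂ) ^ 2 ≠ 0 := by simpa using hv
  let ω : TensorPow κ n →ₗ[ℂ] ℂ :=
    { toFun := fun y => ((‖v‖ : ℂ) ^ 2)⁻¹ * inner ℂ v (T y v)
      map_add' := fun y z => by rw [map_add, add_apply, inner_add_right, mul_add]
      map_smul' := fun c y => by
        rw [map_smul, smul_apply, inner_smul_right, RingHom.id_apply, smul_eq_mul]
        ring }
  have hω : IsState ω := by
    constructor
    · change ((‖v‖ : ℂ) ^ 2)⁻¹ * inner ℂ v (T 1 v) = 1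
      rw [map_one, one_apply_eq_self, inner_self_eq_norm_sq_to_K]
      exact inv_mul_cancel₀ hv'
    · intro y
      change 0 ≤ ((‖v‖ : ℂ) ^ 2)⁻¹ * inner ℂ v (T (star y * y) v)
      rw [map_mul, map_star, mul_apply_eq_comp, ContinuousLinearMap.star_eq_adjoint,
        ContinuousLinearMap.adjoint_inner_right, inner_self_eq_norm_sq_to_K]
      have : (((‖v‖ : ℂ) ^ 2)⁻¹ * ((‖T y v‖ : ℂ) ^ 2)) =
          (((‖v‖ ^ 2)⁻¹ * ‖T y v‖ ^ 2 : ℝ) : ℂ) := by push_cast; rfl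
      exact this.symm ▸ Complex.zero_le_real.2 (by positivity)
  have h0 := h ω hω
  change ((‖v‖ : ℂ) ^ 2)⁻¹ * inner ℂ v (T x v) = 0 at h0
  have h1 := (mul_eq_zero.1 h0).resolve_left (inv_ne_zero hv')
  change inner ℂ (T x v) v = 0
  rw [← inner_conj_symm, h1, map_zero]

theorem emb_injective [NeZero κ] {m n : ℕ} {f : Fin m → Fin n} (hf : Function.Injective f) :
    Function.Injective (emb f : TensorPow κ m →ₗ[ℂ] TensorPow κ n) := by
  classical
  intro x y hxy
  ext s t
  have h := congrFun (congrFun hxy (Function.extend f s fun _ => 0)) (Function.extend f t fun _ => 0)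
  have hc : ∀ b, b ∉ Set.range f →
      Function.extend f s (fun _ => 0) b = Function.extend f t (fun _ => 0) b := fun b hb => by
    rw [Function.extend_apply' _ _ _ fun ⟨a, ha⟩ => hb ⟨a, ha⟩,
      Function.extend_apply' _ _ _ fun ⟨a, ha⟩ => hb ⟨a, ha⟩]
  rw [emb_apply, emb_apply, if_pos hc, if_pos hc, Function.extend_comp hf,
    Function.extend_comp hf] at h
  exact h

/-- States separate elements, so the condition on all states is the vanishing of two partial traces,
a linear condition. -/
theorem isIrr_iff_mem [NeZero κ] {n : ℕ} {a : TensorPow κ (n + 1)} :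
    IsIrr a ↔ a ∈ irrSubmodule κ n := by
  have hl : siteExp 0 a = 0 ↔ traceLeft a = 0 := by
    rw [siteExp_zero_eq, map_eq_zero_iff _ (emb_injective (Fin.succ_injective n))]
  have hr : siteExp (Fin.last n) a = 0 ↔ traceRight a = 0 := by
    rw [siteExp_last_eq, map_eq_zero_iff _ (emb_injective (Fin.castSucc_injective n))]
  rw [irrSubmodule, Submodule.mem_inf, LinearMap.mem_ker, LinearMap.mem_ker, hl, hr]
  constructor
  · exact fun h => ⟨eq_zero_of_forall_state _ fun ω hω => (h ω hω).1,
      eq_zero_of_forall_state _ fun ω hω => (h ω hω).2⟩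
  · rintro ⟨h1, h2⟩ ω -
    rw [h1, h2, map_zero]
    exact ⟨rfl, rfl⟩

/-- A unit factor at the left end of a window only translates the positions, which the average does
not see. -/
theorem gammaBar_emb_succ {N n : ℕ} [NeZero N] (h : n + 1 ≤ N) (x : TensorPow κ n) :
    gammaBar (emb Fin.succ x : TensorPow κ (n + 1)) N = gammaBar x N := by
  rw [gammaBar_eq h, gammaBar_eq (by omega)]
  congr 1
  rw [← Equiv.sum_comp (Equiv.addRight (1 : Fin N)) fun p => place N p x]
  refine Finset.sum_congr rfl fun p _ => place_emb h _ _ _ (fun i => ?_) x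
  simp only [Fin.val_succ, Equiv.coe_addRight]
  push_cast
  ring

theorem gammaBar_emb_castSucc {N n : ℕ} [NeZero N] (h : n + 1 ≤ N) (x : TensorPow κ n) :
    gammaBar (emb Fin.castSucc x : TensorPow κ (n + 1)) N = gammaBar x N := by
  rw [gammaBar_eq h, gammaBar_eq (by omega)]
  congr 1
  exact Finset.sum_congr rfl fun p _ => place_emb h _ _ _ (fun i => by rw [Fin.val_castSucc]) x

theorem gammaBar_add {N M : ℕ} (a b : TensorPow κ M) :
    gammaBar (a + b) N = gammaBar a N + gammaBar b N := by
  unfold gammaBar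
  split_ifs <;> simp

theorem gammaBar_smul {N M : ℕ} (c : ℂ) (a : TensorPow κ M) :
    gammaBar (c • a) N = c • gammaBar a N := by
  unfold gammaBar
  split_ifs <;> simp

/-- Every `γ`-average is a sum of `γ`-averages of irreducible elements. -/
theorem exists_sum_irr [NeZero κ] {M : ℕ} (a : TensorPow κ M) :
    ∃ (c : ℂ) (b : ∀ m, TensorPow κ (m + 1)), (∀ m, b m ∈ irrSubmodule κ m) ∧
      ∀ N : ℕ, 0 < N → M ≤ N →
        gammaBar a N = c • (1 : TensorPow κ N) + ∑ m ∈ Finset.range M, gammaBar (b m) N := by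
  induction M with
  | zero =>
    refine ⟨a finZeroElim finZeroElim, 0, fun _ => zero_mem _, fun N hN _ => ?_⟩
    have hca : a = a finZeroElim finZeroElim • 1 := by
      ext s t
      rw [Subsingleton.elim s finZeroElim, Subsingleton.elim t finZeroElim]
      simp
    have : NeZero N := ⟨hN.ne'⟩
    have h1 : gammaBar (1 : TensorPow κ 0) N = 1 := by
      rw [gammaBar_eq (Nat.zero_le N)]
      simp only [place_one, Finset.sum_const, Finset.card_univ, Fintype.card_fin]
      rw [← Nat.cast_smul_eq_nsmul ℂ, smul_smul,
        inv_mul_cancel₀ (Nat.cast_ne_zero.2 hN.ne'), one_smul]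
    rw [Finset.sum_range_zero, add_zero]
    conv_lhs => rw [hca]
    rw [gammaBar_smul, h1]
  | succ n ih =>
    -- Remove the part with a unit at the first site, then the part with a unit at the last site.
    -- The two expectations commute, so the rest `e` is irreducible, while the removed parts have
    -- the γ-averages of elements of degree `n` and fall under the induction hypothesis.
    let r := a - siteExp 0 a
    let e := r - siteExp (Fin.last n) r
    obtain ⟨c, b, hb, hab⟩ := ih (traceLeft a + traceRight r)
    have he : e ∈ irrSubmodule κ n := by
      have hr : siteExp 0 r = 0 := by
        simp only [r, map_sub, siteExp_siteExp_self, sub_self]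
      rw [irrSubmodule, Submodule.mem_inf, LinearMap.mem_ker, LinearMap.mem_ker]
      constructor
      · simp only [e, map_sub, siteExp_comm 0, hr, map_zero, sub_zero]
      · simp only [e, map_sub, siteExp_siteExp_self, sub_self]
    refine ⟨c, Function.update b n e, fun m => ?_, fun N hN hM => ?_⟩
    · rcases eq_or_ne m n with rfl | hm
      · rwa [Function.update_self]
      · rw [Function.update_of_ne hm]
        exact hb m
    · have : NeZero N := ⟨hN.ne'⟩
      have ha : a = e + (siteExp 0 a + siteExp (Fin.last n) r) := by
        simp only [e, r]
        abel
      conv_lhs => rw [ha]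
      rw [Finset.sum_range_succ, Function.update_self, gammaBar_add, gammaBar_add,
        siteExp_zero_eq, siteExp_last_eq, gammaBar_emb_succ hM, gammaBar_emb_castSucc hM,
        ← gammaBar_add, hab N hN (by omega), add_comm, add_assoc]
      congr 2
      refine Finset.sum_congr rfl fun m hm => ?_
      rw [Function.update_of_ne (Finset.mem_range.1 hm).ne]

variable (κ) in
/-- Indices for bases of the spaces of irreducible elements of positive degree. -/
structure IrrIndex : Type where
  order : ℕ
  index : Fin (Module.finrank ℂ (irrSubmodule κ order))

/-- The degree of a basis element. -/
abbrev IrrIndex.degree (b : IrrIndex κ) : ℕ := b.order + 1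

/-- The basis elements of the spaces of irreducible elements. -/
def IrrIndex.elt (b : IrrIndex κ) : TensorPow κ b.degree :=
  (irrSubmodule κ b.order).subtype (Module.finBasis ℂ (irrSubmodule κ b.order) b.index)

theorem IrrIndex.elt_mem (b : IrrIndex κ) : b.elt ∈ irrSubmodule κ b.order :=
  (Module.finBasis ℂ (irrSubmodule κ b.order) b.index).2

theorem exists_eq_sum_elt {n : ℕ} {a : TensorPow κ (n + 1)} (ha : a ∈ irrSubmodule κ n) :
    ∃ c : Fin (Module.finrank ℂ (irrSubmodule κ n)) → ℂ,
      a = ∑ i, c i • (⟨n, i⟩ : IrrIndex κ).elt := by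
  refine ⟨fun i => (Module.finBasis ℂ (irrSubmodule κ n)).repr ⟨a, ha⟩ i, ?_⟩
  have h := congrArg (Submodule.subtype _) ((Module.finBasis ℂ (irrSubmodule κ n)).sum_repr ⟨a, ha⟩)
  rw [map_sum] at h
  exact h.symm

end SpinChain

end

noncomputable section

namespace SpinChain

open scoped Fin.CommRing

variable {κ : ℕ}

/-! ### Polynomials in irreducible elements -/

/-- The `γ`-sequence of `a`, linearly in `a`. -/
def gammaLinear (M : ℕ) : TensorPow κ M →ₗ[ℂ] LocalAlg κ where
  toFun := gammaLocal
  map_add' a b := Subtype.ext (funext fun _ => gammaBar_add a b)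
  map_smul' c a := Subtype.ext (funext fun _ => gammaBar_smul c a)

variable (κ) in
/-- Polynomials in the basis elements of the spaces of irreducible elements. -/
abbrev IrrPoly : Type := MvPolynomial (IrrIndex κ) ℂ

/-- The leading part of the local sequence described by a polynomial. -/
def leadPoly : IrrPoly κ →ₐ[ℂ] LeadAlg κ :=
  MvPolynomial.aeval fun b => lead (gammaLocal b.elt)

theorem leadPoly_X (b : IrrIndex κ) : leadPoly (MvPolynomial.X b) = lead (gammaLocal b.elt) :=
  MvPolynomial.aeval_X _ b

theorem lead_gammaLocal_mem_range [NeZero κ] {n : ℕ} {a : TensorPow κ (n + 1)}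
    (ha : a ∈ irrSubmodule κ n) :
    lead (gammaLocal a) ∈ (leadPoly (κ := κ)).range := by
  obtain ⟨c, hc⟩ := exists_eq_sum_elt ha
  have h : lead (gammaLocal a) =
      ∑ i, c i • lead (gammaLocal (⟨n, i⟩ : IrrIndex κ).elt) := by
    change lead (gammaLinear _ a) = _
    rw [hc, map_sum, map_sum]
    simp only [map_smul]
    rfl
  rw [h]
  exact sum_mem fun i _ => Subalgebra.smul_mem _
    ((AlgHom.mem_range _).2 ⟨MvPolynomial.X _, leadPoly_X _⟩) _

theorem leadPoly_surjective [NeZero κ] : Function.Surjective (leadPoly (κ := κ)) := by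
  rw [← AlgHom.range_eq_top, eq_top_iff, ← adjoin_lead_gammaLocal]
  refine Algebra.adjoin_le ?_
  rintro _ ⟨M, a, rfl⟩
  obtain ⟨c, b, hb, hab⟩ := exists_sum_irr a
  have h : lead (gammaLocal a) =
      algebraMap ℂ (LeadAlg κ) c + ∑ m ∈ Finset.range M, lead (gammaLocal (b m)) := by
    rw [← AlgHom.commutes lead, ← map_sum, ← map_add]
    refine lead_eq_of_eventually ?_
    filter_upwards [eventually_le_pnat M] with N hN
    let ev : LocalAlg κ →+ TensorPow κ N := ⟨⟨fun f => f.1 N, rfl⟩, fun _ _ => rfl⟩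
    change ev (gammaLocal a) =
      ev (algebraMap ℂ (LocalAlg κ) c + ∑ m ∈ Finset.range M, gammaLocal (b m))
    rw [map_add, map_sum, Algebra.algebraMap_eq_smul_one]
    exact hab N N.pos hN
  rw [h]
  exact add_mem (algebraMap_mem _ c) (sum_mem fun m _ => lead_gammaLocal_mem_range (hb m))

theorem exists_sum_single {ι : Type*} (m : ι →₀ ℕ) :
    ∃ (ℓ : ℕ) (g : Fin ℓ → ι), ∑ k, Finsupp.single (g k) 1 = m := by
  induction m using Finsupp.induction_linear with
  | zero => exact ⟨0, Fin.elim0, by simp⟩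
  | add m m' h h' =>
    obtain ⟨ℓ, g, hg⟩ := h
    obtain ⟨ℓ', g', hg'⟩ := h'
    exact ⟨ℓ + ℓ', Fin.append g g', by simp [Fin.sum_univ_add, hg, hg']⟩
  | single b n => exact ⟨n, fun _ => b, by simp⟩

theorem exists_perm_of_sum_single_eq {ι : Type*} {ℓ : ℕ} {g g' : Fin ℓ → ι}
    (h : ∑ k, Finsupp.single (g k) 1 = ∑ k, Finsupp.single (g' k) 1) :
    ∃ σ : Equiv.Perm (Fin ℓ), ∀ k, g' (σ k) = g k := by
  classical
  have hcard : ∀ b, Fintype.card {k // g k = b} = Fintype.card {k // g' k = b} := fun b => by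
    have := DFunLike.congr_fun h b
    simpa [Finsupp.finsetSum_apply, Finsupp.single_apply, Fintype.card_subtype] using this
  exact ⟨Equiv.ofFiberEquiv fun b => Fintype.equivOfCardEq (hcard b),
    fun k => Equiv.ofFiberEquiv_map _ k⟩

theorem card_eq_of_sum_single_eq {ι : Type*} {ℓ ℓ' : ℕ} {g : Fin ℓ → ι} {g' : Fin ℓ' → ι}
    (h : ∑ k, Finsupp.single (g k) 1 = ∑ k, Finsupp.single (g' k) 1) : ℓ = ℓ' := by
  simpa using congrArg Finsupp.degree h

/-- The multiplication-free part of the sum over placements for the factors `g 0, g 1, …`. -/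
def eltSum (N : ℕ) [NeZero N] {ℓ : ℕ} (g : Fin ℓ → IrrIndex κ) : TensorPow κ N :=
  placementSum N (fun k => (g k).degree) fun k => (g k).elt

/-- Two listings of the same monomial differ by a permutation of the factors, so the choice of a
listing in `canonical` is harmless. -/
theorem eltSum_eq_of_sum_single_eq {N : ℕ} [NeZero N] {ℓ ℓ' : ℕ} {g : Fin ℓ → IrrIndex κ}
    {g' : Fin ℓ' → IrrIndex κ}
    (h : ∑ k, Finsupp.single (g k) 1 = ∑ k, Finsupp.single (g' k) 1) :
    eltSum N g = eltSum N g' := by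
  obtain rfl := card_eq_of_sum_single_eq h
  obtain ⟨σ, hσ⟩ := exists_perm_of_sum_single_eq h
  obtain rfl : g = fun k => g' (σ k) := funext fun k => (hσ k).symm
  exact placementSum_comp_perm (fun k => (g' k).degree) (fun k => (g' k).elt) σ

/-- The `N`-th entry of the canonical sequence described by a polynomial. -/
def canonical (N : ℕ) [NeZero N] : IrrPoly κ →ₗ[ℂ] TensorPow κ N :=
  (MvPolynomial.basisMonomials (IrrIndex κ) ℂ).constr ℂ fun m =>
    eltSum N (exists_sum_single m).choose_spec.choose

theorem canonical_prod_X {N : ℕ} [NeZero N] {ℓ : ℕ} (g : Fin ℓ → IrrIndex κ) :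
    canonical N (∏ k, MvPolynomial.X (g k)) = eltSum N g := by
  have h : (∏ k, MvPolynomial.X (g k) : IrrPoly κ) =
      MvPolynomial.basisMonomials (IrrIndex κ) ℂ (∑ k, Finsupp.single (g k) 1) := by
    rw [MvPolynomial.coe_basisMonomials]
    exact (MvPolynomial.monomial_sum_one _ _).symm
  rw [h, canonical, Module.Basis.constr_basis]
  exact eltSum_eq_of_sum_single_eq (exists_sum_single _).choose_spec.choose_spec

theorem monomial_one_eq_prod_X (m : IrrIndex κ →₀ ℕ) :
    ∃ (ℓ : ℕ) (g : Fin ℓ → IrrIndex κ),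
      (MvPolynomial.monomial m 1 : IrrPoly κ) = ∏ k, MvPolynomial.X (g k) := by
  obtain ⟨ℓ, g, rfl⟩ := exists_sum_single m
  exact ⟨ℓ, g, MvPolynomial.monomial_sum_one _ _⟩

theorem canonical_one {N : ℕ} [NeZero N] : canonical N (1 : IrrPoly κ) = 1 := by
  classical
  have h := canonical_prod_X (N := N) (κ := κ) (g := (Fin.elim0 : Fin 0 → IrrIndex κ))
  rw [Finset.univ_eq_empty, Finset.prod_empty] at h
  rw [h, eltSum, placementSum_apply]
  have : ∀ p : Fin 0 → Fin N, NonOverlap (fun k : Fin 0 =>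
      (Fin.elim0 k : IrrIndex κ).degree) p := fun p x => x.1.elim0
  simp [this]

set_option linter.unusedSectionVars false

section Linear

variable [NeZero κ]

/-- Expand every factor in the basis. The product in `LeadAlg` and the placement sum are both
multilinear in the factors, so the product of the resulting linear forms serves for both. -/
theorem exists_irrPoly_of_pos {ℓ : ℕ} (n : Fin ℓ → ℕ) (a : ∀ k, TensorPow κ (n k + 1))
    (ha : ∀ k, a k ∈ irrSubmodule κ (n k)) :
    ∃ P : IrrPoly κ, leadPoly P = ∏ k, lead (gammaLocal (a k)) ∧
      ∀ N : ℕ+, canonical N P = placementSum N (fun k => n k + 1) a := by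
  classical
  choose c hc using fun k => exists_eq_sum_elt (ha k)
  refine ⟨∏ k, ∑ i, c k i • MvPolynomial.X ⟨n k, i⟩, ?_, fun N => ?_⟩
  · rw [map_prod]
    refine Finset.prod_congr rfl fun k _ => ?_
    rw [map_sum]
    change _ = lead (gammaLinear _ (a k))
    conv_rhs => rw [hc k]
    rw [map_sum, map_sum]
    simp only [map_smul, leadPoly_X]
    rfl
  · have h1 : placementSum N (fun k => n k + 1) a =
        ∑ r : ∀ k, Fin (Module.finrank ℂ (irrSubmodule κ (n k))),
          (∏ k, c k (r k)) • eltSum N fun k => (⟨n k, r k⟩ : IrrIndex κ) := by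
      conv_lhs => rw [show a = fun k => ∑ i, c k i • (⟨n k, i⟩ : IrrIndex κ).elt from funext hc]
      rw [MultilinearMap.map_sum]
      exact Finset.sum_congr rfl fun r _ => MultilinearMap.map_smul_univ _ _ _
    rw [h1, Finset.prod_univ_sum, map_sum, Fintype.piFinset_univ]
    refine Finset.sum_congr rfl fun r _ => ?_
    rw [← canonical_prod_X, ← map_smul]
    congr 1
    simp only [Algebra.smul_def, Finset.prod_mul_distrib, map_prod]

/-- Scalars enter a family as a single factor of degree `0`. An empty window never overlaps, so its
placement sum is the scalar itself; the hypotheses only fill the fields of `IrrFamily`. -/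
theorem leadPoly_scalar (c : ℂ) (hℓ : 0 < 1)
    (hirr : ∀ k : Fin 1, IsIrr ((fun _ => ⟨0, c • 1⟩ : Fin 1 → Σ M, TensorPow κ M) k).2)
    (hd : 1 < 1 → ∀ k : Fin 1, 0 < ((fun _ => ⟨0, c • 1⟩ : Fin 1 → Σ M, TensorPow κ M) k).1) :
    leadClass (leadPoly (c • 1 : IrrPoly κ)) =
        IrrFamily.productClass ⟨1, hℓ, fun _ => ⟨0, c • 1⟩, hirr, hd⟩ ∧
      ∀ N : ℕ+, canonical N (c • 1 : IrrPoly κ) =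
        IrrFamily.canonicalSeq ⟨1, hℓ, fun _ => ⟨0, c • 1⟩, hirr, hd⟩ N := by
  classical
  refine ⟨?_, fun N => ?_⟩
  · rw [IrrFamily.productClass_eq]
    congr 1
    change _ = ∏ k : Fin 1, lead (gammaLinear 0 (c • 1))
    rw [Fin.prod_univ_one, map_smul, map_smul, map_smul, map_one, ← map_one lead]
    congr 1
    refine lead_eq_of_eventually (.of_forall fun N => ?_)
    change (1 : TensorPow κ N) = gammaBar (1 : TensorPow κ 0) N
    rw [gammaBar, dif_pos (Nat.zero_le _), map_one, avg_of_shift_eq N.ne_zero (map_one _)]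
  · rw [IrrFamily.canonicalSeq_eq, map_smul, canonical_one]
    change c • 1 = placementSum N (fun _ : Fin 1 => 0) fun _ => c • 1
    rw [placementSum_apply]
    have hno : ∀ p : Fin 1 → Fin N, NonOverlap (fun _ : Fin 1 => 0) p := fun p x => x.2.elim0
    simp only [hno, if_true, map_smul, place_one, List.ofFn_succ, List.ofFn_zero,
      List.prod_cons, List.prod_nil, mul_one, Finset.sum_const, Finset.card_univ,
      Fintype.card_pi, Fintype.card_fin, Finset.prod_const, pow_one]
    rw [← Nat.cast_smul_eq_nsmul ℂ, smul_smul,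
      inv_mul_cancel₀ (Nat.cast_ne_zero.2 N.ne_zero), one_smul]

theorem IrrFamily.exists_irrPoly (F : IrrFamily κ) :
    ∃ P : IrrPoly κ, leadClass (leadPoly P) = F.productClass ∧
      ∀ N : ℕ+, canonical N P = F.canonicalSeq N := by
  classical
  by_cases hpos : ∀ k, 0 < (F.factor k).1
  · obtain ⟨ℓ, hℓ, a, hirr, hd⟩ := F
    have h : ∀ k, ∃ (n : ℕ) (x : TensorPow κ (n + 1)), a k = ⟨n + 1, x⟩ := fun k => by
      have hk : 0 < (a k).1 := hpos k
      generalize a k = y at hk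
      obtain ⟨m, y⟩ := y
      obtain _ | m := m
      · exact absurd hk (lt_irrefl 0)
      · exact ⟨m, y, rfl⟩
    choose n x hx using h
    obtain rfl : a = fun k => ⟨n k + 1, x k⟩ := funext hx
    obtain ⟨P, hP1, hP2⟩ := exists_irrPoly_of_pos n x fun k => isIrr_iff_mem.1 (hirr k)
    refine ⟨P, ?_, fun N => ?_⟩
    · rw [hP1, IrrFamily.productClass_eq]
    · rw [hP2, IrrFamily.canonicalSeq_eq]
  · have hlen : F.len = 1 := by
      by_contra h
      exact hpos (F.degree_pos (by have := F.len_pos; omega))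
    obtain ⟨ℓ, hℓ, a, hirr, hd⟩ := F
    obtain rfl : ℓ = 1 := hlen
    have ha : ∃ x : TensorPow κ 0, a = fun _ => ⟨0, x⟩ := by
      push Not at hpos
      obtain ⟨k, hk⟩ := hpos
      obtain rfl : k = 0 := Subsingleton.elim _ _
      change (a 0).1 ≤ 0 at hk
      generalize hy : a 0 = y at hk
      obtain ⟨m, y⟩ := y
      obtain rfl : m = 0 := Nat.le_zero.1 hk
      exact ⟨y, funext fun k => by rw [Subsingleton.elim k 0, hy]⟩
    obtain ⟨x, rfl⟩ := ha
    obtain ⟨c, rfl⟩ : ∃ c : ℂ, x = c • 1 := ⟨x finZeroElim finZeroElim, by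
      ext s t
      rw [Subsingleton.elim s finZeroElim, Subsingleton.elim t finZeroElim]
      simp⟩
    exact ⟨c • 1, leadPoly_scalar c hℓ hirr hd⟩

theorem exists_irrFamily {ℓ : ℕ} (g : Fin ℓ → IrrIndex κ) :
    ∃ F : IrrFamily κ, leadClass (leadPoly (∏ k, MvPolynomial.X (g k))) = F.productClass ∧
      ∀ N : ℕ+, canonical N (∏ k, MvPolynomial.X (g k)) = F.canonicalSeq N := by
  -- The constant monomial has no factors, but families are nonempty; the scalar `1` represents it.
  obtain _ | ℓ := ℓ
  · refine ⟨⟨1, one_pos, fun _ => ⟨0, (1 : ℂ) • 1⟩, fun _ => trivial,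
      fun h => absurd h (lt_irrefl 1)⟩, ?_⟩
    rw [Finset.univ_eq_empty, Finset.prod_empty, ← one_smul ℂ (1 : IrrPoly κ)]
    exact leadPoly_scalar 1 _ _ _
  · let F : IrrFamily κ := ⟨ℓ + 1, Nat.succ_pos ℓ, fun k => ⟨(g k).degree, (g k).elt⟩,
      fun k => isIrr_iff_mem.2 (g k).elt_mem, fun _ k => Nat.succ_pos _⟩
    refine ⟨F, ?_, fun N => ?_⟩
    · rw [IrrFamily.productClass_eq, map_prod]
      simp only [leadPoly_X]
      rfl
    · rw [IrrFamily.canonicalSeq_eq, canonical_prod_X]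
      rfl

theorem IsCanonicalRep.add {a b : ∀ N : ℕ+, TensorPow κ N} {x y : ClassAlg κ}
    (ha : IsCanonicalRep a x) (hb : IsCanonicalRep b y) : IsCanonicalRep (a + b) (x + y) := by
  obtain ⟨n, c, F, hx, ha⟩ := ha
  obtain ⟨n', c', F', hy, hb⟩ := hb
  refine ⟨n + n', Fin.append c c', Fin.append F F', ?_, fun N => ?_⟩
  · simp [Fin.sum_univ_add, hx, hy]
  · simp [Fin.sum_univ_add, ha, hb]

/-- Translates existence and uniqueness of canonical representatives into bijectivity of the map
from polynomials to classes. -/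
theorem isCanonicalRep_iff {a : ∀ N : ℕ+, TensorPow κ N} {x : ClassAlg κ} :
    IsCanonicalRep a x ↔
      ∃ P : IrrPoly κ, leadClass (leadPoly P) = x ∧ ∀ N : ℕ+, canonical N P = a N := by
  constructor
  · rintro ⟨n, c, F, rfl, ha⟩
    choose P hP1 hP2 using fun i => (F i).exists_irrPoly
    refine ⟨∑ i, c i • P i, ?_, fun N => ?_⟩
    · simp [map_sum, map_smul, hP1]
    · simp [map_sum, map_smul, hP2, ha]
  · rintro ⟨P, rfl, ha⟩
    obtain rfl : a = fun N : ℕ+ => canonical N P := funext fun N => (ha N).symm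
    clear ha
    induction P using MvPolynomial.induction_on' with
    | monomial m c =>
      obtain ⟨ℓ, g, hg⟩ := monomial_one_eq_prod_X m
      have h : MvPolynomial.monomial m c = c • ∏ k, (MvPolynomial.X (g k) : IrrPoly κ) := by
        rw [← hg, MvPolynomial.smul_monomial, smul_eq_mul, mul_one]
      obtain ⟨F, hF1, hF2⟩ := exists_irrFamily g
      refine ⟨1, fun _ => c, fun _ => F, ?_, fun N => ?_⟩
      · rw [Fin.sum_univ_one, h, map_smul, map_smul, hF1]
      · rw [Fin.sum_univ_one, h]
        exact (map_smul _ _ _).trans (congrArg (c • ·) (hF2 N))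
    | add P P' h h' =>
      rw [map_add, map_add]
      have : (fun N : ℕ+ => canonical N (P + P')) =
          (fun N : ℕ+ => canonical N P) + fun N : ℕ+ => canonical N P' :=
        funext fun N => map_add _ _ _
      rw [this]
      exact h.add h'

theorem isLocalSeq_canonical (P : IrrPoly κ) : IsLocalSeq fun N : ℕ+ => canonical N P := by
  induction P using MvPolynomial.induction_on' with
  | monomial m c =>
    obtain ⟨ℓ, g, hg⟩ := monomial_one_eq_prod_X m
    have h : MvPolynomial.monomial m c = c • ∏ k, (MvPolynomial.X (g k) : IrrPoly κ) := by
      rw [← hg, MvPolynomial.smul_monomial, smul_eq_mul, mul_one]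
    refine ((isLocalSeq_placementSum (fun k => (g k).degree) fun k => (g k).elt).smul c).congr
      (.of_forall fun N => ?_)
    rw [h, map_smul, canonical_prod_X]
    rfl
  | add P P' h h' => exact (h.add h').congr (.of_forall fun N => (map_add _ _ _).symm)

/-- The local sequence described by a polynomial. -/
def canonicalLocal : IrrPoly κ →ₗ[ℂ] LocalAlg κ where
  toFun P := ⟨_, isLocalSeq_canonical P⟩
  map_add' P P' := Subtype.ext (funext fun _ => map_add _ P P')
  map_smul' c P := Subtype.ext (funext fun _ => map_smul _ c P)

/-- On monomials the placement sum and the product of γ-sequences differ by a null sequence;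
linearity does the rest. -/
theorem localClass_canonicalLocal (P : IrrPoly κ) :
    localClass (canonicalLocal P) = leadClass (leadPoly P) := by
  induction P using MvPolynomial.induction_on' with
  | monomial m c =>
    obtain ⟨ℓ, g, hg⟩ := monomial_one_eq_prod_X m
    have h : MvPolynomial.monomial m c = c • ∏ k, (MvPolynomial.X (g k) : IrrPoly κ) := by
      rw [← hg, MvPolynomial.smul_monomial, smul_eq_mul, mul_one]
    rw [h, map_smul, map_smul, map_smul, map_smul, map_prod leadPoly]
    simp only [leadPoly_X]
    rw [← localClass_placementLocal]
    congr 2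
    exact Subtype.ext (funext fun N => canonical_prod_X g)
  | add P P' h h' => rw [map_add, map_add, map_add, map_add, h, h']

end Linear

end SpinChain

end

noncomputable section

namespace SpinChain

open scoped Fin.CommRing

variable {κ : ℕ}

/-! ### Supports and the normalized trace -/

section Support

variable {α β γ : Type} [Fintype α] [Fintype β] [Fintype γ] [DecidableEq α] [DecidableEq β]
  [DecidableEq γ]

set_option linter.unusedSectionVars false

variable (κ) in
/-- The operators supported on the set of sites `S`. -/
def supp (S : Finset α) : Subalgebra ℂ (SiteMat κ α) :=
  (embHom (κ := κ) (f := (Subtype.val : S → α)) Subtype.val_injective).toAlgHom.range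

theorem mem_supp_iff {S : Finset α} {x : SiteMat κ α} :
    x ∈ supp κ S ↔ ∃ y : SiteMat κ S, emb Subtype.val y = x := AlgHom.mem_range _

theorem emb_mem_supp {S : Finset α} {f : β → α} (h : ∀ b, f b ∈ S) (x : SiteMat κ β) :
    emb f x ∈ supp κ S :=
  mem_supp_iff.2 ⟨emb (fun b => (⟨f b, h b⟩ : S)) x, emb_emb Subtype.val_injective _ x⟩

theorem supp_mono {S T : Finset α} (h : S ⊆ T) : supp κ S ≤ supp κ T := by
  intro x hx
  obtain ⟨y, rfl⟩ := mem_supp_iff.1 hx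
  exact emb_mem_supp (fun b => h b.2) y

theorem commute_of_mem_supp {S T : Finset α} (h : Disjoint S T) {x y : SiteMat κ α}
    (hx : x ∈ supp κ S) (hy : y ∈ supp κ T) : Commute x y := by
  obtain ⟨x, rfl⟩ := mem_supp_iff.1 hx
  obtain ⟨y, rfl⟩ := mem_supp_iff.1 hy
  exact emb_commute Subtype.val_injective Subtype.val_injective
    (fun a b hab => Finset.disjoint_left.1 h a.2 (hab ▸ b.2)) x y

/-- The normalized trace. -/
def ntr : SiteMat κ α →ₗ[ℂ] ℂ := ((κ : ℂ) ^ Fintype.card α)⁻¹ • Matrix.traceLinearMap _ ℂ ℂ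

theorem ntr_apply (x : SiteMat κ α) : ntr x = ((κ : ℂ) ^ Fintype.card α)⁻¹ * x.trace := rfl

theorem ntr_mul_comm (x y : SiteMat κ α) : ntr (x * y) = ntr (y * x) := by
  rw [ntr_apply, ntr_apply, Matrix.trace_mul_comm]

theorem ntr_one [NeZero κ] : ntr (1 : SiteMat κ α) = 1 := by
  have hκ : (κ : ℂ) ≠ 0 := Nat.cast_ne_zero.2 (NeZero.ne κ)
  rw [ntr_apply, Matrix.trace_one, Fintype.card_fun, Fintype.card_fin]
  push_cast
  exact inv_mul_cancel₀ (pow_ne_zero _ hκ)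

theorem ntr_star (x : SiteMat κ α) : ntr (star x) = star (ntr x) := by
  rw [ntr_apply, ntr_apply, Matrix.star_eq_conjTranspose, Matrix.trace_conjTranspose]
  simp

theorem ntr_emb_equiv (e : α ≃ β) (x : SiteMat κ α) : ntr (emb e x) = ntr x := by
  rw [ntr_apply, ntr_apply, Fintype.card_congr e]
  congr 1
  rw [Matrix.trace, Matrix.trace, ← Equiv.sum_comp (Equiv.arrowCongr e (Equiv.refl (Fin κ)))]
  refine Finset.sum_congr rfl fun s _ => ?_
  rw [Matrix.diag_apply, Matrix.diag_apply, emb_apply_of_surjective e.surjective]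
  congr 1 <;> ext <;> simp

theorem ntr_emb_inl_mul_emb_inr (x : SiteMat κ α) (y : SiteMat κ β) :
    ntr (emb Sum.inl x * emb Sum.inr y : SiteMat κ (α ⊕ β)) = ntr x * ntr y := by
  simp only [ntr_apply, Matrix.trace, Matrix.diag_apply, emb_inl_mul_emb_inr_apply,
    Fintype.card_sum, pow_add, mul_inv]
  have h : ∑ s : α ⊕ β → Fin κ, x (s ∘ Sum.inl) (s ∘ Sum.inl) * y (s ∘ Sum.inr) (s ∘ Sum.inr) =
      (∑ s, x s s) * ∑ s, y s s := by
    rw [Fintype.sum_mul_sum, ← Fintype.sum_prod_type', ← Equiv.sum_comp (Equiv.sumArrowEquivProdArrow α β (Fin κ)).symm]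
    rfl
  rw [h]
  ring

/-- A set of sites and its complement make up all sites. -/
def sumCompl (S : Finset α) : S ⊕ (Sᶜ : Finset α) ≃ α :=
  Equiv.ofBijective (Sum.elim Subtype.val Subtype.val) ⟨Subtype.val_injective.sumElim
    Subtype.val_injective fun a b hab => Finset.mem_compl.1 b.2 (hab ▸ a.2), fun a => by
      by_cases ha : a ∈ S
      · exact ⟨Sum.inl ⟨a, ha⟩, rfl⟩
      · exact ⟨Sum.inr ⟨a, Finset.mem_compl.2 ha⟩, rfl⟩⟩

theorem ntr_emb_mul_emb_compl {S : Finset α} (x : SiteMat κ S) (y : SiteMat κ (Sᶜ : Finset α)) :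
    ntr (emb Subtype.val x * emb Subtype.val y : SiteMat κ α) = ntr x * ntr y := by
  have h1 : (emb Subtype.val x : SiteMat κ α) = emb (sumCompl S) (emb Sum.inl x) := by
    rw [emb_emb (sumCompl S).injective]
    rfl
  have h2 : (emb Subtype.val y : SiteMat κ α) = emb (sumCompl S) (emb Sum.inr y) := by
    rw [emb_emb (sumCompl S).injective]
    rfl
  rw [h1, h2, ← emb_mul (sumCompl S).injective, ntr_emb_equiv, ntr_emb_inl_mul_emb_inr]

theorem ntr_emb_val [NeZero κ] {S : Finset α} (x : SiteMat κ S) :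
    ntr (emb Subtype.val x : SiteMat κ α) = ntr x := by
  simpa [ntr_one, emb_one] using ntr_emb_mul_emb_compl x 1

theorem ntr_mul_of_mem_supp [NeZero κ] {S T : Finset α} (h : Disjoint S T) {x y : SiteMat κ α}
    (hx : x ∈ supp κ S) (hy : y ∈ supp κ T) : ntr (x * y) = ntr x * ntr y := by
  have hT : T ⊆ Sᶜ := fun a ha => Finset.mem_compl.2 fun ha' => Finset.disjoint_left.1 h ha' ha
  obtain ⟨x, rfl⟩ := mem_supp_iff.1 hx
  obtain ⟨y, rfl⟩ := mem_supp_iff.1 (supp_mono hT hy)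
  rw [ntr_emb_mul_emb_compl, ntr_emb_val, ntr_emb_val]

theorem ntr_emb [NeZero κ] {f : α → β} (hf : Function.Injective f) (x : SiteMat κ α) :
    ntr (emb f x) = ntr x := by
  let S : Finset β := Finset.univ.image f
  let e : α ≃ S := Equiv.ofBijective (fun a => ⟨f a, Finset.mem_image_of_mem f (Finset.mem_univ a)⟩)
    ⟨fun a b h => hf (congrArg Subtype.val h), fun ⟨b, hb⟩ => by
      obtain ⟨a, -, rfl⟩ := Finset.mem_image.1 hb
      exact ⟨a, rfl⟩⟩
  have h1 : (emb f x : SiteMat κ β) = emb Subtype.val (emb e x) := by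
    rw [emb_emb Subtype.val_injective]
    rfl
  rw [h1, ntr_emb_val, ntr_emb_equiv]

end Support

section SiteExp

variable {n : ℕ}

theorem siteExp_emb {m : ℕ} {f : Fin m → Fin n} (hf : Function.Injective f) (q : Fin m)
    (x : TensorPow κ m) : siteExp (f q) (emb f x) = emb f (siteExp q x) := by
  classical
  ext s t
  have hup : ∀ (s : Fin n → Fin κ) i, Function.update s (f q) i ∘ f = Function.update (s ∘ f) q i :=
    fun s i => Function.update_comp_eq_of_injective _ hf _ _
  have hne : ∀ b, b ∉ Set.range f → b ≠ f q := fun b hb h => hb ⟨q, h.symm⟩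
  have hc : ∀ i, (∀ b, b ∉ Set.range f →
      Function.update s (f q) i b = Function.update t (f q) i b) ↔
      ∀ b, b ∉ Set.range f → s b = t b := fun i =>
    forall₂_congr fun b hb => by
      rw [Function.update_of_ne (hne b hb), Function.update_of_ne (hne b hb)]
  simp only [siteExp_apply, emb_apply, hup, hc, Function.comp_apply]
  by_cases h1 : s (f q) = t (f q) <;> simp [h1]

theorem apply_eq_zero_of_mem_supp {S : Finset (Fin n)} {p : Fin n} (hp : p ∉ S)
    {y : TensorPow κ n} (hy : y ∈ supp κ S) {s t : Fin n → Fin κ} (h : s p ≠ t p) : y s t = 0 := by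
  classical
  obtain ⟨y, rfl⟩ := mem_supp_iff.1 hy
  rw [emb_apply, if_neg]
  exact fun hc => h (hc p (by rintro ⟨b, rfl⟩; exact hp b.2))

theorem apply_update_of_mem_supp {S : Finset (Fin n)} {p : Fin n} (hp : p ∉ S)
    {y : TensorPow κ n} (hy : y ∈ supp κ S) {s t : Fin n → Fin κ} (h : s p = t p) (i : Fin κ) :
    y (Function.update s p i) (Function.update t p i) = y s t := by
  classical
  obtain ⟨y, rfl⟩ := mem_supp_iff.1 hy
  have hne : ∀ b : S, (b : Fin n) ≠ p := fun b hb => hp (hb ▸ b.2)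
  have hup : ∀ s : Fin n → Fin κ, Function.update s p i ∘ (Subtype.val : S → Fin n) =
      s ∘ Subtype.val := fun s => funext fun b => Function.update_of_ne (hne b) _ _
  rw [emb_apply, emb_apply, hup, hup]
  congr 1
  refine propext (forall₂_congr fun b _ => ?_)
  by_cases hb : b = p
  · subst hb
    simp [h]
  · rw [Function.update_of_ne hb, Function.update_of_ne hb]

/-- Since `y` acts as the unit at the site `p`, the trace sees only the partial trace of `x` over
that site. -/
theorem ntr_siteExp_mul [NeZero κ] {S : Finset (Fin n)} {p : Fin n} (hp : p ∉ S) (x : TensorPow κ n)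
    {y : TensorPow κ n} (hy : y ∈ supp κ S) : ntr (siteExp p x * y) = ntr (x * y) := by
  have hκ : (κ : ℂ) ≠ 0 := Nat.cast_ne_zero.2 (NeZero.ne κ)
  rw [ntr_apply, ntr_apply]
  congr 1
  simp only [Matrix.trace, Matrix.diag_apply, Matrix.mul_apply]
  simp only [← Fintype.sum_prod_type']
  have h1 : ∀ z : TensorPow κ n, ∑ st : (Fin n → Fin κ) × (Fin n → Fin κ), z st.1 st.2 * y st.2 st.1 =
      ∑ st ∈ Finset.univ.filter fun st : (Fin n → Fin κ) × (Fin n → Fin κ) => st.1 p = st.2 p,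
        z st.1 st.2 * y st.2 st.1 := fun z => by
    rw [Finset.sum_filter]
    refine Finset.sum_congr rfl fun st _ => ?_
    split_ifs with h
    · rfl
    · rw [apply_eq_zero_of_mem_supp hp hy (Ne.symm h), mul_zero]
  rw [h1, h1]
  have h2 : ∀ st ∈ Finset.univ.filter fun st : (Fin n → Fin κ) × (Fin n → Fin κ) => st.1 p = st.2 p,
      siteExp p x st.1 st.2 * y st.2 st.1 = ∑ i : Fin κ, (κ : ℂ)⁻¹ *
        (x (Function.update st.1 p i) (Function.update st.2 p i) * y st.2 st.1) := fun st hst => by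
    rw [siteExp_apply, if_pos (Finset.mem_filter.1 hst).2, ← Finset.mul_sum, ← Finset.sum_mul,
      mul_assoc]
  have h3 : ∀ st : (Fin n → Fin κ) × (Fin n → Fin κ), x st.1 st.2 * y st.2 st.1 =
      ∑ i : Fin κ, (κ : ℂ)⁻¹ * (x st.1 st.2 * y st.2 st.1) := fun st => by
    rw [Finset.sum_const, Finset.card_univ, Fintype.card_fin, nsmul_eq_mul, ← mul_assoc,
      mul_inv_cancel₀ hκ, one_mul]
  rw [Finset.sum_congr rfl h2, Finset.sum_congr rfl fun st _ => h3 st, ← Finset.sum_product',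
    ← Finset.sum_product']
  -- The involution exchanges the averaging index with the common value of the two configurations at
  -- `p`.
  refine Finset.sum_nbij' (fun z => ((Function.update z.1.1 p z.2, Function.update z.1.2 p z.2), z.1.1 p))
    (fun z => ((Function.update z.1.1 p z.2, Function.update z.1.2 p z.2), z.1.1 p)) ?_ ?_ ?_ ?_ ?_
  · simp
  · simp
  · rintro ⟨⟨s, t⟩, i⟩ h
    have h : s p = t p := by simpa using h
    simp [h]
  · rintro ⟨⟨s, t⟩, i⟩ h
    have h : s p = t p := by simpa using h
    simp [h]
  · rintro ⟨⟨s, t⟩, i⟩ h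
    have h : s p = t p := by simpa using h
    simp only
    rw [apply_update_of_mem_supp hp hy h.symm]

end SiteExp

end SpinChain

end

noncomputable section

namespace SpinChain

open scoped Fin.CommRing

variable {κ : ℕ}

/-! ### Product states -/

/-- A normalized functional which satisfies the Cauchy–Schwarz inequality. -/
structure IsCSState {N : ℕ} (ω : TensorPow κ N →ₗ[ℂ] ℂ) : Prop where
  map_one : ω 1 = 1
  map_star : ∀ x, ω (star x) = star (ω x)
  norm_map_mul_le : ∀ y z, ‖ω (y * z)‖ ≤ ‖y‖ * √(ω (star z * z)).re

theorem IsCSState.norm_map_le {N : ℕ} {ω : TensorPow κ N →ₗ[ℂ] ℂ} (h : IsCSState ω)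
    (x : TensorPow κ N) : ‖ω x‖ ≤ ‖x‖ := by
  have := h.norm_map_mul_le x 1
  simpa [h.map_one] using this

/-- By cyclicity of the trace, `ω` is an average of the vector forms at `star C` applied to the
basis vectors. The inequality is Cauchy–Schwarz in each form, then for the sum over the basis. -/
theorem isCSState_of_density {N : ℕ} (C : TensorPow κ N) (hC : ntr (star C * C) = 1)
    {ω : TensorPow κ N →ₗ[ℂ] ℂ} (hω : ∀ x, ω x = ntr (x * (star C * C))) : IsCSState ω := by
  classical
  let T := Matrix.toEuclideanCLM (n := Fin N → Fin κ) (𝕜 := ℂ)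
  let w : ℝ := ((κ : ℝ) ^ Fintype.card (Fin N))⁻¹
  have hw : 0 ≤ w := by positivity
  let e : (Fin N → Fin κ) → EuclideanSpace ℂ (Fin N → Fin κ) := fun s => EuclideanSpace.single s 1
  let v : (Fin N → Fin κ) → EuclideanSpace ℂ (Fin N → Fin κ) := fun s => T (star C) (e s)
  have hdiag : ∀ (A : TensorPow κ N) s, A s s = inner ℂ (e s) (T A (e s)) := fun A s => by
    rw [EuclideanSpace.inner_single_left, map_one, one_mul, Matrix.ofLp_toEuclideanCLM]
    simp [e]
  have hform : ∀ y z, ω (star y * z) = (w : ℂ) * ∑ s, inner ℂ (T y (v s)) (T z (v s)) := by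
    intro y z
    rw [hω, ← mul_assoc, ntr_mul_comm, ← mul_assoc, ← mul_assoc, ntr_apply]
    congr 1
    · simp [w]
    · refine Finset.sum_congr rfl fun s _ => ?_
      have hA : C * (star y * z * star C) = star (y * star C) * (z * star C) := by
        simp only [star_mul, star_star, mul_assoc]
      have hA' : C * star y * z * star C = star (y * star C) * (z * star C) := by
        rw [← hA]
        simp only [mul_assoc]
      rw [Matrix.diag_apply, hA', hdiag (star (y * star C) * (z * star C)) s, map_mul, map_star, mul_apply_eq_comp,
        ContinuousLinearMap.star_eq_adjoint, ContinuousLinearMap.adjoint_inner_right, map_mul,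
        map_mul, mul_apply_eq_comp, mul_apply_eq_comp]
  have hsq : ∀ z, (ω (star z * z)).re = w * ∑ s, ‖T z (v s)‖ ^ 2 := by
    intro z
    rw [hform, Complex.re_ofReal_mul, Complex.re_sum]
    congr 1
    refine Finset.sum_congr rfl fun s _ => ?_
    exact inner_self_eq_norm_sq (𝕜 := ℂ) _
  have h1 : ω 1 = 1 := by rw [hω, one_mul, hC]
  have h2 : w * ∑ s, ‖v s‖ ^ 2 = 1 := by
    have := hsq 1
    rw [star_one, one_mul, h1, map_one] at this
    simpa using this.symm
  refine ⟨h1, fun x => ?_, fun y z => ?_⟩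
  · rw [hω, hω, ← ntr_star, star_mul, star_mul, star_star, ntr_mul_comm]
  · have h3 := hform (star y) z
    rw [star_star] at h3
    rw [h3, norm_mul, Complex.norm_real, Real.norm_of_nonneg hw, hsq]
    have h4 : ‖∑ s, inner ℂ (T (star y) (v s)) (T z (v s))‖ ≤
        ‖y‖ * ∑ s, ‖v s‖ * ‖T z (v s)‖ := by
      rw [Finset.mul_sum]
      refine norm_sum_le_of_le _ fun s _ => ?_
      rw [map_star, ContinuousLinearMap.star_eq_adjoint, ContinuousLinearMap.adjoint_inner_left]
      refine (norm_inner_le_norm _ _).trans ?_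
      have h5 := (T y).le_opNorm (T z (v s))
      have h6 : ‖T y‖ = ‖y‖ := Matrix.l2_opNorm_toEuclideanCLM y
      rw [h6] at h5
      calc ‖v s‖ * ‖T y (T z (v s))‖ ≤ ‖v s‖ * (‖y‖ * ‖T z (v s)‖) := by gcongr
        _ = _ := by ring
    have h7 := Real.sum_mul_le_sqrt_mul_sqrt Finset.univ (fun s => ‖v s‖) fun s => ‖T z (v s)‖
    have h8 : w = √w * √w := (Real.mul_self_sqrt hw).symm
    calc w * ‖∑ s, inner ℂ (T (star y) (v s)) (T z (v s))‖
        ≤ w * (‖y‖ * (√(∑ s, ‖v s‖ ^ 2) * √(∑ s, ‖T z (v s)‖ ^ 2))) := by gcongr; exact h4.trans (by gcongr)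
      _ = ‖y‖ * (√(w * ∑ s, ‖v s‖ ^ 2) * √(w * ∑ s, ‖T z (v s)‖ ^ 2)) := by
        rw [Real.sqrt_mul hw, Real.sqrt_mul hw]
        conv_lhs => rw [h8]
        ring
      _ = _ := by rw [h2, Real.sqrt_one, one_mul]

set_option linter.unusedSectionVars false

section Block

variable {N : ℕ} [NeZero N]

/-- The sites `p, …, p + M - 1`. -/
def window (N : ℕ) [NeZero N] (M : ℕ) (p : Fin N) : Finset (Fin N) :=
  Finset.univ.image (cycSite N M p)

theorem place_mem_supp {M : ℕ} {p : Fin N} {S : Finset (Fin N)} (h : window N M p ⊆ S)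
    (a : TensorPow κ M) : place N p a ∈ supp κ S :=
  emb_mem_supp (fun i => h (Finset.mem_image_of_mem _ (Finset.mem_univ i))) a

theorem ntr_place [NeZero κ] {M : ℕ} (h : M ≤ N) (p : Fin N) (a : TensorPow κ M) :
    ntr (place N p a) = ntr a := ntr_emb (cycSite_injective h p) a

variable (L : ℕ) {m : ℕ} (ρ : TensorPow κ m)

/-- The product of copies of `ρ` placed at the beginnings of the blocks of length `L` with
numbers in `l`. -/
def blockProd (N : ℕ) [NeZero N] (l : List ℕ) : TensorPow κ N :=
  (l.map fun k => place N ((k * L : ℕ) : Fin N) ρ).prod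

/-- The functional with density `ρ` on each of the blocks of length `L`. -/
def blockState (N : ℕ) [NeZero N] : TensorPow κ N →ₗ[ℂ] ℂ :=
  ntr ∘ₗ LinearMap.mulRight ℂ (blockProd L ρ N (List.range (N / L)))

theorem blockState_apply (x : TensorPow κ N) :
    blockState L ρ N x = ntr (x * blockProd L ρ N (List.range (N / L))) := rfl

variable {L}

theorem lt_of_lt_div {k i : ℕ} (hk : k < N / L) (hi : i < L) : k * L + i < N := by
  have h1 := Nat.div_mul_le_self N L
  have h2 : (k + 1) * L ≤ N / L * L := Nat.mul_le_mul_right L hk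
  rw [Nat.add_mul] at h2
  omega

theorem le_of_lt_div (hmL : m ≤ L) {k : ℕ} (hk : k < N / L) : m ≤ N := by
  have h1 := Nat.div_mul_le_self N L
  have h2 : (k + 1) * L ≤ N / L * L := Nat.mul_le_mul_right L hk
  rw [Nat.add_mul] at h2
  omega

theorem val_cycSite_block (hmL : m ≤ L) {k : ℕ} (hk : k < N / L) (i : Fin m) :
    (cycSite N m ((k * L : ℕ) : Fin N) i).val = k * L + i := by
  rw [cycSite, ← Nat.cast_add, Fin.val_natCast,
    Nat.mod_eq_of_lt (lt_of_lt_div hk (i.2.trans_le hmL))]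

theorem div_cycSite_block (hmL : m ≤ L) {k : ℕ} (hk : k < N / L) (i : Fin m) :
    (cycSite N m ((k * L : ℕ) : Fin N) i).val / L = k := by
  rw [val_cycSite_block hmL hk, mul_comm, Nat.mul_add_div (by have := i.2; omega),
    Nat.div_eq_of_lt (i.2.trans_le hmL), add_zero]

/-- The sites in blocks with numbers satisfying `B`. -/
def blockSites (L N : ℕ) (B : ℕ → Prop) [DecidablePred B] : Finset (Fin N) :=
  Finset.univ.filter fun i => B (i.val / L)

theorem mem_blockSites {B : ℕ → Prop} [DecidablePred B] {i : Fin N} :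
    i ∈ blockSites L N B ↔ B (i.val / L) := by simp [blockSites]

theorem compl_blockSites {B : ℕ → Prop} [DecidablePred B] :
    (blockSites L N B)ᶜ = blockSites L N fun k => ¬B k := by
  ext i
  simp [mem_blockSites]

theorem place_block_mem_supp (hmL : m ≤ L) {k : ℕ} (hk : k < N / L) {B : ℕ → Prop}
    [DecidablePred B] (hB : B k) (a : TensorPow κ m) :
    place N ((k * L : ℕ) : Fin N) a ∈ supp κ (blockSites L N B) := by
  refine place_mem_supp ?_ a
  intro i hi
  obtain ⟨u, -, rfl⟩ := Finset.mem_image.1 hi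
  rwa [mem_blockSites, div_cycSite_block hmL hk]

variable {ρ}

theorem blockProd_mem_supp (hmL : m ≤ L) {l : List ℕ} (hl : ∀ k ∈ l, k < N / L) {B : ℕ → Prop}
    [DecidablePred B] (hB : ∀ k ∈ l, B k) : blockProd L ρ N l ∈ supp κ (blockSites L N B) := by
  refine list_prod_mem fun x hx => ?_
  obtain ⟨k, hk, rfl⟩ := List.mem_map.1 hx
  exact place_block_mem_supp hmL (hl k hk) (hB k hk) ρ

theorem disjoint_blockSites (B : ℕ → Prop) [DecidablePred B] :
    Disjoint (blockSites L N B) (blockSites L N fun k => ¬B k) := by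
  rw [← compl_blockSites]
  exact disjoint_compl_right

theorem blockProd_cons (k : ℕ) (l : List ℕ) :
    blockProd L ρ N (k :: l) = place N ((k * L : ℕ) : Fin N) ρ * blockProd L ρ N l := by
  simp [blockProd]

theorem ntr_blockProd [NeZero κ] (hmL : m ≤ L) (hρ : ntr ρ = 1) {l : List ℕ} (hd : l.Nodup)
    (hl : ∀ k ∈ l, k < N / L) : ntr (blockProd L ρ N l) = 1 := by
  induction l with
  | nil => simp [blockProd, ntr_one]
  | cons k l ih =>
    obtain ⟨hk, hd⟩ := List.nodup_cons.1 hd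
    have hkN := hl k List.mem_cons_self
    rw [blockProd_cons, ntr_mul_of_mem_supp (disjoint_blockSites (L := L) (· = k))
      (place_block_mem_supp hmL hkN (B := (· = k)) rfl ρ) (blockProd_mem_supp hmL
        (B := fun j => ¬j = k) (fun j hj => hl j (List.mem_cons_of_mem k hj))
        fun j hj h => hk (h ▸ hj)),
      ih hd fun j hj => hl j (List.mem_cons_of_mem k hj), ntr_place (le_of_lt_div hmL hkN), hρ,
      one_mul]

/-- Densities on different blocks commute, so their product is positive with an explicit square
root. -/
theorem exists_blockProd_eq_star_mul (hmL : m ≤ L) {c : TensorPow κ m} (hc : ρ = star c * c)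
    {l : List ℕ} (hd : l.Nodup) (hl : ∀ k ∈ l, k < N / L) :
    ∃ C : TensorPow κ N, blockProd L ρ N l = star C * C := by
  induction l with
  | nil => exact ⟨1, by simp [blockProd]⟩
  | cons k l ih =>
    obtain ⟨hk, hd⟩ := List.nodup_cons.1 hd
    have hkN := hl k List.mem_cons_self
    obtain ⟨C, hC⟩ := ih hd fun j hj => hl j (List.mem_cons_of_mem k hj)
    refine ⟨C * place N ((k * L : ℕ) : Fin N) c, ?_⟩
    have hcomm : Commute (place N ((k * L : ℕ) : Fin N) c) (blockProd L ρ N l) :=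
      commute_of_mem_supp (disjoint_blockSites (L := L) (· = k))
        (place_block_mem_supp hmL hkN (B := (· = k)) rfl c) (blockProd_mem_supp hmL
          (B := fun j => ¬j = k) (fun j hj => hl j (List.mem_cons_of_mem k hj))
          fun j hj h => hk (h ▸ hj))
    rw [blockProd_cons, hc, place_mul (le_of_lt_div hmL hkN), star_mul, place_star, mul_assoc,
      ← hc, hcomm.eq, hC]
    simp only [mul_assoc]

theorem isCSState_blockState [NeZero κ] (hmL : m ≤ L) (hρ : ntr ρ = 1) {c : TensorPow κ m}
    (hc : ρ = star c * c) : IsCSState (blockState L ρ N) := by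
  have hl : ∀ k ∈ List.range (N / L), k < N / L := fun k hk => List.mem_range.1 hk
  obtain ⟨C, hC⟩ := exists_blockProd_eq_star_mul (N := N) hmL hc List.nodup_range hl
  refine isCSState_of_density C ?_ fun x => ?_
  · rw [← hC, ntr_blockProd hmL hρ List.nodup_range hl]
  · rw [blockState_apply, hC]

theorem commute_place_block (hmL : m ≤ L) {j k : ℕ} (hj : j < N / L) (hk : k < N / L) :
    Commute (place N ((j * L : ℕ) : Fin N) ρ) (place N ((k * L : ℕ) : Fin N) ρ) := by
  rcases eq_or_ne j k with rfl | h
  · exact Commute.refl _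
  · exact commute_of_mem_supp (disjoint_blockSites (L := L) (· = j))
      (place_block_mem_supp hmL hj (B := (· = j)) rfl ρ)
      (place_block_mem_supp hmL hk (B := fun i => ¬i = j) h.symm ρ)

theorem blockProd_eq_filter_mul (hmL : m ≤ L) (B : ℕ → Prop) [DecidablePred B] {l : List ℕ}
    (hl : ∀ k ∈ l, k < N / L) : blockProd L ρ N l =
      blockProd L ρ N (l.filter (B ·)) * blockProd L ρ N (l.filter fun k => ¬B k) := by
  induction l with
  | nil => simp [blockProd]
  | cons k l ih =>
    have hl' : ∀ j ∈ l, j < N / L := fun j hj => hl j (List.mem_cons_of_mem k hj)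
    rw [blockProd_cons, ih hl']
    by_cases h : B k
    · rw [List.filter_cons_of_pos (by simpa using h), List.filter_cons_of_neg (by simpa using h),
        blockProd_cons, mul_assoc]
    · rw [List.filter_cons_of_neg (by simpa using h), List.filter_cons_of_pos (by simpa using h),
        blockProd_cons, ← mul_assoc, ← mul_assoc]
      congr 1
      refine Commute.list_prod_right _ _ fun x hx => ?_
      obtain ⟨j, hj, rfl⟩ := List.mem_map.1 hx
      exact commute_place_block hmL (hl k List.mem_cons_self) (hl' j (List.mem_filter.1 hj).1)

theorem blockState_of_mem_supp [NeZero κ] (hmL : m ≤ L) (hρ : ntr ρ = 1) {B : ℕ → Prop}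
    [DecidablePred B] {x : TensorPow κ N} (hx : x ∈ supp κ (blockSites L N B)) :
    blockState L ρ N x = ntr (x * blockProd L ρ N ((List.range (N / L)).filter (B ·))) := by
  have hl : ∀ k ∈ List.range (N / L), k < N / L := fun k hk => List.mem_range.1 hk
  rw [blockState_apply, blockProd_eq_filter_mul hmL B hl, ← mul_assoc,
    ntr_mul_of_mem_supp (disjoint_blockSites B) (mul_mem hx ?_) (blockProd_mem_supp hmL ?_ ?_),
    ntr_blockProd hmL hρ (List.nodup_range.filter _), mul_one]
  · exact fun k hk => hl k (List.mem_filter.1 hk).1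
  · exact blockProd_mem_supp hmL (fun k hk => hl k (List.mem_filter.1 hk).1)
      fun k hk => by simpa using (List.mem_filter.1 hk).2
  · exact fun k hk => hl k (List.mem_filter.1 hk).1
  · exact fun k hk => by simpa using (List.mem_filter.1 hk).2

/-- The density factorizes over the two sets of blocks, and the normalized trace is multiplicative
over disjoint supports. Sites after the last complete block share the number `N / L`, carry no copy
of `ρ` and count as one more block. -/
theorem blockState_mul [NeZero κ] (hmL : m ≤ L) (hρ : ntr ρ = 1) {B : ℕ → Prop}
    [DecidablePred B] {x y : TensorPow κ N} (hx : x ∈ supp κ (blockSites L N B))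
    (hy : y ∈ supp κ (blockSites L N fun k => ¬B k)) :
    blockState L ρ N (x * y) = blockState L ρ N x * blockState L ρ N y := by
  have hl : ∀ k ∈ List.range (N / L), k < N / L := fun k hk => List.mem_range.1 hk
  have hR1 : blockProd L ρ N ((List.range (N / L)).filter (B ·)) ∈ supp κ (blockSites L N B) :=
    blockProd_mem_supp hmL (fun k hk => hl k (List.mem_filter.1 hk).1)
      fun k hk => by simpa using (List.mem_filter.1 hk).2
  have hR2 : blockProd L ρ N ((List.range (N / L)).filter fun k => ¬B k) ∈
      supp κ (blockSites L N fun k => ¬B k) :=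
    blockProd_mem_supp hmL (fun k hk => hl k (List.mem_filter.1 hk).1)
      fun k hk => by simpa using (List.mem_filter.1 hk).2
  rw [blockState_of_mem_supp hmL hρ hx, blockState_of_mem_supp hmL hρ hy, blockState_apply,
    blockProd_eq_filter_mul hmL B hl]
  have hcomm := commute_of_mem_supp (disjoint_blockSites (L := L) B) hR1 hy
  rw [← ntr_mul_of_mem_supp (disjoint_blockSites B) (mul_mem hx hR1) (mul_mem hy hR2)]
  congr 1
  simp only [mul_assoc]
  rw [← mul_assoc y, ← hcomm.eq, mul_assoc]

theorem card_div_eq_le (k : ℕ) (hL : 0 < L) :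
    (Finset.univ.filter fun j : Fin N => j.val / L = k).card ≤ L := by
  have := Finset.card_le_card_of_injOn (s := Finset.univ.filter fun j : Fin N => j.val / L = k)
    (t := Finset.range L) (fun j => j.val % L) (fun j _ => by simpa using Nat.mod_lt _ hL)
    (by
      intro i hi j hj hij
      have hi : i.val / L = k := by simpa using hi
      have hj : j.val / L = k := by simpa using hj
      have hij : i.val % L = j.val % L := hij
      refine Fin.ext ?_
      rw [← Nat.div_add_mod i.val L, ← Nat.div_add_mod j.val L, hi, hj, hij])
  simpa using this

-- For each `p` and each pair of offsets at most `L` positions `q` qualify, because at most `L`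
-- sites have the same block number.
open Classical in
theorem sum_overlap_le (hL : 0 < L) (M : ℕ) :
    ∑ p : Fin N, ∑ q : Fin N, (if ∃ u v : Fin M,
      (cycSite N M p u).val / L = (cycSite N M q v).val / L then (1 : ℝ) else 0) ≤
      M * M * (N * L) := by
  have h1 : ∀ p q : Fin N, (if ∃ u v : Fin M,
      (cycSite N M p u).val / L = (cycSite N M q v).val / L then (1 : ℝ) else 0) ≤
      ∑ u : Fin M, ∑ v : Fin M,
        if (cycSite N M q v).val / L = (cycSite N M p u).val / L then (1 : ℝ) else 0 := by
    intro p q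
    have hnn : ∀ u v : Fin M, (0 : ℝ) ≤
        if (cycSite N M q v).val / L = (cycSite N M p u).val / L then (1 : ℝ) else 0 :=
      fun u v => by split_ifs <;> norm_num
    split_ifs with h
    · obtain ⟨u, v, huv⟩ := h
      refine le_trans ?_ (Finset.single_le_sum (fun u _ => Finset.sum_nonneg fun v _ => hnn u v)
        (Finset.mem_univ u))
      refine le_trans ?_ (Finset.single_le_sum (fun v _ => hnn u v) (Finset.mem_univ v))
      rw [if_pos huv.symm]
    · exact Finset.sum_nonneg fun u _ => Finset.sum_nonneg fun v _ => hnn u v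
  have h2 : ∀ k : ℕ, ∑ j : Fin N, (if j.val / L = k then (1 : ℝ) else 0) ≤ L := fun k => by
    rw [Finset.sum_boole]
    exact_mod_cast card_div_eq_le (N := N) k hL
  calc _ ≤ ∑ p : Fin N, ∑ q : Fin N, ∑ u : Fin M, ∑ v : Fin M,
        (if (cycSite N M q v).val / L = (cycSite N M p u).val / L then (1 : ℝ) else 0) :=
        Finset.sum_le_sum fun p _ => Finset.sum_le_sum fun q _ => h1 p q
    _ = ∑ p : Fin N, ∑ u : Fin M, ∑ v : Fin M, ∑ q : Fin N,
        (if (cycSite N M q v).val / L = (cycSite N M p u).val / L then (1 : ℝ) else 0) := by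
        refine Finset.sum_congr rfl fun p _ => ?_
        rw [Finset.sum_comm]
        exact Finset.sum_congr rfl fun u _ => Finset.sum_comm
    _ ≤ ∑ p : Fin N, ∑ u : Fin M, ∑ v : Fin M, (L : ℝ) := by
        refine Finset.sum_le_sum fun p _ => Finset.sum_le_sum fun u _ =>
          Finset.sum_le_sum fun v _ => ?_
        refine le_trans (le_of_eq ?_) (h2 ((cycSite N M p u).val / L))
        exact Equiv.sum_comp (Equiv.addRight ((v : ℕ) : Fin N))
          fun j : Fin N => if j.val / L = (cycSite N M p u).val / L then (1 : ℝ) else 0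
    _ = M * M * (N * L) := by
        simp only [Finset.sum_const, Finset.card_univ, Fintype.card_fin, nsmul_eq_mul]
        ring

/-- The dispersion is the average of covariances over pairs of positions. A covariance vanishes
unless the two windows meet a common block, which happens for at most M²NL of the N² pairs. -/
theorem norm_dispersion_blockState_le [NeZero κ] (hL : 0 < L) (hmL : m ≤ L) (hρ : ntr ρ = 1)
    {c : TensorPow κ m} (hc : ρ = star c * c) {M : ℕ} (hM : M ≤ N) (a : TensorPow κ M) :
    ‖blockState L ρ N (star (gammaBar a N) * gammaBar a N) -
      blockState L ρ N (star (gammaBar a N)) * blockState L ρ N (gammaBar a N)‖ ≤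
      2 * ‖a‖ ^ 2 * (M * M * L) * (N : ℝ)⁻¹ := by
  classical
  have hω := isCSState_blockState (N := N) hmL hρ hc
  set ω := blockState L ρ N with hωdef
  have hN0 : (0 : ℝ) < N := Nat.cast_pos.2 (Nat.pos_of_neZero N)
  have h1 : ω (star (gammaBar a N) * gammaBar a N) - ω (star (gammaBar a N)) * ω (gammaBar a N) =
      ((N : ℂ)⁻¹ * (N : ℂ)⁻¹) * ∑ p : Fin N, ∑ q : Fin N,
        (ω (place N p (star a) * place N q a) - ω (place N p (star a)) * ω (place N q a)) := by
    rw [← gammaBar_star, gammaBar_eq hM, gammaBar_eq hM, smul_mul_smul_comm, map_smul, map_smul,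
      map_smul, Finset.sum_mul_sum, map_sum, map_sum, map_sum]
    simp only [map_sum, Finset.sum_sub_distrib, smul_eq_mul]
    rw [← Finset.sum_mul_sum]
    ring
  have h2 : ∀ p q : Fin N,
      ‖ω (place N p (star a) * place N q a) - ω (place N p (star a)) * ω (place N q a)‖ ≤
      (2 * ‖a‖ ^ 2) * if ∃ u v : Fin M,
        (cycSite N M p u).val / L = (cycSite N M q v).val / L then (1 : ℝ) else 0 := by
    intro p q
    split_ifs with h
    · have ha : ‖place N p (star a)‖ ≤ ‖a‖ := (norm_place_le hM p _).trans (norm_star a).le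
      have hb : ‖place N q a‖ ≤ ‖a‖ := norm_place_le hM q a
      refine (norm_sub_le _ _).trans ?_
      rw [norm_mul]
      have h3 := (hω.norm_map_le (place N p (star a) * place N q a)).trans (norm_mul_le _ _)
      have h4 := (hω.norm_map_le (place N p (star a))).trans ha
      have h5 := (hω.norm_map_le (place N q a)).trans hb
      have h6 : ‖place N p (star a)‖ * ‖place N q a‖ ≤ ‖a‖ * ‖a‖ := by gcongr
      have h7 : ‖ω (place N p (star a))‖ * ‖ω (place N q a)‖ ≤ ‖a‖ * ‖a‖ := by gcongr
      linarith
    · rw [hωdef, blockState_mul hmL hρ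
        (B := fun k => ∃ u : Fin M, (cycSite N M p u).val / L = k), sub_self, norm_zero, mul_zero]
      · refine place_mem_supp ?_ _
        intro i hi
        obtain ⟨u, -, rfl⟩ := Finset.mem_image.1 hi
        exact mem_blockSites.2 ⟨u, rfl⟩
      · refine place_mem_supp ?_ _
        intro i hi
        obtain ⟨v, -, rfl⟩ := Finset.mem_image.1 hi
        rw [mem_blockSites]
        rintro ⟨u, hu⟩
        exact h ⟨u, v, hu⟩
  have h3 : ‖∑ p : Fin N, ∑ q : Fin N,
      (ω (place N p (star a) * place N q a) - ω (place N p (star a)) * ω (place N q a))‖ ≤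
      2 * ‖a‖ ^ 2 * (M * M * (N * L)) := by
    refine (norm_sum_le_of_le _ fun p _ => norm_sum_le_of_le _ fun q _ => h2 p q).trans ?_
    simp only [← Finset.mul_sum]
    exact mul_le_mul_of_nonneg_left (sum_overlap_le hL M) (by positivity)
  rw [h1, norm_mul, norm_mul, norm_inv, Complex.norm_natCast]
  calc _ ≤ ((N : ℝ)⁻¹ * (N : ℝ)⁻¹) * (2 * ‖a‖ ^ 2 * (M * M * (N * L))) := by gcongr
    _ = _ := by field_simp

end Block

end SpinChain

end

noncomputable section

namespace SpinChain

open scoped Fin.CommRing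

variable {κ : ℕ}

/-! ### Asymptotically dispersion-free states -/

/-- A family of states for which the `γ`-averages become dispersion-free. -/
structure IsDispersionFree (ω : ∀ N : ℕ+, TensorPow κ N →ₗ[ℂ] ℂ) : Prop where
  isCSState : ∀ N, IsCSState (ω N)
  tendsto : ∀ {M : ℕ} (a : TensorPow κ M), Tendsto (fun N : ℕ+ =>
    ω N (star (gammaBar a N) * gammaBar a N) - ω N (star (gammaBar a N)) * ω N (gammaBar a N))
      atTop (𝓝 0)

theorem isDispersionFree_blockState [NeZero κ] {L m : ℕ} {ρ : TensorPow κ m} (hL : 0 < L)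
    (hmL : m ≤ L) (hρ : ntr ρ = 1) {c : TensorPow κ m} (hc : ρ = star c * c) :
    IsDispersionFree fun N : ℕ+ => blockState L ρ N where
  isCSState N := isCSState_blockState hmL hρ hc
  tendsto {M} a := by
    rw [tendsto_zero_iff_norm_tendsto_zero]
    refine squeeze_zero' (.of_forall fun _ => norm_nonneg _) (g := fun N : ℕ+ =>
      2 * ‖a‖ ^ 2 * (M * M * L) * ((N : ℕ) : ℝ)⁻¹) ?_
      (by simpa using tendsto_inv_natCast.const_mul (2 * ‖a‖ ^ 2 * (M * M * L)))
    filter_upwards [eventually_le_pnat M] with N hN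
    exact norm_dispersion_blockState_le hL hmL hρ hc hN a

namespace IsDispersionFree

variable {ω : ∀ N : ℕ+, TensorPow κ N →ₗ[ℂ] ℂ}

/-- With the centred average `z`, the error is `ω (y z)`; Cauchy–Schwarz bounds it by the norm of
`y` times the square root of the dispersion. -/
theorem tendsto_mul_gammaBar (hω : IsDispersionFree ω)
    {y : ∀ N : ℕ+, TensorPow κ N} {C : ℝ} (hy : ∀ N, ‖y N‖ ≤ C)
    {M : ℕ} (a : TensorPow κ M) : Tendsto (fun N : ℕ+ =>
      ω N (y N * gammaBar a N) - ω N (y N) * ω N (gammaBar a N)) atTop (𝓝 0) := by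
  have h1 : ∀ N : ℕ+, ‖ω N (y N * gammaBar a N) - ω N (y N) * ω N (gammaBar a N)‖ ≤
      C * √(ω N (star (gammaBar a N) * gammaBar a N) -
        ω N (star (gammaBar a N)) * ω N (gammaBar a N)).re := fun N => by
    set g := gammaBar a N
    set z := g - ω N g • (1 : TensorPow κ N)
    have h2 : ω N (y N * g) - ω N (y N) * ω N g = ω N (y N * z) := by
      rw [mul_sub, map_sub, mul_smul_comm, mul_one, map_smul, smul_eq_mul, mul_comm (ω N g)]
    have h3 : ω N (star g * g) - ω N (star g) * ω N g = ω N (star z * z) := by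
      have : star z * z = star g * g - ω N g • star g - star (ω N g) • g +
          (star (ω N g) * ω N g) • 1 := by
        simp only [z, star_sub, star_smul, star_one, sub_mul, mul_sub, smul_mul_assoc,
          mul_smul_comm, one_mul, mul_one, smul_sub, smul_smul, mul_comm (ω N g)]
        abel
      rw [this, map_add, map_sub, map_sub, map_smul, map_smul, map_smul, (hω.isCSState N).map_one,
        (hω.isCSState N).map_star]
      simp only [smul_eq_mul]
      ring
    rw [h2, h3]
    exact ((hω.isCSState N).norm_map_mul_le _ _).trans
      (mul_le_mul_of_nonneg_right (hy N) (Real.sqrt_nonneg _))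
  refine squeeze_zero_norm h1 ?_
  have h := (Complex.continuous_re.tendsto 0).comp (hω.tendsto a)
  have h' := ((Real.continuous_sqrt.tendsto _).comp h).const_mul C
  simpa using h'

variable [NeZero κ]

/-- Equal leading parts give equal classes, hence sequences differing by a null sequence. So any
representative of the leading part may be used in the induction that follows. -/
theorem tendsto_of_lead_eq (hω : IsDispersionFree ω) {f g : LocalAlg κ} (h : lead f = lead g) {u : ℕ+ → ℂ}
    (hf : Tendsto (fun N => ω N (f.1 N) - u N) atTop (𝓝 0)) :
    Tendsto (fun N => ω N (g.1 N) - u N) atTop (𝓝 0) := by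
  have h1 : localClass g = localClass f := by rw [← leadClass_lead, ← leadClass_lead, h]
  have h2 : Tendsto (fun N => ω N (g.1 N - f.1 N)) atTop (𝓝 0) :=
    squeeze_zero_norm (fun N => (hω.isCSState N).norm_map_le _) (localClass_eq_iff.1 h1)
  have h3 := h2.add hf
  rw [add_zero] at h3
  refine h3.congr fun N => ?_
  rw [map_sub]
  ring

/-- Evaluation of a local sequence in dispersion-free states is evaluation of polynomials. -/
theorem tendsto_sub_eval (hω : IsDispersionFree ω) (P : IrrPoly κ) {f : LocalAlg κ} (hf : lead f = leadPoly P) :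
    Tendsto (fun N : ℕ+ => ω N (f.1 N) -
      MvPolynomial.eval (fun b => ω N (gammaBar b.elt N)) P) atTop (𝓝 0) := by
  induction P using MvPolynomial.induction_on generalizing f with
  | C c =>
    have h : lead (algebraMap ℂ (LocalAlg κ) c) = lead f := by
      rw [hf, AlgHom.commutes, ← MvPolynomial.algebraMap_eq, AlgHom.commutes]
    refine hω.tendsto_of_lead_eq h (tendsto_const_nhds.congr fun N => ?_)
    have h1 : (algebraMap ℂ (LocalAlg κ) c).1 N = c • 1 := Algebra.algebraMap_eq_smul_one c
    rw [h1, map_smul, (hω.isCSState N).map_one, MvPolynomial.eval_C, smul_eq_mul, mul_one, sub_self]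
  | add P P' h h' =>
    obtain ⟨g, hg⟩ := lead_surjective (leadPoly P)
    obtain ⟨g', hg'⟩ := lead_surjective (leadPoly P')
    have h1 : lead (g + g') = lead f := by rw [hf, map_add, map_add, hg, hg']
    have h2 := (h hg).add (h' hg')
    rw [add_zero] at h2
    refine hω.tendsto_of_lead_eq h1 (h2.congr fun N => ?_)
    have h3 : (g + g').1 N = g.1 N + g'.1 N := rfl
    rw [h3, map_add, map_add]
    ring
  | mul_X P b h =>
    obtain ⟨g, hg⟩ := lead_surjective (leadPoly P)
    have h1 : lead (g * gammaLocal b.elt) = lead f := by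
      rw [hf, map_mul, map_mul, hg, leadPoly_X]
    obtain ⟨C, hC⟩ := g.2.exists_norm_le
    have h2 : Tendsto (fun N : ℕ+ => (ω N (g.1 N) -
        MvPolynomial.eval (fun b => ω N (gammaBar b.elt N)) P) * ω N (gammaBar b.elt N)) atTop
          (𝓝 0) := by
      refine squeeze_zero_norm (a := fun N : ℕ+ => ‖ω N (g.1 N) -
        MvPolynomial.eval (fun b => ω N (gammaBar b.elt N)) P‖ * ‖b.elt‖) (fun N => ?_) ?_
      · rw [norm_mul]
        gcongr
        exact ((hω.isCSState N).norm_map_le _).trans (norm_gammaBar_le _ _)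
      · simpa using (h hg).norm.mul_const ‖b.elt‖
    have h3 := (hω.tendsto_mul_gammaBar hC b.elt).add h2
    rw [add_zero] at h3
    refine hω.tendsto_of_lead_eq h1 (h3.congr fun N => ?_)
    have h4 : (g * gammaLocal b.elt).1 N = g.1 N * gammaBar b.elt N := rfl
    rw [h4, map_mul (MvPolynomial.eval _), MvPolynomial.eval_X]
    ring

/-- The expectations of a null sequence tend to zero, and asymptotically they are the values of `P`
at the expectations of the γ-averages. -/
theorem eval_eq_zero (hω : IsDispersionFree ω) {P : IrrPoly κ} (hP : leadClass (leadPoly P) = 0) {μ : IrrIndex κ → ℂ}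
    (hμ : ∀ b ∈ P.vars, Tendsto (fun N : ℕ+ => ω N (gammaBar b.elt N)) atTop (𝓝 (μ b))) :
    MvPolynomial.eval μ P = 0 := by
  classical
  obtain ⟨f, hf⟩ := lead_surjective (leadPoly P)
  have h0 : localClass f = localClass 0 := by rw [← leadClass_lead, hf, hP, map_zero]
  have h1 : Tendsto (fun N => ω N (f.1 N)) atTop (𝓝 0) := by
    refine squeeze_zero_norm (fun N => (hω.isCSState N).norm_map_le _) ?_
    refine (localClass_eq_iff.1 h0).congr fun N => ?_
    exact congrArg norm (sub_zero _)
  -- Convergence is known only for the variables of `P`; the other coordinates do not affect the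
  -- value and are frozen at `μ`.
  let ν : ℕ+ → IrrIndex κ → ℂ := fun N b => if b ∈ P.vars then ω N (gammaBar b.elt N) else μ b
  have h2 : Tendsto ν atTop (𝓝 μ) := by
    refine tendsto_pi_nhds.2 fun b => ?_
    by_cases hb : b ∈ P.vars
    · simpa [ν, hb] using hμ b hb
    · simp [ν, hb]
  have h3 : ∀ N, MvPolynomial.eval (ν N) P =
      MvPolynomial.eval (fun b => ω N (gammaBar b.elt N)) P := fun N =>
    MvPolynomial.eval₂Hom_congr' rfl (fun b hb _ => if_pos hb) rfl
  have h4 : Tendsto (fun N => MvPolynomial.eval (ν N) P) atTop (𝓝 (MvPolynomial.eval μ P)) :=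
    ((MvPolynomial.continuous_eval P).tendsto μ).comp h2
  have h5 := h1.sub (hω.tendsto_sub_eval P hf)
  simp only [sub_sub_cancel, sub_zero] at h5
  exact tendsto_nhds_unique (h4.congr h3) h5

end IsDispersionFree

end SpinChain

end

noncomputable section

namespace SpinChain

open scoped Fin.CommRing

set_option linter.unusedSectionVars false

variable {κ : ℕ}

/-! ### Trace pairings of irreducible elements -/

theorem siteExp_star {n : ℕ} (p : Fin n) (x : TensorPow κ n) :
    siteExp p (star x) = star (siteExp p x) := by
  ext s t
  simp only [siteExp_apply, Matrix.star_apply, eq_comm (a := s p)]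
  split_ifs <;> simp

theorem star_mem_irrSubmodule {n : ℕ} {a : TensorPow κ (n + 1)} (ha : a ∈ irrSubmodule κ n) :
    star a ∈ irrSubmodule κ n := by
  rw [irrSubmodule, Submodule.mem_inf, LinearMap.mem_ker, LinearMap.mem_ker] at *
  rw [siteExp_star, siteExp_star, ha.1, ha.2, star_zero]
  exact ⟨rfl, rfl⟩

section Pairing

variable [NeZero κ]

theorem ntr_eq_zero_of_mem_irr {n : ℕ} {a : TensorPow κ (n + 1)} (ha : a ∈ irrSubmodule κ n) :
    ntr a = 0 := by
  have h := ntr_siteExp_mul (Finset.notMem_empty 0) a (one_mem (supp κ ∅))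
  rw [mul_one, mul_one, LinearMap.mem_ker.1 (Submodule.mem_inf.1 ha).1, map_zero] at h
  exact h.symm

variable {N : ℕ} [NeZero N]

/-- If `y` does not involve the first site of the window, the expectation at that site can be
inserted under the trace, and it annihilates `a`. -/
theorem ntr_place_mul_eq_zero_left {n : ℕ} (hn : n + 1 ≤ N) {a : TensorPow κ (n + 1)}
    (ha : a ∈ irrSubmodule κ n) {p : Fin N} {S : Finset (Fin N)} (hp : p ∉ S) {y : TensorPow κ N}
    (hy : y ∈ supp κ S) : ntr (place N p a * y) = 0 := by
  have h1 : siteExp p (place N p a) = 0 := by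
    have h := siteExp_emb (cycSite_injective hn p) 0 a
    have h0 : cycSite N (n + 1) p 0 = p := by simp [cycSite]
    rw [h0, LinearMap.mem_ker.1 (Submodule.mem_inf.1 ha).1, map_zero] at h
    exact h
  rw [← ntr_siteExp_mul hp _ hy, h1, zero_mul, map_zero]

theorem ntr_place_mul_eq_zero_right {n : ℕ} (hn : n + 1 ≤ N) {a : TensorPow κ (n + 1)}
    (ha : a ∈ irrSubmodule κ n) {p : Fin N} {S : Finset (Fin N)} (hp : p + (n : Fin N) ∉ S)
    {y : TensorPow κ N} (hy : y ∈ supp κ S) : ntr (place N p a * y) = 0 := by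
  have h1 : siteExp (p + (n : Fin N)) (place N p a) = 0 := by
    have h := siteExp_emb (cycSite_injective hn p) (Fin.last n) a
    have h0 : cycSite N (n + 1) p (Fin.last n) = p + (n : Fin N) := by simp [cycSite]
    rw [h0, LinearMap.mem_ker.1 (Submodule.mem_inf.1 ha).2, map_zero] at h
    exact h
  rw [← ntr_siteExp_mul hp _ hy, h1, zero_mul, map_zero]

theorem mem_window {M : ℕ} {p i : Fin N} :
    i ∈ window N M p ↔ ∃ u : ℕ, u < M ∧ i = p + (u : Fin N) := by
  simp only [window, Finset.mem_image, Finset.mem_univ, true_and, cycSite]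
  constructor
  · rintro ⟨u, rfl⟩
    exact ⟨u, u.2, rfl⟩
  · rintro ⟨u, hu, rfl⟩
    exact ⟨⟨u, hu⟩, rfl⟩

/-- A nonzero pairing forces both end sites of each window into the other window. As the lengths add
up to at most `N`, the windows then start at the same site and have equal length. -/
theorem ntr_place_mul_place_eq_zero {n n' : ℕ} (hn : n + 1 + (n' + 1) ≤ N)
    {a : TensorPow κ (n + 1)} {a' : TensorPow κ (n' + 1)} (ha : a ∈ irrSubmodule κ n)
    (ha' : a' ∈ irrSubmodule κ n') {p q : Fin N} (h : p = q → n ≠ n') :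
    ntr (place N p a * place N q a') = 0 := by
  by_contra hne
  have hw : place N p a ∈ supp κ (window N (n + 1) p) := place_mem_supp subset_rfl a
  have hw' : place N q a' ∈ supp κ (window N (n' + 1) q) := place_mem_supp subset_rfl a'
  have h1 : p ∈ window N (n' + 1) q := by
    by_contra hp
    exact hne (ntr_place_mul_eq_zero_left (by omega) ha hp hw')
  have h2 : q ∈ window N (n + 1) p := by
    by_contra hq
    exact hne (by rw [ntr_mul_comm, ntr_place_mul_eq_zero_left (by omega) ha' hq hw])
  have h3 : p + (n : Fin N) ∈ window N (n' + 1) q := by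
    by_contra hp
    exact hne (ntr_place_mul_eq_zero_right (by omega) ha hp hw')
  have h4 : q + (n' : Fin N) ∈ window N (n + 1) p := by
    by_contra hq
    exact hne (by rw [ntr_mul_comm, ntr_place_mul_eq_zero_right (by omega) ha' hq hw])
  rw [mem_window] at h1 h2 h3 h4
  obtain ⟨u, hu, hpu⟩ := h1
  obtain ⟨v, hv, hqv⟩ := h2
  obtain ⟨s, hs, hps⟩ := h3
  obtain ⟨t, ht, hqt⟩ := h4
  -- The offsets of each start in the other window add up to zero modulo `N` and to less than `N`.
  have huv : u + v = 0 := by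
    refine natCast_inj_of_lt (N := N) (by omega) (by omega) ?_
    push_cast
    linear_combination -hpu - hqv
  obtain rfl : u = 0 := by omega
  have hpq : p = q := by simpa using hpu
  subst hpq
  have hns : n = s := natCast_inj_of_lt (by omega) (by omega) (add_left_cancel hps)
  have hnt : n' = t := natCast_inj_of_lt (by omega) (by omega) (add_left_cancel hqt)
  exact h rfl (by omega)

/-- The trace pairing on the space of irreducible elements. -/
def irrForm (κ n : ℕ) : LinearMap.BilinForm ℂ (irrSubmodule κ n) :=
  LinearMap.mk₂ ℂ (fun a b => ntr (a.1 * b.1))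
    (fun a b c => by rw [Submodule.coe_add, add_mul, map_add])
    (fun c a b => by rw [Submodule.coe_smul, smul_mul_assoc, map_smul])
    (fun a b c => by rw [Submodule.coe_add, mul_add, map_add])
    (fun c a b => by rw [Submodule.coe_smul, mul_smul_comm, map_smul])

theorem irrForm_apply {n : ℕ} (a b : irrSubmodule κ n) :
    irrForm κ n a b = ntr (a.1 * b.1) := rfl

/-- The adjoint of an irreducible element is irreducible, and pairing an element with its adjoint
gives its normalized squared Hilbert–Schmidt norm. -/
theorem irrForm_nondegenerate (n : ℕ) : (irrForm κ n).Nondegenerate := by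
  have h : ∀ x : irrSubmodule κ n, (∀ y, irrForm κ n x y = 0) → x = 0 := fun x hx => by
    have h1 := hx ⟨star x.1, star_mem_irrSubmodule x.2⟩
    have hκ : (κ : ℂ) ≠ 0 := Nat.cast_ne_zero.2 (NeZero.ne κ)
    rw [irrForm_apply, ntr_apply] at h1
    have h2 := (mul_eq_zero.1 h1).resolve_left (inv_ne_zero (pow_ne_zero _ hκ))
    exact Subtype.ext (Matrix.trace_mul_conjTranspose_self_eq_zero_iff.1 h2)
  refine ⟨h, fun x hx => h x fun y => ?_⟩
  rw [irrForm_apply, ntr_mul_comm]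
  exact hx y

/-- The elements dual to the basis elements with respect to the trace pairing. -/
def IrrIndex.dual (b : IrrIndex κ) : TensorPow κ b.degree :=
  (irrSubmodule κ b.order).subtype ((irrForm κ b.order).dualBasis (irrForm_nondegenerate b.order)
    (Module.finBasis ℂ (irrSubmodule κ b.order)) b.index)

theorem IrrIndex.dual_mem (b : IrrIndex κ) : b.dual ∈ irrSubmodule κ b.order :=
  ((irrForm κ b.order).dualBasis (irrForm_nondegenerate b.order)
    (Module.finBasis ℂ (irrSubmodule κ b.order)) b.index).2

open Classical in
theorem ntr_place_elt_mul_place_dual {b b' : IrrIndex κ} (h : b.degree + b'.degree ≤ N)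
    (p : Fin N) : ntr (place N p b.elt * place N p b'.dual) = if b = b' then 1 else 0 := by
  by_cases hn : b.order = b'.order
  · obtain ⟨n, i⟩ := b
    obtain ⟨n', j⟩ := b'
    obtain rfl : n = n' := hn
    have h' : n + 1 + (n + 1) ≤ N := h
    have h1 := LinearMap.BilinForm.apply_dualBasis_left (irrForm_nondegenerate (κ := κ) n)
      (Module.finBasis ℂ (irrSubmodule κ n)) j i
    have h2 : (IrrIndex.mk n i = IrrIndex.mk n j) ↔ i = j := by simp
    rw [← place_mul (M := n + 1) (by omega), ntr_place (by omega), ntr_mul_comm]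
    simp only [h2]
    exact h1
  · rw [if_neg fun hb : b = b' => hn (congrArg IrrIndex.order hb)]
    exact ntr_place_mul_place_eq_zero h b.elt_mem b'.dual_mem fun _ => hn

end Pairing

/-! ### Densities close to the unit -/

open scoped MatrixOrder in
theorem exists_eq_star_mul_of_posSemidef {ι : Type*} [Fintype ι] [DecidableEq ι]
    {A : Matrix ι ι ℂ} (hA : A.PosSemidef) : ∃ c : Matrix ι ι ℂ, A = star c * c :=
  CStarAlgebra.nonneg_iff_eq_star_mul_self.1 hA.nonneg

/-- The quadratic form of `1 + A` at `v` is at least `‖v‖² - ‖A‖ ‖v‖²`, which is nonnegative. -/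
theorem exists_one_add_eq_star_mul {ι : Type*} [Fintype ι] [DecidableEq ι]
    {A : Matrix ι ι ℂ} (hA : star A = A) (hn : ‖A‖ ≤ 1) :
    ∃ c : Matrix ι ι ℂ, 1 + A = star c * c := by
  refine exists_eq_star_mul_of_posSemidef (.of_dotProduct_mulVec_nonneg ?_ fun x => ?_)
  · rw [Matrix.IsHermitian, ← Matrix.star_eq_conjTranspose, star_add, star_one, hA]
  · let v : EuclideanSpace ℂ ι := WithLp.toLp 2 x
    let T := Matrix.toEuclideanCLM (n := ι) (𝕜 := ℂ)
    have h1 : star x ⬝ᵥ ((1 + A).mulVec x) = inner ℂ v v + inner ℂ v (T A v) := by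
      rw [Matrix.add_mulVec, Matrix.one_mulVec, dotProduct_add, EuclideanSpace.inner_eq_star_dotProduct,
        EuclideanSpace.inner_eq_star_dotProduct, dotProduct_comm, dotProduct_comm (star x)]
      rfl
    have h2 : starRingEnd ℂ (inner ℂ v (T A v)) = inner ℂ v (T A v) := by
      rw [inner_conj_symm, ← ContinuousLinearMap.adjoint_inner_right,
        ← ContinuousLinearMap.star_eq_adjoint, ← map_star, hA]
    have h3 : ‖inner ℂ v (T A v)‖ ≤ ‖v‖ ^ 2 := by
      refine (norm_inner_le_norm _ _).trans ?_
      have h4 := (T A).le_opNorm v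
      have h5 : ‖T A‖ = ‖A‖ := Matrix.l2_opNorm_toEuclideanCLM A
      rw [h5] at h4
      have h6 : ‖A‖ * ‖v‖ ≤ 1 * ‖v‖ := by gcongr
      calc ‖v‖ * ‖T A v‖ ≤ ‖v‖ * (1 * ‖v‖) := by gcongr; exact h4.trans h6
        _ = ‖v‖ ^ 2 := by ring
    rw [h1, inner_self_eq_norm_sq_to_K, ← Complex.conj_eq_iff_re.1 h2]
    have h7 : -(‖v‖ ^ 2) ≤ (inner ℂ v (T A v)).re :=
      (abs_le.1 ((Complex.abs_re_le_norm _).trans h3)).1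
    have h8 : ((‖v‖ : ℂ) ^ 2 + ((inner ℂ v (T A v)).re : ℂ)) =
        ((‖v‖ ^ 2 + (inner ℂ v (T A v)).re : ℝ) : ℂ) := by push_cast; rfl
    exact h8.symm ▸ Complex.zero_le_real.2 (by linarith)

end SpinChain

end

noncomputable section

namespace SpinChain

open scoped Fin.CommRing

variable {κ : ℕ}

/-! ### Linear independence of the classes of monomials -/

set_option linter.unusedSectionVars false

section Block

variable [NeZero κ] {N : ℕ} [NeZero N]

theorem place_place {M K : ℕ} [NeZero K] {j : ℕ} (h : j + M ≤ K) (hK : K ≤ N) (q : Fin N)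
    (x : TensorPow κ M) :
    place N q (place K (j : Fin K) x) = place N (q + (j : Fin N)) x := by
  refine place_emb hK _ _ _ (fun i => ?_) x
  rw [cycSite, ← Nat.cast_add, Fin.val_natCast, Nat.mod_eq_of_lt (by omega), Nat.cast_add, add_assoc]

variable {L m : ℕ} {ρ : TensorPow κ m}

theorem filter_range_eq_singleton {n k : ℕ} (hk : k < n) :
    (List.range n).filter (fun i => i = k) = [k] := by
  have h : (List.range n).filter (fun i => decide (i = k)) = (List.range n).filter (· == k) := rfl
  rw [h, List.filter_beq, List.nodup_range.count, if_pos (List.mem_range.2 hk)]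
  rfl

/-- A window that stays within one complete block sees only the density of that block. -/
theorem blockState_place_block (hmL : m ≤ L) (hρ : ntr ρ = 1) {k j M : ℕ} (hk : k < N / L)
    (hj : j + M ≤ L) (a : TensorPow κ M) :
    blockState L ρ N (place N ((k * L + j : ℕ) : Fin N) a) =
      ntr (place N ((k * L + j : ℕ) : Fin N) a * place N ((k * L : ℕ) : Fin N) ρ) := by
  have hx : place N ((k * L + j : ℕ) : Fin N) a ∈ supp κ (blockSites L N (· = k)) := by
    refine place_mem_supp ?_ a
    intro i hi
    obtain ⟨u, hu, rfl⟩ := mem_window.1 hi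
    have h1 : k * L + j + u < N := by
      rw [add_assoc]
      exact lt_of_lt_div hk (by omega)
    rw [mem_blockSites, ← Nat.cast_add, Fin.val_natCast, Nat.mod_eq_of_lt h1, add_assoc, mul_comm,
      Nat.mul_add_div (by omega), Nat.div_eq_of_lt (by omega), add_zero]
  rw [blockState_of_mem_supp hmL hρ hx, filter_range_eq_singleton hk]
  simp [blockProd]

/-- Blocks are at least twice as long as `ρ`, so a window starting on a site covered by a copy of
`ρ` stays within the block, and by `hpair` it contributes only at the exact beginning. A window
starting on an uncovered site contributes nothing, by irreducibility at its first site. -/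
theorem blockState_place_irr (hm : 0 < m) (hmL : 2 * m ≤ L) (hρ : ntr ρ = 1) {n : ℕ}
    (hn : n + 1 ≤ m) {a : TensorPow κ (n + 1)} (ha : a ∈ irrSubmodule κ n)
    (hpair : ∀ p q : Fin N, p ≠ q → ntr (place N p a * place N q ρ) = 0) (hmN : m ≤ N) (p : Fin N)
    [NeZero m] [Decidable (∃ k < N / L, p = ((k * L : ℕ) : Fin N))] :
    blockState L ρ N (place N p a) =
      if ∃ k < N / L, p = ((k * L : ℕ) : Fin N) then ntr (place m 0 a * ρ) else 0 := by
  by_cases hp : ∃ k < N / L, ∃ j < m, p = ((k * L + j : ℕ) : Fin N)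
  · obtain ⟨k, hk, j, hj, rfl⟩ := hp
    rw [blockState_place_block (by omega) hρ hk (by omega)]
    rcases Nat.eq_zero_or_pos j with rfl | hj0
    · rw [if_pos ⟨k, hk, by rw [add_zero]⟩, add_zero]
      have h1 := place_place (N := N) (K := m) (j := 0) (M := n + 1) (by omega) hmN
        ((k * L : ℕ) : Fin N) a
      rw [Nat.cast_zero, Nat.cast_zero, add_zero] at h1
      rw [← h1, ← place_mul hmN, ntr_place hmN]
    · have hne : ∀ k' < N / L, ((k * L + j : ℕ) : Fin N) ≠ ((k' * L : ℕ) : Fin N) := by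
        intro k' hk' h
        have h1 := natCast_inj_of_lt (lt_of_lt_div hk (by omega))
          (by simpa using lt_of_lt_div hk' (i := 0) (by omega)) h
        have h2 := congrArg (· % L) h1
        simp only [Nat.mul_add_mod', Nat.mul_mod_left] at h2
        rw [Nat.mod_eq_of_lt (by omega)] at h2
        omega
      rw [if_neg fun ⟨k', hk', h⟩ => hne k' hk' h]
      exact hpair _ _ (hne k hk)
  · rw [if_neg fun ⟨k, hk, h⟩ => hp ⟨k, hk, 0, hm, h⟩, blockState_apply]
    refine ntr_place_mul_eq_zero_left (by omega) ha (S := {p}ᶜ) (by simp) ?_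
    refine list_prod_mem fun x hx => ?_
    obtain ⟨k, hk, rfl⟩ := List.mem_map.1 hx
    refine place_mem_supp ?_ ρ
    intro i hi
    obtain ⟨u, hu, rfl⟩ := mem_window.1 hi
    rw [Finset.mem_compl, Finset.mem_singleton]
    intro h
    exact hp ⟨k, List.mem_range.1 hk, u, hu, by rw [← h, Nat.cast_add]⟩

theorem blockState_gammaBar_irr (hm : 0 < m) (hmL : 2 * m ≤ L) (hρ : ntr ρ = 1) {n : ℕ}
    (hn : n + 1 ≤ m) {a : TensorPow κ (n + 1)} (ha : a ∈ irrSubmodule κ n)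
    (hpair : ∀ p q : Fin N, p ≠ q → ntr (place N p a * place N q ρ) = 0) (hmN : m ≤ N)
    [NeZero m] : blockState L ρ N (gammaBar a N) =
      (((N / L : ℕ) : ℂ) / (N : ℂ)) * ntr (place m 0 a * ρ) := by
  classical
  rw [gammaBar_eq (by omega), map_smul, map_sum,
    Finset.sum_congr rfl fun p _ => blockState_place_irr hm hmL hρ hn ha hpair hmN p,
    ← Finset.sum_filter, Finset.sum_const]
  have h : (Finset.univ.filter fun p : Fin N => ∃ k < N / L, p = ((k * L : ℕ) : Fin N)) =
      (Finset.range (N / L)).image fun k => ((k * L : ℕ) : Fin N) := by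
    ext p
    simp [eq_comm]
  rw [h, Finset.card_image_of_injOn, Finset.card_range, nsmul_eq_mul, smul_eq_mul]
  · ring
  · intro k hk k' hk' h
    have hk : k < N / L := by simpa using hk
    have hk' : k' < N / L := by simpa using hk'
    have h1 := natCast_inj_of_lt (by simpa using lt_of_lt_div hk (i := 0) (by omega))
      (by simpa using lt_of_lt_div hk' (i := 0) (by omega)) h
    exact Nat.eq_of_mul_eq_mul_right (by omega) h1

end Block

theorem tendsto_natDiv_div (L : ℕ) :
    Tendsto (fun N : ℕ+ => (((N : ℕ) / L : ℕ) : ℂ) / ((N : ℕ) : ℂ)) atTop (𝓝 (L : ℂ)⁻¹) := by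
  have h1 : Tendsto (fun N : ℕ+ => ((N : ℕ) : ℝ)) atTop atTop :=
    tendsto_natCast_atTop_atTop.comp (tendsto_atTop.2 eventually_le_pnat)
  have h2 := (tendsto_nat_floor_mul_div_atTop (R := ℝ) (a := (L : ℝ)⁻¹) (by positivity)).comp h1
  have h3 := (Complex.continuous_ofReal.tendsto _).comp h2
  rw [Complex.ofReal_inv, Complex.ofReal_natCast] at h3
  refine h3.congr fun N => ?_
  simp only [Function.comp_apply]
  rw [inv_mul_eq_div, Nat.floor_div_natCast, Nat.floor_natCast]
  push_cast
  rfl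

section Injective

variable [NeZero κ]

/-- The density is `1 + h` with `h` a combination of dual elements, repeated with period `2 * m`;
the bound `hs` makes it positive. The limit expectation of the γ-average of a basis element is its
pairing with `h`, divided by `2 * m`: the dual elements pick out `s b`, and their adjoints, which
make `h` self-adjoint, contribute the conjugates. -/
theorem eval_perturbed_eq_zero {P : IrrPoly κ} (hP : leadClass (leadPoly P) = 0) {m : ℕ}
    [NeZero m] (hm : ∀ b ∈ P.vars, 2 * b.degree ≤ m) (s : IrrIndex κ → ℂ)
    (hs : ∑ b ∈ P.vars, ‖s b • b.dual + star (s b) • star b.dual‖ ≤ 1) :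
    MvPolynomial.eval (fun b => ((2 * m : ℕ) : ℂ)⁻¹ * (s b + ∑ b' ∈ P.vars, star (s b') *
      ntr (place m 0 b.elt * place m 0 (star b'.dual)))) P = 0 := by
  classical
  have hm0 : 0 < m := Nat.pos_of_neZero m
  let w : ∀ b : IrrIndex κ, TensorPow κ b.degree := fun b => s b • b.dual + star (s b) • star b.dual
  have hw : ∀ b, w b ∈ irrSubmodule κ b.order := fun b =>
    add_mem (Submodule.smul_mem _ _ b.dual_mem)
      (Submodule.smul_mem _ _ (star_mem_irrSubmodule b.dual_mem))
  let h : TensorPow κ m := ∑ b ∈ P.vars, place m 0 (w b)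
  have hstar : star h = h := by
    rw [star_sum]
    refine Finset.sum_congr rfl fun b _ => ?_
    rw [← place_star]
    congr 1
    simp only [w, star_add, star_smul, star_star]
    exact add_comm _ _
  have hle : ∀ b ∈ P.vars, b.degree ≤ m := fun b hb => by have := hm b hb; omega
  have hnorm : ‖h‖ ≤ 1 :=
    (norm_sum_le_of_le _ fun b hb => norm_place_le (hle b hb) 0 (w b)).trans hs
  obtain ⟨c, hc⟩ := exists_one_add_eq_star_mul hstar hnorm
  have hntr : ntr h = 0 := by
    rw [map_sum]
    exact Finset.sum_eq_zero fun b hb => by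
      rw [ntr_place (hle b hb), ntr_eq_zero_of_mem_irr (hw b)]
  have hρ : ntr (1 + h) = 1 := by rw [map_add, ntr_one, hntr, add_zero]
  have hω := isDispersionFree_blockState (L := 2 * m) (by omega) (by omega) hρ hc
  refine hω.eval_eq_zero hP fun b hb => ?_
  have hval : ntr (place m 0 b.elt * (1 + h)) = s b + ∑ b' ∈ P.vars, star (s b') *
      ntr (place m 0 b.elt * place m 0 (star b'.dual)) := by
    rw [mul_add, mul_one, map_add, ntr_place (hle b hb), ntr_eq_zero_of_mem_irr b.elt_mem, zero_add,
      Finset.mul_sum, map_sum]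
    have h1 : ∀ b' ∈ P.vars, ntr (place m 0 b.elt * place m 0 (w b')) =
        (if b = b' then s b' else 0) + star (s b') *
          ntr (place m 0 b.elt * place m 0 (star b'.dual)) := fun b' hb' => by
      simp only [w]
      rw [map_add, map_smul, map_smul, mul_add, mul_smul_comm, mul_smul_comm, map_add, map_smul,
        map_smul, ntr_place_elt_mul_place_dual (by have := hm b hb; have := hm b' hb'; omega)]
      simp
    rw [Finset.sum_congr rfl h1, Finset.sum_add_distrib, Finset.sum_ite_eq, if_pos hb]
  rw [← hval]
  refine ((tendsto_natDiv_div (2 * m)).mul_const _).congr' ?_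
  filter_upwards [eventually_le_pnat (2 * m)] with N hN
  refine (blockState_gammaBar_irr hm0 le_rfl hρ (hle b hb) b.elt_mem (fun p q hpq => ?_)
    (by omega)).symm
  have h2 : ∀ b' ∈ P.vars, place N q (place m 0 (w b')) = place N q (w b') := fun b' hb' => by
    have := place_place (N := N) (K := m) (j := 0) (M := b'.degree)
      (by have := hle b' hb'; omega) (by omega) q (w b')
    rwa [Nat.cast_zero, Nat.cast_zero, add_zero] at this
  rw [map_add, place_one, mul_add, mul_one, map_add,
    ntr_place ((hle b hb).trans (by omega)), ntr_eq_zero_of_mem_irr b.elt_mem, zero_add, map_sum,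
    Finset.mul_sum, map_sum]
  refine Finset.sum_eq_zero fun b' hb' => ?_
  rw [h2 b' hb']
  have h3 := hm b hb
  have h4 := hm b' hb'
  exact ntr_place_mul_place_eq_zero (by simp only [IrrIndex.degree] at h3 h4; omega) b.elt_mem
    (hw b') fun h => absurd h hpq

/-- The available points involve the small parameters `s b` together with their conjugates. In real
and imaginary parts the vanishing holds on a real box, hence identically, also for complex values of
these parts. There the combination standing for the conjugate can be made zero independently of the
one standing for `s b`, and the variables of `P` become free. -/
theorem leadClass_leadPoly_injective {P : IrrPoly κ} (hP : leadClass (leadPoly P) = 0) :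
    P = 0 := by
  classical
  -- Room for two windows belonging to any variables of `P`; the `+ 1` keeps `m` positive when there
  -- are no variables.
  let m : ℕ := 2 * ∑ b ∈ P.vars, b.degree + 1
  have : NeZero m := ⟨Nat.succ_ne_zero _⟩
  have hm : ∀ b ∈ P.vars, 2 * b.degree ≤ m := fun b hb => by
    have := Finset.single_le_sum (f := IrrIndex.degree) (fun _ _ => Nat.zero_le _) hb
    simp only [m]
    omega
  -- Parts bounded by `r` give `|s b| ≤ 2 r`, and each self-adjoint summand has norm at most `4 r
  -- ‖b.dual‖`; so `r = 1 / (D + 1)` keeps the perturbation below norm `1`.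
  let D : ℝ := ∑ b ∈ P.vars, 4 * ‖b.dual‖
  have hD : 0 ≤ D := Finset.sum_nonneg fun b _ => by positivity
  let r : ℝ := (D + 1)⁻¹
  have hr : 0 < r := by positivity
  let K : IrrIndex κ → IrrIndex κ → ℂ := fun b b' =>
    ntr (place m 0 b.elt * place m 0 (star b'.dual))
  -- `Sum.inl b` and `Sum.inr b` stand for the real part `x` and the imaginary part `y` of `s b`,
  -- with `x - i y` in place of the conjugate.
  let Y : IrrIndex κ → MvPolynomial (IrrIndex κ ⊕ IrrIndex κ) ℂ := fun b =>
    MvPolynomial.C ((2 * m : ℕ) : ℂ)⁻¹ * (MvPolynomial.X (Sum.inl b) +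
      MvPolynomial.C Complex.I * MvPolynomial.X (Sum.inr b) + ∑ b' ∈ P.vars,
        (MvPolynomial.X (Sum.inl b') - MvPolynomial.C Complex.I * MvPolynomial.X (Sum.inr b')) *
          MvPolynomial.C (K b b'))
  let Q : MvPolynomial (IrrIndex κ ⊕ IrrIndex κ) ℂ := MvPolynomial.bind₁ Y P
  have hQ : ∀ x, MvPolynomial.eval x Q = MvPolynomial.eval (fun b => ((2 * m : ℕ) : ℂ)⁻¹ *
      ((x (Sum.inl b) + Complex.I * x (Sum.inr b)) + ∑ b' ∈ P.vars,
        (x (Sum.inl b') - Complex.I * x (Sum.inr b')) * K b b')) P := fun x => by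
    have h1 : MvPolynomial.eval x Q =
        MvPolynomial.eval (fun b => MvPolynomial.eval x (Y b)) P := by
      simp only [Q, MvPolynomial.eval, MvPolynomial.eval₂Hom_bind₁]
    rw [h1]
    congr 2
    funext b
    simp [Y]
  have hQ0 : Q = 0 := by
    refine MvPolynomial.funext_set (fun _ => (fun t : ℝ => (t : ℂ)) '' Set.Icc (-r) r) (fun _ => ?_)
      fun x hx => ?_
    · exact (Set.Icc_infinite (by linarith)).image Complex.ofReal_injective.injOn
    · choose y hy using fun i => hx i (Set.mem_univ i)
      have hy1 : ∀ i, |y i| ≤ r := fun i => abs_le.2 (hy i).1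
      obtain rfl : x = fun i => (y i : ℂ) := funext fun i => (hy i).2.symm
      rw [hQ, map_zero]
      have h2 := eval_perturbed_eq_zero hP hm
        (fun b => (y (Sum.inl b) : ℂ) + Complex.I * (y (Sum.inr b) : ℂ)) ?_
      · convert h2 using 9 with b b' hb'
        simp [sub_eq_add_neg]
      · have h3 : ∀ b, ‖(y (Sum.inl b) : ℂ) + Complex.I * (y (Sum.inr b) : ℂ)‖ ≤ 2 * r := fun b => by
          refine (norm_add_le _ _).trans ?_
          rw [norm_mul, Complex.norm_I, one_mul, Complex.norm_real, Complex.norm_real]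
          have := hy1 (Sum.inl b)
          have := hy1 (Sum.inr b)
          simp only [Real.norm_eq_abs]
          linarith
        have h4 : ∀ b ∈ P.vars, ‖((y (Sum.inl b) : ℂ) + Complex.I * (y (Sum.inr b) : ℂ)) • b.dual +
            star ((y (Sum.inl b) : ℂ) + Complex.I * (y (Sum.inr b) : ℂ)) • star b.dual‖ ≤
            r * (4 * ‖b.dual‖) := fun b _ => by
          refine (norm_add_le _ _).trans ?_
          rw [norm_smul, norm_smul, norm_star, norm_star]
          have := mul_le_mul_of_nonneg_right (h3 b) (norm_nonneg b.dual)
          linarith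
        refine (Finset.sum_le_sum h4).trans ?_
        rw [← Finset.mul_sum]
        change (D + 1)⁻¹ * D ≤ 1
        rw [inv_mul_le_iff₀ (by linarith)]
        linarith
  refine MvPolynomial.funext fun t => ?_
  -- With `x = m t` and `y = -i m t` one has `x - i y = 0` and `x + i y = 2 m t`, so the factor `1 /
  -- (2 m)` leaves exactly `t`.
  have h5 := hQ (Sum.elim (fun b => (m : ℂ) * t b) fun b => -Complex.I * (m * t b))
  have hm0 : (m : ℂ) ≠ 0 := Nat.cast_ne_zero.2 (NeZero.ne m)
  rw [hQ0, map_zero] at h5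
  rw [map_zero, h5]
  congr 2
  funext b
  have hI : ∀ z : ℂ, Complex.I * (-Complex.I * z) = z := fun z => by
    rw [← mul_assoc, mul_neg, Complex.I_mul_I, neg_neg, one_mul]
  simp only [Sum.elim_inl, Sum.elim_inr, hI, sub_self, zero_mul, Finset.sum_const_zero, add_zero]
  push_cast
  field_simp
  ring

end Injective

end SpinChain

end

noncomputable section

namespace SpinChain

open scoped Fin.CommRing

variable {κ : ℕ}

/-! ### Periodic product states built from a vector state -/

theorem sum_range_mul {E : Type*} [AddCommMonoid E] (f : ℕ → E) (n L : ℕ) :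
    ∑ p ∈ Finset.range (n * L), f p =
      ∑ k ∈ Finset.range n, ∑ j ∈ Finset.range L, f (k * L + j) := by
  induction n with
  | zero => simp
  | succ n ih => rw [Nat.add_mul, one_mul, Finset.sum_range_add, ih, Finset.sum_range_succ]

section Estimate

variable [NeZero κ] {L : ℕ} [NeZero L] {ρ : TensorPow κ L}

/-- A window within a complete block has the same expectation as on the chain of length `L`. At most
`M` of the `L` starting points in a block give windows crossing its end, which accounts for the
first term; the second comes from the incomplete last block and from replacing `n / N` by `1 / L`.
-/
theorem norm_blockState_gammaBar_sub_le (hρ : ntr ρ = 1) {c : TensorPow κ L} (hc : ρ = star c * c)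
    {N : ℕ} [NeZero N] {M : ℕ} (hML : M ≤ L) (hLN : L ≤ N) (a : TensorPow κ M) :
    ‖blockState L ρ N (gammaBar a N) - ntr (gammaBar a L * ρ)‖ ≤
      2 * M * ‖a‖ / L + 2 * L * ‖a‖ / N := by
  have hL0 : (0 : ℝ) < L := Nat.cast_pos.2 (Nat.pos_of_neZero L)
  have hN0 : (0 : ℝ) < N := Nat.cast_pos.2 (Nat.pos_of_neZero N)
  have hω : IsCSState (blockState L ρ N) := isCSState_blockState le_rfl hρ hc
  let φ : TensorPow κ L →ₗ[ℂ] ℂ := ntr ∘ₗ LinearMap.mulRight ℂ ρ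
  have hφ : IsCSState φ := isCSState_of_density c (by rw [← hc, hρ]) fun x => by rw [← hc]; rfl
  let F : ℕ → ℂ := fun p => blockState L ρ N (place N (p : Fin N) a)
  let G : ℕ → ℂ := fun j => φ (place L (j : Fin L) a)
  have hF : ∀ p, ‖F p‖ ≤ ‖a‖ := fun p =>
    (hω.norm_map_le _).trans (norm_place_le (hML.trans hLN) _ a)
  have hG : ∀ j, ‖G j‖ ≤ ‖a‖ := fun j => (hφ.norm_map_le _).trans (norm_place_le hML _ a)
  have hsumF : blockState L ρ N (gammaBar a N) = (N : ℂ)⁻¹ * ∑ p ∈ Finset.range N, F p := by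
    rw [gammaBar_eq (hML.trans hLN), map_smul, map_sum, smul_eq_mul]
    congr 1
    rw [← sum_range_eq_sum_fin fun p : Fin N => blockState L ρ N (place N p a)]
  have hsumG : ntr (gammaBar a L * ρ) = (L : ℂ)⁻¹ * ∑ j ∈ Finset.range L, G j := by
    change φ (gammaBar a L) = _
    rw [gammaBar_eq hML, map_smul, map_sum, smul_eq_mul]
    congr 1
    rw [← sum_range_eq_sum_fin fun p : Fin L => φ (place L p a)]
  set n := N / L with hn
  have hnL : n * L ≤ N := Nat.div_mul_le_self N L
  obtain ⟨r, hr⟩ : ∃ r, N = n * L + r := ⟨N - n * L, by omega⟩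
  have hrL : r < L := by
    have := Nat.lt_div_mul_add (a := N) (Nat.pos_of_neZero L)
    rw [← hn] at this
    omega
  have hFG : ∀ k < n, ∀ j < L, ‖F (k * L + j) - G j‖ ≤
      if L < j + M then 2 * ‖a‖ else 0 := fun k hk j hj => by
    split_ifs with h
    · exact (norm_sub_le _ _).trans (by linarith [hF (k * L + j), hG j])
    · have h1 : F (k * L + j) = G j := by
        have h2 := blockState_place_block (N := N) (ρ := ρ) le_rfl hρ hk (by omega : j + M ≤ L) a
        have h3 := place_place (N := N) (K := L) (by omega : j + M ≤ L) hLN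
          ((k * L : ℕ) : Fin N) a
        simp only [F, G]
        rw [h2]
        change _ = ntr (place L (j : Fin L) a * ρ)
        rw [Nat.cast_add, ← h3, ← place_mul hLN, ntr_place hLN]
      rw [h1, sub_self, norm_zero]
  have hbd : ∑ j ∈ Finset.range L, (if L < j + M then 2 * ‖a‖ else 0) ≤ M * (2 * ‖a‖) := by
    rw [← Finset.sum_filter, Finset.sum_const, nsmul_eq_mul]
    refine mul_le_mul_of_nonneg_right ?_ (by positivity)
    have h1 : (Finset.range L).filter (fun j => L < j + M) ⊆ Finset.Ico (L - M) L := fun j hj => by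
      rw [Finset.mem_filter, Finset.mem_range] at hj
      rw [Finset.mem_Ico]
      omega
    have h2 := Finset.card_le_card h1
    rw [Nat.card_Ico] at h2
    exact_mod_cast h2.trans (by omega)
  have hdiff : ‖∑ p ∈ Finset.range N, F p - (n : ℂ) * ∑ j ∈ Finset.range L, G j‖ ≤
      n * (M * (2 * ‖a‖)) + L * ‖a‖ := by
    have h1 : ∑ p ∈ Finset.range N, F p - (n : ℂ) * ∑ j ∈ Finset.range L, G j =
        (∑ k ∈ Finset.range n, ∑ j ∈ Finset.range L, (F (k * L + j) - G j)) +
          ∑ i ∈ Finset.range r, F (n * L + i) := by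
      conv_lhs => rw [hr]
      rw [Finset.sum_range_add, sum_range_mul]
      simp only [Finset.sum_sub_distrib, Finset.sum_const, Finset.card_range, nsmul_eq_mul]
      ring
    rw [h1]
    refine (norm_add_le _ _).trans (add_le_add ?_ ?_)
    · refine (norm_sum_le_of_le _ fun k hk => (norm_sum_le_of_le _ fun j hj =>
        hFG k (Finset.mem_range.1 hk) j (Finset.mem_range.1 hj)).trans hbd).trans ?_
      simp
    · refine (norm_sum_le_of_le _ fun i _ => hF _).trans ?_
      rw [Finset.sum_const, Finset.card_range, nsmul_eq_mul]
      exact mul_le_mul_of_nonneg_right (by exact_mod_cast hrL.le) (norm_nonneg a)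
  have hsumG' : ‖∑ j ∈ Finset.range L, G j‖ ≤ L * ‖a‖ := by
    refine (norm_sum_le_of_le _ fun j _ => hG j).trans ?_
    simp
  have hNL : (N : ℂ) = n * L + r := by exact_mod_cast congrArg (Nat.cast (R := ℂ)) hr
  have hN0' : (N : ℂ) ≠ 0 := Nat.cast_ne_zero.2 (NeZero.ne N)
  have hL0' : (L : ℂ) ≠ 0 := Nat.cast_ne_zero.2 (NeZero.ne L)
  have hsplit : blockState L ρ N (gammaBar a N) - ntr (gammaBar a L * ρ) =
      (N : ℂ)⁻¹ * (∑ p ∈ Finset.range N, F p - (n : ℂ) * ∑ j ∈ Finset.range L, G j) -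
        (N : ℂ)⁻¹ * ((r : ℂ) * (L : ℂ)⁻¹ * ∑ j ∈ Finset.range L, G j) := by
    rw [hsumF, hsumG, mul_sub, sub_sub]
    congr 1
    have : (L : ℂ)⁻¹ = (N : ℂ)⁻¹ * n + (N : ℂ)⁻¹ * (r * (L : ℂ)⁻¹) := by
      field_simp
      rw [hNL]
      ring
    conv_lhs => rw [this]
    ring
  rw [hsplit]
  refine (norm_sub_le _ _).trans ?_
  have h1 : ‖(N : ℂ)⁻¹ * (∑ p ∈ Finset.range N, F p - (n : ℂ) * ∑ j ∈ Finset.range L, G j)‖ ≤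
      (N : ℝ)⁻¹ * (n * (M * (2 * ‖a‖)) + L * ‖a‖) := by
    rw [norm_mul, norm_inv, Complex.norm_natCast]
    gcongr
  have h2 : ‖(N : ℂ)⁻¹ * ((r : ℂ) * (L : ℂ)⁻¹ * ∑ j ∈ Finset.range L, G j)‖ ≤
      (N : ℝ)⁻¹ * (L * ‖a‖) := by
    rw [norm_mul, norm_mul, norm_mul, norm_inv, norm_inv, Complex.norm_natCast,
      Complex.norm_natCast, Complex.norm_natCast]
    have h3 : (r : ℝ) ≤ L := by exact_mod_cast hrL.le
    refine mul_le_mul_of_nonneg_left ?_ (by positivity)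
    calc (r : ℝ) * (L : ℝ)⁻¹ * ‖∑ j ∈ Finset.range L, G j‖ ≤ L * (L : ℝ)⁻¹ * (L * ‖a‖) := by
          gcongr
      _ = L * ‖a‖ := by field_simp
  have h4 : (n : ℝ) * L ≤ N := by exact_mod_cast hnL
  have h5 : (N : ℝ)⁻¹ * (n * (M * (2 * ‖a‖))) ≤ 2 * M * ‖a‖ / L := by
    rw [le_div_iff₀ hL0]
    have h6 : (N : ℝ)⁻¹ * (n * L) ≤ 1 := by rw [inv_mul_le_iff₀ hN0]; linarith
    calc (N : ℝ)⁻¹ * (n * (M * (2 * ‖a‖))) * L = (N : ℝ)⁻¹ * (n * L) * (2 * M * ‖a‖) := by ring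
      _ ≤ 1 * (2 * M * ‖a‖) := by gcongr
      _ = _ := one_mul _
  calc _ ≤ (N : ℝ)⁻¹ * (n * (M * (2 * ‖a‖)) + L * ‖a‖) + (N : ℝ)⁻¹ * (L * ‖a‖) := add_le_add h1 h2
    _ = (N : ℝ)⁻¹ * (n * (M * (2 * ‖a‖))) + 2 * L * ‖a‖ / N := by ring
    _ ≤ _ := by gcongr

end Estimate

/-- The density is the projection onto `v`, scaled by the dimension to compensate for the
normalization of the trace. -/
theorem exists_density_of_vector [NeZero κ] {n : ℕ} (v : EuclideanSpace ℂ (Fin n → Fin κ))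
    (hv : ‖v‖ = 1) : ∃ ρ c : TensorPow κ n, ρ = star c * c ∧ ntr ρ = 1 ∧
      ∀ y : TensorPow κ n,
        ntr (y * ρ) = inner ℂ v (Matrix.toEuclideanCLM (n := Fin n → Fin κ) (𝕜 := ℂ) y v) := by
  have hκ : (κ : ℂ) ^ Fintype.card (Fin n) ≠ 0 :=
    pow_ne_zero _ (Nat.cast_ne_zero.2 (NeZero.ne κ))
  let p : TensorPow κ n := Matrix.vecMulVec v.ofLp (star v.ofLp)
  have hvv : star v.ofLp ⬝ᵥ v.ofLp = 1 := by
    have h := inner_self_eq_norm_sq_to_K (𝕜 := ℂ) v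
    rw [hv, EuclideanSpace.inner_eq_star_dotProduct, dotProduct_comm] at h
    simpa using h
  have hstar : star p = p := by
    rw [Matrix.star_eq_conjTranspose, Matrix.conjTranspose_vecMulVec, star_star]
  have hpp : p * p = p := by
    rw [Matrix.vecMulVec_mul_vecMulVec, hvv, one_smul]
  let q : ℝ := √((κ : ℝ) ^ Fintype.card (Fin n))
  have hq : (q : ℂ) * q = (κ : ℂ) ^ Fintype.card (Fin n) := by
    rw [← Complex.ofReal_mul, Real.mul_self_sqrt (by positivity)]
    push_cast
    rfl
  have htr : ∀ y : TensorPow κ n, ntr (y * ((κ : ℂ) ^ Fintype.card (Fin n) • p)) =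
      inner ℂ v (Matrix.toEuclideanCLM (n := Fin n → Fin κ) (𝕜 := ℂ) y v) := fun y => by
    rw [mul_smul_comm, map_smul, ntr_apply, smul_eq_mul, ← mul_assoc, mul_inv_cancel₀ hκ, one_mul,
      Matrix.mul_vecMulVec, Matrix.trace_vecMulVec, EuclideanSpace.inner_eq_star_dotProduct]
    rfl
  refine ⟨(κ : ℂ) ^ Fintype.card (Fin n) • p, (q : ℂ) • p, ?_, ?_, htr⟩
  · rw [star_smul, hstar, smul_mul_smul_comm, hpp, ← hq]
    congr 1
    simp
  · have := htr 1
    rw [one_mul, map_one, one_apply_eq_self, inner_self_eq_norm_sq_to_K, hv] at this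
    simpa using this

end SpinChain

end

noncomputable section

/-! ### Characters of the classical algebra and approximating vector states -/

/-- In a commutative C⋆-algebra the norm of every element is attained at a character. -/
theorem exists_starAlgHom_norm_eq {A : Type*} [CStarAlgebra A] [Nontrivial A]
    (hcomm : ∀ a b : A, a * b = b * a) (x : A) : ∃ χ : A →⋆ₐ[ℂ] ℂ, ‖χ x‖ = ‖x‖ := by
  let : CommCStarAlgebra A := { (inferInstance : CStarAlgebra A) with mul_comm := hcomm }
  obtain ⟨χ, -, hχ⟩ := isCompact_univ.exists_isMaxOn
    (Set.univ_nonempty (α := WeakDual.characterSpace ℂ A))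
    (f := fun χ => ‖WeakDual.gelfandTransform ℂ A x χ‖) (by fun_prop)
  have hn : ‖WeakDual.gelfandTransform ℂ A x‖ = ‖x‖ :=
    (gelfandTransform_isometry A).norm_map_of_map_zero (map_zero _) x
  refine ⟨{ toAlgHom := WeakDual.CharacterSpace.toAlgHom χ, map_star' := fun a => map_star χ a },
    ?_⟩
  change ‖WeakDual.gelfandTransform ℂ A x χ‖ = ‖x‖
  rw [← hn]
  exact le_antisymm (ContinuousMap.norm_coe_le_norm _ _)
    ((ContinuousMap.norm_le _ (norm_nonneg _)).2 fun y => hχ (Set.mem_univ y))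

namespace Matrix

/-- A matrix that is bounded below is invertible, with a corresponding bound for the inverse. -/
theorem exists_inverse_of_bounded_below {n : Type*} [Fintype n] [DecidableEq n]
    {A : Matrix n n ℂ} {δ : ℝ} (hδ : 0 < δ)
    (h : ∀ v, δ * ‖v‖ ≤ ‖toEuclideanCLM (𝕜 := ℂ) A v‖) :
    ∃ B : Matrix n n ℂ, A * B = 1 ∧ B * A = 1 ∧ ‖B‖ ≤ δ⁻¹ := by
  have hA : IsUnit A := by
    refine mulVec_injective_iff_isUnit.1 ?_
    refine (injective_iff_map_eq_zero (mulVecLin A)).2 fun v hv => ?_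
    have h1 := h (WithLp.toLp 2 v)
    have h2 : toEuclideanCLM (𝕜 := ℂ) A (WithLp.toLp 2 v) = 0 := by
      rw [toEuclideanCLM_toLp]
      exact congrArg (WithLp.toLp 2) hv
    rw [h2, norm_zero] at h1
    have h3 : ‖WithLp.toLp 2 v‖ = 0 := by
      have := norm_nonneg (WithLp.toLp 2 v)
      nlinarith
    exact congrArg WithLp.ofLp (norm_eq_zero.1 h3)
  obtain ⟨u, rfl⟩ := hA
  refine ⟨↑u⁻¹, u.mul_inv, u.inv_mul, ?_⟩
  refine ContinuousLinearMap.opNorm_le_bound _ (inv_nonneg.2 hδ.le) fun v => ?_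
  have h1 := h (toEuclideanCLM (𝕜 := ℂ) (↑u⁻¹ : Matrix n n ℂ) v)
  rw [← mul_apply_eq_comp, ← map_mul, u.mul_inv, map_one,
    one_apply_eq_self] at h1
  rw [inv_mul_eq_div, le_div_iff₀' hδ]
  exact h1

end Matrix

namespace SpinChain

set_option linter.unusedSectionVars false

variable {κ : ℕ} [NeZero κ]

/-- Finite matrices that are bounded below are invertible, and the uniform bound `δ⁻¹` makes the
inverses a bounded sequence; the finitely many exceptional entries are set to zero. -/
theorem isUnit_mk_of_bounded_below {f : BddSeq κ} {δ : ℝ} (hδ : 0 < δ)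
    (h : ∀ᶠ N in atTop, ∀ v, δ * ‖v‖ ≤ ‖Matrix.toEuclideanCLM (𝕜 := ℂ) (f N) v‖) :
    IsUnit (AsympAlg.mk f) := by
  classical
  choose! g hg using fun N (hN : ∀ v, δ * ‖v‖ ≤ ‖Matrix.toEuclideanCLM (𝕜 := ℂ) (f N) v‖) =>
    Matrix.exists_inverse_of_bounded_below hδ hN
  let G : BddSeq κ := ⟨fun N => if ∀ v, δ * ‖v‖ ≤ ‖Matrix.toEuclideanCLM (𝕜 := ℂ) (f N) v‖
    then g N else 0, memℓp_infty ⟨δ⁻¹, by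
      rintro _ ⟨N, rfl⟩
      dsimp only
      split_ifs with hN
      · exact (hg N hN).2.2
      · simpa using hδ.le⟩⟩
  have hG : ∀ N, (∀ v, δ * ‖v‖ ≤ ‖Matrix.toEuclideanCLM (𝕜 := ℂ) (f N) v‖) → G N = g N :=
    fun N hN => if_pos hN
  have h1 : AsympAlg.mk f * AsympAlg.mk G = 1 := by
    rw [← map_mul, ← map_one AsympAlg.mk]
    refine AsympAlg.mk_eq_mk.2 (tendsto_const_nhds.congr' ?_)
    filter_upwards [h] with N hN
    have : (f * G) N - (1 : BddSeq κ) N = 0 := by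
      change f N * G N - 1 = 0
      rw [hG N hN, (hg N hN).1, sub_self]
    rw [this, norm_zero]
  have h2 : AsympAlg.mk G * AsympAlg.mk f = 1 := by
    rw [← map_mul, ← map_one AsympAlg.mk]
    refine AsympAlg.mk_eq_mk.2 (tendsto_const_nhds.congr' ?_)
    filter_upwards [h] with N hN
    have : (G * f) N - (1 : BddSeq κ) N = 0 := by
      change G N * f N - 1 = 0
      rw [hG N hN, (hg N hN).2.1, sub_self]
    rw [this, norm_zero]
  exact ⟨⟨_, _, h1, h2⟩, rfl⟩

/-- A non-invertible class has approximate null vectors along every tail. -/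
theorem exists_norm_toEuclideanCLM_lt {f : BddSeq κ} (hf : ¬ IsUnit (AsympAlg.mk f)) {δ : ℝ}
    (hδ : 0 < δ) (K : ℕ+) : ∃ L, K ≤ L ∧ ∃ v : EuclideanSpace ℂ (Fin L → Fin κ), ‖v‖ = 1 ∧
      ‖Matrix.toEuclideanCLM (𝕜 := ℂ) (f L) v‖ < δ := by
  by_contra! hcon
  refine hf (isUnit_mk_of_bounded_below hδ ?_)
  filter_upwards [eventually_ge_atTop K] with L hL v
  rcases eq_or_ne v 0 with rfl | hv
  · simp
  have hv' : ‖v‖ ≠ 0 := norm_ne_zero_iff.2 hv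
  have h1 := hcon L hL ((‖v‖⁻¹ : ℂ) • v) (by
    rw [norm_smul, norm_inv, Complex.norm_real, norm_norm, inv_mul_cancel₀ hv'])
  rw [map_smul, norm_smul, norm_inv, Complex.norm_real, norm_norm] at h1
  rw [inv_mul_eq_div, le_div_iff₀ (norm_pos_iff.2 hv)] at h1
  exact h1

instance : Nontrivial (ClassAlg κ) := by
  refine ⟨⟨1, 0, fun h => ?_⟩⟩
  rw [← map_one (localClass (κ := κ)), ← map_zero (localClass (κ := κ)), localClass_eq_iff] at h
  have h1 : ∀ N : ℕ+, ‖((1 : LocalAlg κ).1 N) - (0 : LocalAlg κ).1 N‖ = 1 := fun N => by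
    change ‖(1 : TensorPow κ N) - 0‖ = 1
    rw [sub_zero, CStarRing.norm_one]
  simp only [h1] at h
  exact one_ne_zero (tendsto_nhds_unique tendsto_const_nhds h)

instance : Nontrivial (Binf κ) :=
  ⟨⟨1, 0, fun h => one_ne_zero (α := ClassAlg κ) (congrArg Subtype.val h)⟩⟩

theorem gammaClassAlg_mul_comm {x y : ClassAlg κ} (hx : x ∈ GammaClassAlg κ)
    (hy : y ∈ GammaClassAlg κ) : x * y = y * x := by
  obtain ⟨f, rfl⟩ := mem_gammaClassAlg_iff.1 hx
  obtain ⟨g, rfl⟩ := mem_gammaClassAlg_iff.1 hy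
  rw [← leadClass_lead, ← leadClass_lead, ← map_mul, mul_comm, map_mul]

theorem binf_mul_comm (x y : Binf κ) : x * y = y * x :=
  ((GammaClassAlg κ).commRingTopologicalClosure fun x y =>
    Subtype.ext (gammaClassAlg_mul_comm x.2 y.2)).mul_comm x y

theorem localClass_mem_binf (f : LocalAlg κ) : localClass f ∈ Binf κ :=
  (GammaClassAlg κ).le_topologicalClosure (localClass_mem f)

/-- `localClass` with values in `[B]^∞_γ`. -/
def localBinf : LocalAlg κ →⋆ₐ[ℂ] Binf κ :=
  localClass.codRestrict (Binf κ) localClass_mem_binf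

theorem coe_localBinf (f : LocalAlg κ) : (localBinf f : ClassAlg κ) = localClass f := rfl

theorem norm_inner_sub_le {n : ℕ} (a : TensorPow κ n) (c : ℂ)
    {v : EuclideanSpace ℂ (Fin n → Fin κ)} (hv : ‖v‖ = 1) :
    ‖inner ℂ v (Matrix.toEuclideanCLM (𝕜 := ℂ) a v) - c‖ ≤
      ‖Matrix.toEuclideanCLM (𝕜 := ℂ) (a - algebraMap ℂ _ c) v‖ := by
  have h1 : inner ℂ v (Matrix.toEuclideanCLM (𝕜 := ℂ) a v) - c =
      inner ℂ v (Matrix.toEuclideanCLM (𝕜 := ℂ) (a - algebraMap ℂ _ c) v) := by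
    rw [map_sub, AlgHomClass.commutes, sub_apply, inner_sub_right,
      Algebra.algebraMap_eq_smul_one, smul_apply,
      one_apply_eq_self, inner_smul_right, inner_self_eq_norm_sq_to_K, hv]
    simp
  rw [h1]
  refine (norm_inner_le_norm _ _).trans ?_
  rw [hv, one_mul]

theorem norm_sq_le_of_sum {n : ℕ} {ι : Type*} (I : Finset ι) (a : ι → TensorPow κ n)
    {v : EuclideanSpace ℂ (Fin n → Fin κ)} (hv : ‖v‖ = 1) {i : ι} (hi : i ∈ I) :
    ‖Matrix.toEuclideanCLM (𝕜 := ℂ) (a i) v‖ ^ 2 ≤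
      ‖Matrix.toEuclideanCLM (𝕜 := ℂ) (∑ i ∈ I, star (a i) * a i) v‖ := by
  have h1 : ∀ j, inner ℂ v (Matrix.toEuclideanCLM (𝕜 := ℂ) (star (a j) * a j) v) =
      ((‖Matrix.toEuclideanCLM (𝕜 := ℂ) (a j) v‖ ^ 2 : ℝ) : ℂ) := fun j => by
    rw [map_mul, map_star, mul_apply_eq_comp, ContinuousLinearMap.star_eq_adjoint,
      ContinuousLinearMap.adjoint_inner_right, inner_self_eq_norm_sq_to_K]
    norm_cast
  have h2 : inner ℂ v (Matrix.toEuclideanCLM (𝕜 := ℂ) (∑ i ∈ I, star (a i) * a i) v) =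
      ((∑ j ∈ I, ‖Matrix.toEuclideanCLM (𝕜 := ℂ) (a j) v‖ ^ 2 : ℝ) : ℂ) := by
    rw [map_sum, sum_apply, inner_sum, Complex.ofReal_sum]
    exact Finset.sum_congr rfl fun j _ => h1 j
  calc ‖Matrix.toEuclideanCLM (𝕜 := ℂ) (a i) v‖ ^ 2
      ≤ ∑ j ∈ I, ‖Matrix.toEuclideanCLM (𝕜 := ℂ) (a j) v‖ ^ 2 :=
        Finset.single_le_sum (f := fun j => ‖Matrix.toEuclideanCLM (𝕜 := ℂ) (a j) v‖ ^ 2)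
          (fun j _ => sq_nonneg _) hi
    _ = ‖inner ℂ v (Matrix.toEuclideanCLM (𝕜 := ℂ) (∑ i ∈ I, star (a i) * a i) v)‖ := by
        rw [h2, Complex.norm_real, Real.norm_of_nonneg (Finset.sum_nonneg fun j _ => sq_nonneg _)]
    _ ≤ _ := (norm_inner_le_norm _ _).trans (by rw [hv, one_mul])

/-- Every character of `[B]^∞_γ` is approximated on finitely many `γ`-sequences by vector states. -/
theorem exists_vector_of_character (χ : Binf κ →⋆ₐ[ℂ] ℂ) {ι : Type*} (I : Finset ι)
    (f : ι → LocalAlg κ) {η : ℝ} (hη : 0 < η) (K : ℕ+) :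
    ∃ L, K ≤ L ∧ ∃ v : EuclideanSpace ℂ (Fin L → Fin κ), ‖v‖ = 1 ∧
      ∀ i ∈ I, ‖inner ℂ v (Matrix.toEuclideanCLM (𝕜 := ℂ) ((f i).1 L) v) -
        χ (localBinf (f i))‖ < η := by
  -- Centre the sequences at their values under `χ`. The positive sum `z` of the `star (g i) * g i`
  -- is annihilated by `χ`, hence not invertible, and an approximate null vector of `z` is one for
  -- every `g i`.
  let g : ι → LocalAlg κ := fun i => f i - algebraMap ℂ _ (χ (localBinf (f i)))
  have hg : ∀ i, χ (localBinf (g i)) = 0 := fun i => by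
    simp only [g, map_sub, AlgHomClass.commutes]
    exact sub_self _
  let z : LocalAlg κ := ∑ i ∈ I, star (g i) * g i
  have hz : χ (localBinf z) = 0 := by
    simp only [z, map_sum, map_mul, hg, mul_zero, Finset.sum_const_zero]
  have hz' : ¬ IsUnit (localClass z) := fun h => by
    -- Spectral permanence: invertibility in the full quotient and in the closed ⋆-subalgebra agree.
    rw [← coe_localBinf, StarSubalgebra.coe_isUnit] at h
    exact (h.map χ).ne_zero hz
  rw [localClass_apply] at hz'
  obtain ⟨L, hL, v, hv, hlt⟩ := exists_norm_toEuclideanCLM_lt hz' (pow_pos hη 2) K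
  refine ⟨L, hL, v, hv, fun i hi => ?_⟩
  refine (norm_inner_sub_le _ _ hv).trans_lt (lt_of_pow_lt_pow_left₀ 2 hη.le ?_)
  have h1 : (z.1 L) = ∑ i ∈ I, star ((g i).1 L) * (g i).1 L := by
    simp only [z, AddSubmonoidClass.coe_finsetSum, Finset.sum_apply]
    rfl
  refine (norm_sq_le_of_sum I (fun i => (g i).1 L) hv hi).trans_lt ?_
  rw [← h1]
  exact hlt

end SpinChain

end

noncomputable section

namespace SpinChain

variable {κ : ℕ} [NeZero κ]

/-! ### Convergence of norms for local sequences -/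

theorem leadClass_eq_coe_localBinf {F : LeadAlg κ} {f : LocalAlg κ} (h : lead f = F) :
    leadClass F = localBinf f := by
  rw [← h, leadClass_lead, coe_localBinf]

/-- Composed with the map from polynomials to classes, a character is an algebra homomorphism on
polynomials, hence evaluation at a point. -/
theorem character_localBinf (χ : Binf κ →⋆ₐ[ℂ] ℂ) {f : LocalAlg κ} {P : IrrPoly κ}
    (h : lead f = leadPoly P) :
    χ (localBinf f) = MvPolynomial.eval (fun b => χ (localBinf (gammaLocal b.elt))) P := by
  let Ψ : IrrPoly κ →ₐ[ℂ] Binf κ := (leadClass.comp leadPoly).codRestrict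
    (Binf κ).toSubalgebra fun Q => by
      obtain ⟨g, hg⟩ := lead_surjective (leadPoly Q)
      change leadClass (leadPoly Q) ∈ Binf κ
      rw [leadClass_eq_coe_localBinf hg]
      exact (localBinf g).2
  have hΨ : ∀ {g : LocalAlg κ} {Q : IrrPoly κ}, lead g = leadPoly Q → Ψ Q = localBinf g :=
    fun hg => Subtype.ext (leadClass_eq_coe_localBinf hg)
  have hχ : (χ : Binf κ →ₐ[ℂ] ℂ).comp Ψ =
      MvPolynomial.aeval fun b => χ (localBinf (gammaLocal b.elt)) := by
    refine MvPolynomial.algHom_ext fun b => ?_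
    rw [MvPolynomial.aeval_X, ← hΨ (leadPoly_X b).symm]
    rfl
  rw [← hΨ h]
  exact DFunLike.congr_fun hχ P

/-- Lower semicontinuity, the substantial half of the continuity of the norm. A character attaining
the norm is evaluation of `P` at a point `μ`. A vector state of a chain of length `L` nearly
reproduces the relevant coordinates of `μ`, and its periodic repetition carries them to all long
chains, where the expectation of `f` is asymptotically a value of `P` near `μ` and is bounded by the
norm of `f`. -/
theorem eventually_lt_norm_of_lt_norm_localClass (f : LocalAlg κ) {r : ℝ}
    (hr : r < ‖localClass f‖) : ∀ᶠ N in atTop, r < ‖f.1 N‖ := by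
  obtain ⟨P, hP⟩ := leadPoly_surjective (lead f)
  obtain ⟨χ, hχ⟩ := exists_starAlgHom_norm_eq binf_mul_comm (localBinf f)
  let μ : IrrIndex κ → ℂ := fun b => χ (localBinf (gammaLocal b.elt))
  have hμ : ‖MvPolynomial.eval μ P‖ = ‖localClass f‖ := by
    rw [← character_localBinf χ hP.symm, hχ]
    rfl
  obtain ⟨s, hrs, hs⟩ := exists_between hr
  have hopen : IsOpen {ν : IrrIndex κ → ℂ | s < ‖MvPolynomial.eval ν P‖} :=
    isOpen_lt continuous_const (MvPolynomial.continuous_eval P).norm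
  -- In the product topology only finitely many coordinates have to be close to those of `μ`.
  obtain ⟨I, u, hu, hsub⟩ := isOpen_pi_iff.1 hopen μ (by rw [Set.mem_ofPred_eq, hμ]; exact hs)
  obtain ⟨η, hη, hball⟩ : ∃ η > 0, ∀ b ∈ I, Metric.ball (μ b) η ⊆ u b := by
    choose! ε hε hball using fun b (hb : b ∈ I) => Metric.isOpen_iff.1 (hu b hb).1 _ (hu b hb).2
    rcases I.eq_empty_or_nonempty with rfl | hI
    · exact ⟨1, one_pos, by simp⟩
    · exact ⟨I.inf' hI ε, (Finset.lt_inf'_iff hI).2 hε, fun b hb =>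
        (Metric.ball_subset_ball (Finset.inf'_le _ hb)).trans (hball b hb)⟩
  -- One third each for the windows crossing block ends (`L` large), for the approximation of `χ` by
  -- a vector state, and for the incomplete last block (`N` large).
  have hη3 : 0 < η / 3 := by positivity
  have hsmall : ∀ c : ℝ, ∀ᶠ N : ℕ+ in atTop, c / ((N : ℕ) : ℝ) < η / 3 := fun c => by
    have := (tendsto_inv_natCast.const_mul c).eventually_lt_const
      (by rw [mul_zero]; exact hη3 : c * 0 < η / 3)
    simpa only [div_eq_mul_inv] using this
  have hK : ∀ᶠ L : ℕ+ in atTop, ∀ b ∈ I, b.degree ≤ (L : ℕ) ∧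
      2 * (b.degree : ℝ) * ‖b.elt‖ / ((L : ℕ) : ℝ) < η / 3 := by
    rw [Filter.eventually_all_finset]
    exact fun b _ => (eventually_le_pnat _).and (hsmall _)
  obtain ⟨K, hK⟩ := eventually_atTop.1 hK
  obtain ⟨L, hL, v, hv, hvec⟩ := exists_vector_of_character χ I (fun b => gammaLocal b.elt) hη3 K
  obtain ⟨ρ, c, hc, hρ, hval⟩ := exists_density_of_vector v hv
  have hω := isDispersionFree_blockState L.pos le_rfl hρ hc
  have hlim := (hω.tendsto_sub_eval P hP.symm).norm
  rw [norm_zero] at hlim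
  have hN : ∀ᶠ N : ℕ+ in atTop, ∀ b ∈ I,
      2 * ((L : ℕ) : ℝ) * ‖b.elt‖ / ((N : ℕ) : ℝ) < η / 3 := by
    rw [Filter.eventually_all_finset]
    exact fun b _ => hsmall _
  filter_upwards [hlim.eventually_lt_const (sub_pos.2 hrs), hN, eventually_ge_atTop L]
    with N h1 h2 hLN
  have h3 : s < ‖MvPolynomial.eval (fun b => blockState L ρ N (gammaBar b.elt N)) P‖ := by
    refine hsub fun b hb => hball b hb ?_
    rw [Metric.mem_ball, dist_eq_norm]
    have e1 := norm_blockState_gammaBar_sub_le hρ hc (hK L hL b hb).1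
      (PNat.coe_le_coe _ _ |>.2 hLN) b.elt
    have e2 := hvec b hb
    rw [hval] at e1
    have e3 := (hK L hL b hb).2
    have e4 := h2 b hb
    calc ‖blockState L ρ N (gammaBar b.elt N) - μ b‖
        ≤ ‖blockState L ρ N (gammaBar b.elt N) -
            inner ℂ v (Matrix.toEuclideanCLM (𝕜 := ℂ) (gammaBar b.elt L) v)‖ +
          ‖inner ℂ v (Matrix.toEuclideanCLM (𝕜 := ℂ) (gammaBar b.elt L) v) - μ b‖ :=
          norm_sub_le_norm_sub_add_norm_sub _ _ _
      _ < η := by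
          have e5 : ‖inner ℂ v (Matrix.toEuclideanCLM (𝕜 := ℂ) (gammaBar b.elt L) v) - μ b‖ <
            η / 3 := e2
          linarith
  have h4 := (isCSState_blockState (N := N) le_rfl hρ hc).norm_map_le (f.1 N)
  have h5 := norm_sub_norm_le (MvPolynomial.eval (fun b => blockState L ρ N (gammaBar b.elt N)) P)
    (blockState L ρ N (f.1 N))
  rw [norm_sub_rev] at h5
  linarith

/-- The norms of an element of the local algebra converge to the norm of its class. -/
theorem tendsto_norm_localClass (f : LocalAlg κ) :
    Tendsto (fun N => ‖f.1 N‖) atTop (𝓝 ‖localClass f‖) := by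
  refine tendsto_order.2 ⟨fun r hr => eventually_lt_norm_of_lt_norm_localClass f hr,
    fun r hr => ?_⟩
  rw [localClass_apply] at hr
  exact AsympAlg.eventually_norm_lt_of_norm_mk_lt hr

end SpinChain

end

noncomputable section

namespace SpinChain

set_option linter.unusedSectionVars false

variable {κ : ℕ} [NeZero κ]

/-! ### The continuous bundle -/

namespace HasClass

variable {a b : ∀ N : ℕ+, TensorPow κ N} {x y : ClassAlg κ}

theorem add (ha : HasClass a x) (hb : HasClass b y) : HasClass (a + b) (x + y) := by
  obtain ⟨f, hf, rfl⟩ := ha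
  obtain ⟨g, hg, rfl⟩ := hb
  exact ⟨f + g, fun N => congrArg₂ (· + ·) (hf N) (hg N), map_add _ _ _⟩

theorem sub (ha : HasClass a x) (hb : HasClass b y) : HasClass (a - b) (x - y) := by
  obtain ⟨f, hf, rfl⟩ := ha
  obtain ⟨g, hg, rfl⟩ := hb
  exact ⟨f - g, fun N => congrArg₂ (· - ·) (hf N) (hg N), map_sub _ _ _⟩

theorem mul (ha : HasClass a x) (hb : HasClass b y) : HasClass (a * b) (x * y) := by
  obtain ⟨f, hf, rfl⟩ := ha
  obtain ⟨g, hg, rfl⟩ := hb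
  exact ⟨f * g, fun N => congrArg₂ (· * ·) (hf N) (hg N), map_mul _ _ _⟩

theorem star (ha : HasClass a x) : HasClass (star a) (star x) := by
  obtain ⟨f, hf, rfl⟩ := ha
  exact ⟨Star.star f, fun N => congrArg Star.star (hf N), rfl⟩

theorem smul (c : ℂ) (ha : HasClass a x) : HasClass (c • a) (c • x) := by
  obtain ⟨f, hf, rfl⟩ := ha
  exact ⟨c • f, fun N => congrArg (c • ·) (hf N), map_smul _ _ _⟩

theorem zero : HasClass (κ := κ) 0 0 := ⟨0, fun _ => rfl, map_zero _⟩

theorem norm_le_of_eventually (ha : HasClass a x) {r : ℝ} (hr : 0 ≤ r)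
    (h : ∀ᶠ N in atTop, ‖a N‖ ≤ r) : ‖x‖ ≤ r := by
  obtain ⟨f, hf, rfl⟩ := ha
  exact AsympAlg.norm_mk_le_of_eventually hr (h.mono fun N hN => by rwa [hf])

theorem eventually_norm_lt (ha : HasClass a x) {r : ℝ} (h : ‖x‖ < r) :
    ∀ᶠ N in atTop, ‖a N‖ < r := by
  obtain ⟨f, hf, rfl⟩ := ha
  exact (AsympAlg.eventually_norm_lt_of_norm_mk_lt h).mono fun N hN => by rwa [← hf]

theorem exists_norm_le (ha : HasClass a x) : ∃ C, ∀ N, ‖a N‖ ≤ C := by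
  obtain ⟨f, hf, rfl⟩ := ha
  exact ⟨‖f‖, fun N => by rw [← hf]; exact lp.norm_apply_le_norm ENNReal.top_ne_zero f N⟩

end HasClass

theorem hasClass_algebraMap (c : ℂ) :
    HasClass (κ := κ) (algebraMap ℂ _ c) (algebraMap ℂ _ c) :=
  ⟨algebraMap ℂ _ c, fun _ => rfl, AlgHomClass.commutes _ c⟩

theorem exists_hasClass_of_eventually {a : ∀ N : ℕ+, TensorPow κ N} {C : ℝ}
    (h : ∀ᶠ N in atTop, ‖a N‖ ≤ C) : ∃ x, HasClass a x := by
  obtain ⟨K, hK⟩ := eventually_atTop.1 h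
  refine ⟨_, ⟨a, memℓp_infty ?_⟩, fun _ => rfl, rfl⟩
  refine ⟨C + ∑ N ∈ Finset.Iio K, ‖a N‖, ?_⟩
  rintro _ ⟨N, rfl⟩
  have hC : 0 ≤ C := (norm_nonneg _).trans (hK K le_rfl)
  rcases lt_or_ge N K with hN | hN
  · exact (Finset.single_le_sum (f := fun N => ‖a N‖) (fun _ _ => norm_nonneg _)
      (Finset.mem_Iio.2 hN)).trans (le_add_of_nonneg_left hC)
  · exact (hK N hN).trans (le_add_of_nonneg_right (Finset.sum_nonneg fun _ _ => norm_nonneg _))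

theorem HasClass.congr {a b : ∀ N : ℕ+, TensorPow κ N} {x : ClassAlg κ} (ha : HasClass a x)
    (h : Tendsto (fun N => ‖b N - a N‖) atTop (𝓝 0)) : HasClass b x := by
  obtain ⟨C, hC⟩ := ha.exists_norm_le
  obtain ⟨y, hy⟩ : ∃ y, HasClass b y := by
    refine exists_hasClass_of_eventually (C := C + 1) ?_
    filter_upwards [h.eventually_lt_const one_pos] with N hN
    have h1 := norm_sub_norm_le (b N) (a N)
    have h2 := hC N
    linarith
  have h0 : ‖y - x‖ ≤ 0 := by
    refine le_of_forall_pos_le_add fun ε hε => ?_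
    rw [zero_add]
    exact (hy.sub ha).norm_le_of_eventually hε.le
      ((h.eventually_lt_const hε).mono fun N hN => hN.le)
  rw [← sub_eq_zero.1 (norm_le_zero_iff.1 h0)]
  exact hy

theorem gammaBar_mem_inv {M : ℕ} (a : TensorPow κ M) (N : ℕ+) : gammaBar a N ∈ Inv κ N := by
  unfold gammaBar
  split_ifs with h
  · exact ⟨_, rfl⟩
  · exact zero_mem _

theorem apply_mem_inv_of_mem_gammaSeqAlg {f : BddSeq κ} (hf : f ∈ GammaSeqAlg κ) (N : ℕ+) :
    f N ∈ Inv κ N := by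
  unfold GammaSeqAlg at hf
  induction hf using StarAlgebra.adjoin_induction with
  | mem f hf =>
    obtain ⟨M, a, rfl⟩ := hf
    exact gammaBar_mem_inv a N
  | algebraMap c => exact (Inv κ N).algebraMap_mem c
  | add f g _ _ h1 h2 => exact add_mem h1 h2
  | mul f g _ _ h1 h2 => exact mul_mem h1 h2
  | star f _ h => exact star_mem h

/-- The elements of `[B]^∞_γ` are approximated by classes of elements of `GammaSeqAlg`. -/
theorem exists_norm_sub_mk_lt (x : Binf κ) {ε : ℝ} (hε : 0 < ε) :
    ∃ f ∈ GammaSeqAlg κ, ‖(x : ClassAlg κ) - AsympAlg.mk f‖ < ε := by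
  obtain ⟨_, ⟨f, hf, rfl⟩, h⟩ := Metric.mem_closure_iff.1 x.2 ε hε
  rw [dist_eq_norm] at h
  exact ⟨f, hf, h⟩

theorem mk_mem_binf {f : BddSeq κ} (hf : f ∈ GammaSeqAlg κ) : AsympAlg.mk f ∈ Binf κ :=
  (GammaClassAlg κ).le_topologicalClosure ⟨f, hf, rfl⟩

/-- The continuous sections of the bundle are the sections whose value at `∞` is the class of their
values at finite points. -/
theorem mem_gammaBundle_iff {A : (∀ N : ℕ+, Inv κ N) × Binf κ} :
    A ∈ gammaBundle κ ↔ HasClass (fun N => (A.1 N : TensorPow κ N)) A.2 := by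
  constructor
  · intro h
    obtain ⟨y, hy⟩ : ∃ y, HasClass (fun N => (A.1 N : TensorPow κ N)) y := by
      obtain ⟨K, A', ⟨f, -, hfN, -⟩, hK, -⟩ := h 1 one_pos
      refine exists_hasClass_of_eventually (C := 1 + ‖f‖) (eventually_atTop.2 ⟨K, fun N hN => ?_⟩)
      have h1 : ‖(A.1 N : TensorPow κ N) - A'.1 N‖ < 1 := hK N hN
      have h2 := lp.norm_apply_le_norm ENNReal.top_ne_zero f N
      rw [hfN] at h1
      have h3 := norm_sub_norm_le (A.1 N : TensorPow κ N) (f N)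
      linarith
    have h0 : ‖y - A.2‖ ≤ 0 := by
      refine le_of_forall_pos_le_add fun ε hε => ?_
      rw [zero_add]
      obtain ⟨K, A', ⟨f, -, hfN, hf⟩, hK, h2⟩ := h (ε / 2) (half_pos hε)
      have h3 : HasClass f (A'.2 : ClassAlg κ) := ⟨f, fun _ => rfl, hf.symm⟩
      have h4 := (hy.sub h3).norm_le_of_eventually (half_pos hε).le
        (eventually_atTop.2 ⟨K, fun N hN => by
          change ‖(A.1 N : TensorPow κ N) - f N‖ ≤ _
          rw [← hfN]
          exact (hK N hN).le⟩)
      have h5 : ‖(A.2 : ClassAlg κ) - A'.2‖ < ε / 2 := h2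
      rw [norm_sub_rev] at h5
      have h6 := norm_sub_le_norm_sub_add_norm_sub y (A'.2 : ClassAlg κ) A.2
      linarith
    rw [← sub_eq_zero.1 (norm_le_zero_iff.1 h0)]
    exact hy
  · intro h ε hε
    obtain ⟨f, hf, hlt⟩ := exists_norm_sub_mk_lt A.2 hε
    have h1 : HasClass f (AsympAlg.mk f) := ⟨f, fun _ => rfl, rfl⟩
    obtain ⟨K, hK⟩ := eventually_atTop.1 ((h.sub h1).eventually_norm_lt hlt)
    exact ⟨K, (fun N => ⟨f N, apply_mem_inv_of_mem_gammaSeqAlg hf N⟩, ⟨_, mk_mem_binf hf⟩),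
      ⟨f, hf, fun _ => rfl, rfl⟩, hK, hlt⟩

variable (κ) in
/-- The continuous sections of the bundle as a ⋆-algebra. -/
def gammaBundleAlg : StarSubalgebra ℂ ((∀ N : ℕ+, Inv κ N) × Binf κ) where
  carrier := gammaBundle κ
  mul_mem' ha hb := by
    rw [mem_gammaBundle_iff] at *
    exact ha.mul hb
  add_mem' ha hb := by
    rw [mem_gammaBundle_iff] at *
    exact ha.add hb
  algebraMap_mem' c := mem_gammaBundle_iff.2 (hasClass_algebraMap c)
  star_mem' ha := by
    rw [mem_gammaBundle_iff] at *
    exact ha.star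

theorem norm_avg_sub_le {N : ℕ+} (x : TensorPow κ N) {y : TensorPow κ N} (hy : y ∈ Inv κ N) :
    ‖avg N x - y‖ ≤ ‖x - y‖ := by
  obtain ⟨z, rfl⟩ := hy
  have h : avg N (avg N z) = avg (κ := κ) N z := avg_of_shift_eq N.ne_zero (shift_avg z)
  conv_lhs => rw [← h, ← map_sub]
  exact norm_avg_le _

/-- Elements of the closure are approximated by invariant sequences, which the contractive average
fixes. It supplies an invariant representative of every class, hence surjectivity of evaluation at
infinity. -/
theorem HasClass.avg {a : ∀ N : ℕ+, TensorPow κ N} {x : Binf κ} (ha : HasClass a x) :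
    HasClass (fun N : ℕ+ => SpinChain.avg N (a N)) (x : ClassAlg κ) := by
  refine ha.congr (tendsto_order.2 ⟨fun r hr => .of_forall fun N => hr.trans_le (norm_nonneg _),
    fun r hr => ?_⟩)
  obtain ⟨f, hf, hlt⟩ := exists_norm_sub_mk_lt x (half_pos hr)
  have h1 : HasClass f (AsympAlg.mk f) := ⟨f, fun _ => rfl, rfl⟩
  filter_upwards [(ha.sub h1).eventually_norm_lt hlt] with N hN
  have h2 : ‖a N - f N‖ < r / 2 := hN
  have h3 := norm_avg_sub_le (a N) (apply_mem_inv_of_mem_gammaSeqAlg hf N)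
  have h4 := norm_sub_le_norm_sub_add_norm_sub (SpinChain.avg N (a N)) (f N) (a N)
  rw [norm_sub_rev (f N)] at h4
  linarith

/-- Approximation in norm extends the convergence from local sequences to the closure. -/
theorem HasClass.tendsto_norm {a : ∀ N : ℕ+, TensorPow κ N} {x : Binf κ} (ha : HasClass a x) :
    Tendsto (fun N => ‖a N‖) atTop (𝓝 ‖(x : ClassAlg κ)‖) := by
  refine Metric.tendsto_nhds.2 fun ε hε => ?_
  have hε3 : 0 < ε / 3 := by positivity
  obtain ⟨f, hf, hlt⟩ := exists_norm_sub_mk_lt x hε3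
  have h1 : HasClass f (AsympAlg.mk f) := ⟨f, fun _ => rfl, rfl⟩
  have h2 : Tendsto (fun N => ‖f N‖) atTop (𝓝 ‖AsympAlg.mk f‖) :=
    tendsto_norm_localClass ⟨_, isLocalSeq_of_mem_gammaSeqAlg hf⟩
  filter_upwards [(ha.sub h1).eventually_norm_lt hlt, Metric.tendsto_nhds.1 h2 _ hε3] with N h3 h4
  have h5 : ‖a N - f N‖ < ε / 3 := h3
  rw [Real.dist_eq] at h4 ⊢
  have h6 := abs_norm_sub_norm_le (a N) (f N)
  have h7 := abs_norm_sub_norm_le (x : ClassAlg κ) (AsympAlg.mk f)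
  rw [abs_sub_lt_iff] at h4 ⊢
  rw [abs_sub_le_iff] at h6 h7
  constructor <;> linarith

theorem isContinuousBundle_gammaBundle : IsContinuousBundle (gammaBundle κ) where
  isStarSubalgebra := ⟨gammaBundleAlg κ, rfl⟩
  eval_surjective N x := by
    let s : ∀ N' : ℕ+, Inv κ N' := fun N' => if h : N = N' then h ▸ x else 0
    refine ⟨(s, 0), mem_gammaBundle_iff.2 (HasClass.zero.congr ?_), dif_pos rfl⟩
    refine tendsto_const_nhds.congr' ?_
    filter_upwards [eventually_gt_atTop N] with N' hN'
    have h : s N' = 0 := dif_neg hN'.ne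
    simp [h]
  eval_infty_surjective x := by
    obtain ⟨f, hf⟩ := AsympAlg.mk_surjective (x : ClassAlg κ)
    have h : HasClass f (x : ClassAlg κ) := ⟨f, fun _ => rfl, hf⟩
    exact ⟨(fun N => ⟨avg N (f N), _, rfl⟩, x), mem_gammaBundle_iff.2 h.avg, rfl⟩
  complete s hs ε hε := by
    obtain ⟨t, ht, h1, h2⟩ := hs (ε / 2) (half_pos hε)
    obtain ⟨K, A', hA', hK, hinf⟩ := ht (ε / 2) (half_pos hε)
    refine ⟨K, A', hA', fun N hN => ?_, ?_⟩
    · have h3 := norm_sub_le_norm_sub_add_norm_sub (s.1 N) (t.1 N) (A'.1 N)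
      have h4 := h1 N
      have h5 := hK N hN
      linarith
    · have h3 := norm_sub_le_norm_sub_add_norm_sub s.2 t.2 A'.2
      linarith
  smul_mem α αinf hα s hs := by
    rw [mem_gammaBundle_iff] at *
    obtain ⟨C, hC⟩ := hs.exists_norm_le
    refine (hs.smul αinf).congr ?_
    have h1 : Tendsto (fun N => ‖α N - αinf‖ * C) atTop (𝓝 0) := by
      have := (tendsto_iff_norm_sub_tendsto_zero.1 hα).mul_const C
      rwa [zero_mul] at this
    refine squeeze_zero (fun _ => norm_nonneg _) (fun N => ?_) h1
    have h2 : α N • (s.1 N : TensorPow κ N) - αinf • (s.1 N : TensorPow κ N) =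
      (α N - αinf) • (s.1 N : TensorPow κ N) := (sub_smul _ _ _).symm
    change ‖α N • (s.1 N : TensorPow κ N) - αinf • (s.1 N : TensorPow κ N)‖ ≤ _
    rw [h2, norm_smul]
    exact mul_le_mul_of_nonneg_left (hC N) (norm_nonneg _)
  norm_continuous s hs := (mem_gammaBundle_iff.1 hs).tendsto_norm

end SpinChain

end

noncomputable section

namespace SpinChain

open scoped Fin.CommRing

set_option linter.unusedSectionVars false

variable {κ : ℕ} [NeZero κ]

/-! ### Hermiticity and surjectivity of the quantization maps -/

theorem star_list_prod {R : Type*} [Monoid R] [StarMul R] (l : List R) :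
    star l.prod = (l.map star).reverse.prod := by
  induction l with
  | nil => exact star_one R
  | cons x l ih => simp [ih]

/-- The adjoint reverses each product, which is harmless since factors on disjoint windows commute.
-/
theorem star_placementSum {N : ℕ} [NeZero N] {ℓ : ℕ} (d : Fin ℓ → ℕ)
    (a : ∀ k, TensorPow κ (d k)) :
    star (placementSum N d a) = placementSum N d fun k => star (a k) := by
  classical
  rw [placementSum_apply, placementSum_apply, star_smul, star_sum, star_inv₀, star_pow]
  congr 1
  · simp
  refine Finset.sum_congr rfl fun p _ => ?_
  split_ifs with hp
  · rw [star_list_prod, List.map_ofFn]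
    refine (List.Perm.prod_eq' (List.reverse_perm _) ?_).trans ?_
    · rw [List.pairwise_reverse, List.pairwise_ofFn]
      intro i j hij
      simp only [Function.comp, ← place_star]
      exact hp.commute hij.ne' _ _
    · congr 2
      funext k
      exact (place_star _ _).symm
  · exact star_zero _

/-- Adjoints of basis elements are irreducible but need not be basis elements, so they are expanded
again. -/
theorem exists_irrPoly_star (P : IrrPoly κ) :
    ∃ P' : IrrPoly κ, ∀ N : ℕ+, canonical N P' = star (canonical N P) := by
  induction P using MvPolynomial.induction_on' with
  | monomial m c =>
    obtain ⟨ℓ, g, hg⟩ := monomial_one_eq_prod_X m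
    have h : MvPolynomial.monomial m c = c • ∏ k, (MvPolynomial.X (g k) : IrrPoly κ) := by
      rw [← hg, MvPolynomial.smul_monomial, smul_eq_mul, mul_one]
    obtain ⟨P', -, hP'⟩ := exists_irrPoly_of_pos (fun k => (g k).order)
      (fun k => star (g k).elt) fun k => star_mem_irrSubmodule (g k).elt_mem
    refine ⟨star c • P', fun N => ?_⟩
    rw [h, map_smul, map_smul, star_smul, canonical_prod_X, eltSum, star_placementSum, hP']
  | add P Q hP hQ =>
    obtain ⟨P', hP'⟩ := hP
    obtain ⟨Q', hQ'⟩ := hQ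
    exact ⟨P' + Q', fun N => by rw [map_add, map_add, star_add, hP', hQ']⟩

theorem gammaBar_self {N : ℕ+} {b : TensorPow κ N} (hb : b ∈ Inv κ N) : gammaBar b N = b := by
  have h : place (N : ℕ) 0 b = b := (castTensorPow_eq_place rfl b).symm
  rw [gammaBar_eq le_rfl, ← avg_place (0 : Fin N), h]
  exact avg_of_shift_eq N.ne_zero (mem_range_avg.1 hb)

/-- A single block of length at most `N` never overlaps itself, so no position is excluded. -/
theorem placementSum_one_eq_gammaBar {N : ℕ} [NeZero N] {m : ℕ} (h : m ≤ N) (b : TensorPow κ m) :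
    placementSum N (fun _ : Fin 1 => m) (fun _ => b) = gammaBar b N := by
  classical
  have hno : ∀ p : Fin 1 → Fin N, NonOverlap (fun _ : Fin 1 => m) p := fun p => by
    rintro ⟨i, x⟩ ⟨j, y⟩ hxy
    obtain rfl := Subsingleton.elim i j
    exact congrArg _ (cycSite_injective h (p i) hxy)
  rw [placementSum_apply, gammaBar_eq h, pow_one,
    ← (Equiv.funUnique (Fin 1) (Fin N)).sum_comp fun p => place N p b]
  congr 1
  refine Finset.sum_congr rfl fun p _ => ?_
  rw [if_pos (hno p)]
  simp

/-- An invariant element is its own γ-average of degree `N`. Its irreducible components have degree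
at most `N`, the range in which their placement sums at `N` are γ-averages, so a polynomial of
degree at most one suffices. -/
theorem exists_canonical_eq {N : ℕ+} {b : TensorPow κ N} (hb : b ∈ Inv κ N) :
    ∃ P : IrrPoly κ, canonical N P = b := by
  obtain ⟨c, a, ha, h⟩ := exists_sum_irr b
  choose P _ hP using fun m => exists_irrPoly_of_pos (fun _ : Fin 1 => m) (fun _ => a m)
    fun _ => ha m
  refine ⟨c • 1 + ∑ m ∈ Finset.range N, P m, ?_⟩
  rw [← gammaBar_self hb, h N N.pos le_rfl, map_add, map_smul, canonical_one, map_sum]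
  congr 1
  refine Finset.sum_congr rfl fun m hm => ?_
  rw [hP, placementSum_one_eq_gammaBar (Finset.mem_range.1 hm)]

theorem IrrFamily.canonicalSeq_mem_inv (F : IrrFamily κ) (N : ℕ+) : F.canonicalSeq N ∈ Inv κ N := by
  unfold IrrFamily.canonicalSeq
  split_ifs
  · exact (Inv κ N).smul_mem (sum_mem fun j _ => ⟨_, rfl⟩) _
  · exact zero_mem _

theorem canonical_mem_inv (P : IrrPoly κ) (N : ℕ+) : canonical N P ∈ Inv κ N := by
  obtain ⟨n, c, F, -, h⟩ := isCanonicalRep_iff.2 ⟨P, rfl, fun N => rfl⟩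
  have h1 : canonical N P = _ := h N
  rw [h1]
  exact sum_mem fun i _ => (Inv κ N).smul_mem ((F i).canonicalSeq_mem_inv N) _

end SpinChain

end

noncomputable section

namespace SpinChain

set_option linter.unusedSectionVars false

variable {κ : ℕ} [NeZero κ]

/-! ### The dense Poisson algebra and the quantization maps -/

variable (κ) in
/-- `localClass` with values in the dense subalgebra of `[B]^∞_γ`. -/
def localDense : LocalAlg κ →⋆ₐ[ℂ] BinfDense κ :=
  localBinf.codRestrict (BinfDense κ) localClass_mem

theorem coe_localDense (f : LocalAlg κ) :
    ((localDense κ f : Binf κ) : ClassAlg κ) = localClass f := rfl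

theorem localDense_eq_iff {f g : LocalAlg κ} :
    localDense κ f = localDense κ g ↔ localClass f = localClass g :=
  ⟨fun h => congrArg (fun x : BinfDense κ => ((x : Binf κ) : ClassAlg κ)) h,
    fun h => Subtype.ext (Subtype.ext h)⟩

theorem localDense_surjective : Function.Surjective (localDense κ) := fun x => by
  obtain ⟨f, hf⟩ := mem_gammaClassAlg_iff.1 x.2
  exact ⟨f, Subtype.ext (Subtype.ext hf)⟩

theorem binfDense_mul_comm (x y : BinfDense κ) : x * y = y * x :=
  Subtype.ext (binf_mul_comm _ _)

theorem localDense_canonicalLocal_bijective :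
    Function.Bijective fun P : IrrPoly κ => localDense κ (canonicalLocal P) := by
  constructor
  · intro P P' h
    have h1 : localClass (canonicalLocal P) = localClass (canonicalLocal P') :=
      localDense_eq_iff.1 h
    rw [localClass_canonicalLocal, localClass_canonicalLocal, ← sub_eq_zero, ← map_sub,
      ← map_sub] at h1
    exact sub_eq_zero.1 (leadClass_leadPoly_injective h1)
  · intro x
    obtain ⟨f, rfl⟩ := localDense_surjective x
    obtain ⟨P, hP⟩ := leadPoly_surjective (lead f)
    refine ⟨P, localDense_eq_iff.2 ?_⟩
    rw [localClass_canonicalLocal, hP, leadClass_lead]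

variable (κ) in
/-- The polynomials parametrize the dense subalgebra of `[B]^∞_γ`. -/
def polyEquiv : IrrPoly κ ≃ₗ[ℂ] BinfDense κ :=
  .ofBijective ((localDense κ).toAlgHom.toLinearMap ∘ₗ canonicalLocal)
    localDense_canonicalLocal_bijective

variable (κ) in
/-- The canonical representative of a class, as a local sequence. -/
def canonicalRep : BinfDense κ →ₗ[ℂ] LocalAlg κ := canonicalLocal ∘ₗ (polyEquiv κ).symm.toLinearMap

theorem localDense_canonicalRep (x : BinfDense κ) : localDense κ (canonicalRep κ x) = x :=
  (polyEquiv κ).apply_symm_apply x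

theorem isCanonicalRep_iff_eq {a : ∀ N : ℕ+, TensorPow κ N} {x : BinfDense κ} :
    IsCanonicalRep a ((x : Binf κ) : ClassAlg κ) ↔ a = (canonicalRep κ x).1 := by
  rw [isCanonicalRep_iff]
  constructor
  · rintro ⟨P, hP, ha⟩
    have h : polyEquiv κ P = x :=
      Subtype.ext (Subtype.ext ((localClass_canonicalLocal P).trans hP))
    rw [← h]
    change a = (canonicalLocal ((polyEquiv κ).symm (polyEquiv κ P))).1
    rw [LinearEquiv.symm_apply_apply]
    exact funext fun N => (ha N).symm
  · rintro rfl
    refine ⟨(polyEquiv κ).symm x, ?_, fun N => rfl⟩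
    rw [← localClass_canonicalLocal]
    exact congrArg (fun x : BinfDense κ => ((x : Binf κ) : ClassAlg κ)) (localDense_canonicalRep x)

theorem canonicalRep_mem_inv (x : BinfDense κ) (N : ℕ+) : (canonicalRep κ x).1 N ∈ Inv κ N :=
  canonical_mem_inv _ N

variable (κ) in
/-- The quantization maps. -/
def quantize (N : ℕ+) : BinfDense κ →ₗ[ℂ] Inv κ N where
  toFun x := ⟨(canonicalRep κ x).1 N, canonicalRep_mem_inv x N⟩
  map_add' x y :=
    Subtype.ext (congrArg (fun f : LocalAlg κ => f.1 N) (map_add (canonicalRep κ) x y))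
  map_smul' c x :=
    Subtype.ext (congrArg (fun f : LocalAlg κ => f.1 N) (map_smul (canonicalRep κ) c x))

theorem coe_quantize (N : ℕ+) (x : BinfDense κ) :
    (quantize κ N x : TensorPow κ N) = (canonicalRep κ x).1 N := rfl

theorem canonicalRep_star (x : BinfDense κ) : canonicalRep κ (star x) = star (canonicalRep κ x) := by
  obtain ⟨P', hP'⟩ := exists_irrPoly_star ((polyEquiv κ).symm x)
  have h : canonicalLocal P' = star (canonicalRep κ x) := Subtype.ext (funext hP')
  have h2 : polyEquiv κ P' = star x := by
    change localDense κ (canonicalLocal P') = _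
    rw [h, map_star, localDense_canonicalRep]
  rw [← h, ← h2]
  exact congrArg canonicalLocal ((polyEquiv κ).symm_apply_apply P')

theorem quantize_surjective (N : ℕ+) : Function.Surjective (quantize κ N) := fun b => by
  obtain ⟨P, hP⟩ := exists_canonical_eq b.2
  refine ⟨polyEquiv κ P, Subtype.ext ?_⟩
  rw [coe_quantize]
  change canonical N ((polyEquiv κ).symm (polyEquiv κ P)) = _
  rw [LinearEquiv.symm_apply_apply, hP]

/-! ### The Poisson bracket -/

/-- The rescaled commutator `i N [x, y]` in `B^N`. -/
def scaledCommutator (N : ℕ+) (x y : TensorPow κ N) : TensorPow κ N :=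
  (Complex.I * ((N : ℕ) : ℂ)) • (x * y - y * x)

theorem scaledCommutator_skew (N : ℕ+) (x y : TensorPow κ N) :
    scaledCommutator N x y = -scaledCommutator N y x := by
  rw [scaledCommutator, scaledCommutator, ← smul_neg, neg_sub]

theorem scaledCommutator_add_left (N : ℕ+) (x x' y : TensorPow κ N) :
    scaledCommutator N (x + x') y = scaledCommutator N x y + scaledCommutator N x' y := by
  simp only [scaledCommutator]
  rw [← smul_add]
  congr 1
  noncomm_ring

theorem scaledCommutator_smul_left (N : ℕ+) (c : ℂ) (x y : TensorPow κ N) :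
    scaledCommutator N (c • x) y = c • scaledCommutator N x y := by
  simp only [scaledCommutator]
  rw [smul_mul_assoc, mul_smul_comm, ← smul_sub, smul_comm]

theorem scaledCommutator_star (N : ℕ+) (x y : TensorPow κ N) :
    star (scaledCommutator N x y) = scaledCommutator N (star x) (star y) := by
  have hc : star (Complex.I * ((N : ℕ) : ℂ)) = -(Complex.I * ((N : ℕ) : ℂ)) := by simp
  rw [scaledCommutator, scaledCommutator, star_smul, hc, star_sub, star_mul, star_mul, neg_smul,
    ← smul_neg, neg_sub]

theorem scaledCommutator_mul (N : ℕ+) (x y z : TensorPow κ N) :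
    scaledCommutator N x (y * z) = scaledCommutator N x y * z + y * scaledCommutator N x z := by
  simp only [scaledCommutator]
  rw [smul_mul_assoc, mul_smul_comm, ← smul_add]
  congr 1
  noncomm_ring

theorem scaledCommutator_jacobi (N : ℕ+) (x y z : TensorPow κ N) :
    scaledCommutator N x (scaledCommutator N y z) =
      scaledCommutator N (scaledCommutator N x y) z +
        scaledCommutator N y (scaledCommutator N x z) := by
  simp only [scaledCommutator]
  rw [← smul_add]
  congr 1
  simp only [smul_mul_assoc, mul_smul_comm, ← smul_sub, ← smul_add]
  congr 1
  noncomm_ring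

variable (κ) in
/-- The rescaled commutator `i N [f, g]` of local sequences. -/
def localBracket : LocalAlg κ →ₗ[ℂ] LocalAlg κ →ₗ[ℂ] LocalAlg κ :=
  LinearMap.mk₂ ℂ (fun f g => ⟨fun N => scaledCommutator N (f.1 N) (g.1 N),
    ((f.2.commutator g.2).smul Complex.I).congr (.of_forall fun N => (mul_smul _ _ _).symm)⟩)
    (fun f f' g => Subtype.ext (funext fun N =>
      scaledCommutator_add_left N (f.1 N) (f'.1 N) (g.1 N)))
    (fun c f g => Subtype.ext (funext fun N => scaledCommutator_smul_left N c (f.1 N) (g.1 N)))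
    (fun f g g' => Subtype.ext (funext fun N => by
      change scaledCommutator N (f.1 N) (g.1 N + g'.1 N) =
        scaledCommutator N (f.1 N) (g.1 N) + scaledCommutator N (f.1 N) (g'.1 N)
      rw [scaledCommutator_skew, scaledCommutator_add_left, neg_add, ← scaledCommutator_skew,
        ← scaledCommutator_skew]))
    (fun c f g => Subtype.ext (funext fun N => by
      change scaledCommutator N (f.1 N) (c • g.1 N) = c • scaledCommutator N (f.1 N) (g.1 N)
      rw [scaledCommutator_skew, scaledCommutator_smul_left, ← smul_neg,
        ← scaledCommutator_skew]))

theorem localBracket_skew (f g : LocalAlg κ) : localBracket κ f g = -localBracket κ g f :=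
  Subtype.ext (funext fun N => scaledCommutator_skew N (f.1 N) (g.1 N))

theorem localBracket_star (f g : LocalAlg κ) :
    star (localBracket κ f g) = localBracket κ (star f) (star g) :=
  Subtype.ext (funext fun N => scaledCommutator_star N (f.1 N) (g.1 N))

theorem localBracket_leibniz (f g h : LocalAlg κ) :
    localBracket κ f (g * h) = localBracket κ f g * h + g * localBracket κ f h :=
  Subtype.ext (funext fun N => scaledCommutator_mul N (f.1 N) (g.1 N) (h.1 N))

theorem localBracket_jacobi (f g h : LocalAlg κ) :
    localBracket κ f (localBracket κ g h) =
      localBracket κ (localBracket κ f g) h + localBracket κ g (localBracket κ f h) :=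
  Subtype.ext (funext fun N => scaledCommutator_jacobi N (f.1 N) (g.1 N) (h.1 N))

/-- Independence of the monomials in another form: a local sequence that tends to zero has order `1
/ N`. The bracket is well defined on classes because of this. -/
theorem mem_orderIdeal_of_localDense_eq_zero {f : LocalAlg κ} (hf : localDense κ f = 0) :
    f ∈ orderIdeal κ := by
  rw [← map_zero (localDense κ), localDense_eq_iff, map_zero] at hf
  obtain ⟨P, hP⟩ := leadPoly_surjective (lead f)
  rw [← leadClass_lead, ← hP] at hf
  rw [← lead_eq_zero_iff, ← hP, leadClass_leadPoly_injective hf, map_zero]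

/-- The factor `N` can be moved onto `f`, which leaves a commutator of two local sequences, and
classes commute. -/
theorem localDense_localBracket_eq_zero {f : LocalAlg κ} (hf : localDense κ f = 0)
    (g : LocalAlg κ) : localDense κ (localBracket κ f g) = 0 := by
  let h : LocalAlg κ := ⟨_, mem_orderIdeal.1 (mem_orderIdeal_of_localDense_eq_zero hf)⟩
  have h1 : localBracket κ f g = Complex.I • (h * g - g * h) := by
    refine Subtype.ext (funext fun N => ?_)
    change (Complex.I * ((N : ℕ) : ℂ)) • (f.1 N * g.1 N - g.1 N * f.1 N) =
      Complex.I • ((((N : ℕ) : ℂ) • f.1 N) * g.1 N - g.1 N * (((N : ℕ) : ℂ) • f.1 N))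
    rw [smul_mul_assoc, mul_smul_comm, ← smul_sub, mul_smul]
  rw [h1, map_smul, map_sub, map_mul, map_mul, binfDense_mul_comm, sub_self, smul_zero]

theorem localDense_localBracket_congr {f f' g g' : LocalAlg κ}
    (hf : localDense κ f = localDense κ f') (hg : localDense κ g = localDense κ g') :
    localDense κ (localBracket κ f g) = localDense κ (localBracket κ f' g') := by
  have h1 := localDense_localBracket_eq_zero (f := f - f') (by rw [map_sub, hf, sub_self]) g
  have h2 := localDense_localBracket_eq_zero (f := g - g') (by rw [map_sub, hg, sub_self]) f'
  rw [map_sub, LinearMap.sub_apply, map_sub, sub_eq_zero] at h1 h2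
  rw [h1, localBracket_skew, localBracket_skew f' g', map_neg, map_neg, h2]

variable (κ) in
/-- The Poisson bracket on the dense subalgebra of `[B]^∞_γ`. -/
def poissonBracket : BinfDense κ →ₗ[ℂ] BinfDense κ →ₗ[ℂ] BinfDense κ :=
  ((localBracket κ).compl₁₂ (canonicalRep κ) (canonicalRep κ)).compr₂ (localDense κ).toAlgHom.toLinearMap

/-- Arbitrary local representatives may replace the canonical ones, so each identity for the bracket
follows from the one for commutators. -/
theorem poissonBracket_localDense (f g : LocalAlg κ) :
    poissonBracket κ (localDense κ f) (localDense κ g) = localDense κ (localBracket κ f g) :=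
  localDense_localBracket_congr (localDense_canonicalRep _) (localDense_canonicalRep _)

theorem poissonBracket_skew (a b : BinfDense κ) :
    poissonBracket κ a b = -poissonBracket κ b a := by
  obtain ⟨f, rfl⟩ := localDense_surjective a
  obtain ⟨g, rfl⟩ := localDense_surjective b
  rw [poissonBracket_localDense, poissonBracket_localDense, localBracket_skew, map_neg]

set_option maxHeartbeats 1000000 in
theorem poissonBracket_star (a b : BinfDense κ) :
    star (poissonBracket κ a b) = poissonBracket κ (star a) (star b) := by
  obtain ⟨f, rfl⟩ := localDense_surjective a
  obtain ⟨g, rfl⟩ := localDense_surjective b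
  rw [← map_star (localDense κ) f, ← map_star (localDense κ) g, poissonBracket_localDense f g,
    poissonBracket_localDense (star f) (star g), ← map_star (localDense κ), localBracket_star]

set_option maxHeartbeats 1000000 in
theorem poissonBracket_mul (a b c : BinfDense κ) :
    poissonBracket κ a (b * c) = poissonBracket κ a b * c + b * poissonBracket κ a c := by
  obtain ⟨f, rfl⟩ := localDense_surjective a
  obtain ⟨g, rfl⟩ := localDense_surjective b
  obtain ⟨h, rfl⟩ := localDense_surjective c
  rw [← map_mul (localDense κ) g h, poissonBracket_localDense f (g * h),
    poissonBracket_localDense f g, poissonBracket_localDense f h, localBracket_leibniz,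
    map_add (localDense κ), map_mul (localDense κ), map_mul (localDense κ)]

set_option maxHeartbeats 1000000 in
theorem poissonBracket_jacobi (a b c : BinfDense κ) :
    poissonBracket κ a (poissonBracket κ b c) =
      poissonBracket κ (poissonBracket κ a b) c + poissonBracket κ b (poissonBracket κ a c) := by
  obtain ⟨f, rfl⟩ := localDense_surjective a
  obtain ⟨g, rfl⟩ := localDense_surjective b
  obtain ⟨h, rfl⟩ := localDense_surjective c
  rw [poissonBracket_localDense g h, poissonBracket_localDense f (localBracket κ g h),
    poissonBracket_localDense f g, poissonBracket_localDense (localBracket κ f g) h,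
    poissonBracket_localDense f h, poissonBracket_localDense g (localBracket κ f h),
    localBracket_jacobi, map_add (localDense κ)]

theorem dense_binfDense : Dense (BinfDense κ : Set (Binf κ)) := fun x => by
  refine Metric.mem_closure_iff.2 fun ε hε => ?_
  obtain ⟨f, hf, hlt⟩ := exists_norm_sub_mk_lt x hε
  refine ⟨⟨_, mk_mem_binf hf⟩, ⟨f, hf, rfl⟩, ?_⟩
  rw [dist_eq_norm]
  exact hlt

theorem isPoissonStructure_poissonBracket :
    IsPoissonStructure (BinfDense κ) (poissonBracket κ) where
  dense := dense_binfDense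
  skew := poissonBracket_skew
  star_apply := poissonBracket_star
  leibniz := poissonBracket_mul
  jacobi := poissonBracket_jacobi

theorem isGammaBracket_poissonBracket : IsGammaBracket (poissonBracket κ) := by
  intro x y a b ha hb
  obtain rfl := isCanonicalRep_iff_eq.1 ha
  obtain rfl := isCanonicalRep_iff_eq.1 hb
  exact hasClass_localClass (localBracket κ (canonicalRep κ x) (canonicalRep κ y))

theorem isGammaQuantization_quantize : IsGammaQuantization (quantize κ) :=
  fun _ => isCanonicalRep_iff_eq.2 rfl

theorem hasClass_canonicalRep (x : BinfDense κ) :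
    HasClass (canonicalRep κ x).1 ((x : Binf κ) : ClassAlg κ) := by
  have h := hasClass_localClass (canonicalRep κ x)
  rwa [← coe_localDense, localDense_canonicalRep] at h

theorem quantize_star (N : ℕ+) (a : BinfDense κ) : quantize κ N (star a) = star (quantize κ N a) :=
  Subtype.ext (congrArg (fun f : LocalAlg κ => f.1 N) (canonicalRep_star a))

/-- Both are local sequences representing the class of the bracket, so their difference is a null
sequence. -/
theorem tendsto_norm_quantize_sub (a b : BinfDense κ) : Tendsto (fun N : ℕ+ =>
    ‖(canonicalRep κ (poissonBracket κ a b)).1 N -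
      scaledCommutator N ((canonicalRep κ a).1 N) ((canonicalRep κ b).1 N)‖) atTop (𝓝 0) := by
  refine (localClass_eq_iff (f := canonicalRep κ (poissonBracket κ a b))
    (g := localBracket κ (canonicalRep κ a) (canonicalRep κ b))).1 ?_
  exact localDense_eq_iff.1 (localDense_canonicalRep _)

theorem range_quantize (N : ℕ+) : Set.range (quantize κ N) = Set.univ :=
  (quantize_surjective N).range_eq

theorem isStrictDeformationQuantization_quantize :
    IsStrictDeformationQuantization (BinfDense κ) (poissonBracket κ) (gammaBundle κ) (quantize κ)
      (BinfDense κ).subtype.toLinearMap where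
  commutative := binf_mul_comm
  poisson := isPoissonStructure_poissonBracket
  bundle := isContinuousBundle_gammaBundle
  infty_apply _ := rfl
  hermitian := quantize_star
  continuous_section a := mem_gammaBundle_iff.2 (hasClass_canonicalRep a)
  dirac_groenewold_rieffel := tendsto_norm_quantize_sub
  strict N := ⟨⟨⊤, StarSubalgebra.coe_top.trans (range_quantize N).symm⟩,
    (quantize_surjective N).denseRange⟩

end SpinChain

theorem theorem3p13 (κ : ℕ) [NeZero κ] :
    (∀ x : SpinChain.BinfDense κ,
      ∃! a : ∀ N : ℕ+, SpinChain.TensorPow κ N, SpinChain.IsCanonicalRep a (x : SpinChain.ClassAlg κ)) ∧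
    ∃ (br : SpinChain.BinfDense κ →ₗ[ℂ] SpinChain.BinfDense κ →ₗ[ℂ] SpinChain.BinfDense κ)
      (Q : ∀ N : ℕ+, SpinChain.BinfDense κ →ₗ[ℂ] SpinChain.Inv κ N),
      SpinChain.IsGammaBracket br ∧
      SpinChain.IsGammaQuantization Q ∧
      IsStrictDeformationQuantization (SpinChain.BinfDense κ) br (SpinChain.gammaBundle κ) Q
        (SpinChain.BinfDense κ).subtype.toLinearMap ∧
      ∀ N, Function.Surjective (Q N) :=
  ⟨fun x => ⟨(SpinChain.canonicalRep κ x).1, (SpinChain.isCanonicalRep_iff_eq (κ := κ) (x := x)).2 rfl,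
      fun _ h => (SpinChain.isCanonicalRep_iff_eq (κ := κ) (x := x)).1 h⟩,
    SpinChain.poissonBracket κ, SpinChain.quantize κ, SpinChain.isGammaBracket_poissonBracket,
    SpinChain.isGammaQuantization_quantize, SpinChain.isStrictDeformationQuantization_quantize,
    SpinChain.quantize_surjective⟩

end
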